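/- **Setting.** Along a sequence indexed by $m\to\infty$ let $n=n_m$, $T=T_m$, $d=d_m\ge 1$ be integers with $nT\to\infty$ (either of $n,T$ may stay bounded). For each $m$ the responses $Y_t\in\mathbb{R}^n$, $t=1,\dots,T$, follow the mutual influence regression model $Y_t=B_t(\lambda_0)Y_t+\varepsilon_t$, where $B_t(\lambda)=\sum_{k=1}^d\lambda_kW_k^{(t)}$ with known non-random $n\times n$ matrices $W_k^{(t)}$ (for instance row-normalized similarity matrices). Put $\Delta_t(\lambda)=I_n-B_t(\lambda)$, $\theta=(\lambda^\top,\sigma^2)^\top$, $\theta_0=(\lambda_0^\top,\sigma_0^2)^\top$, where $\lambda_0\in\mathbb{R}^d$ may depend on $m$ and $\sigma_0^2>0$ is fixed. The quasi-loglikelihood is $$\ell(\theta)=-\tfrac{nT}{2}\log(2\pi)-\tfrac{nT}{2}\log\sigma^2+\sum_{t}\log|\det\Delta_t(\lambda)|-\tfrac1{2\sigma^2}\sum_tY_t^\top\Delta_t(\lambda)^\top\Delta_t(\lambda)Y_t .$$ With $\hat\sigma^2(\lambda)=(nT)^{-1}\sum_tY_t^\top\Delta_t(\lambda)^\top\Delta_t(\lambda)Y_t$,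 the concentrated quasi-loglikelihood is $\ell_c(\lambda)=-\tfrac{nT}2\log(2\pi)-\tfrac{nT}2-\tfrac{nT}2\log\hat\sigma^2(\lambda)+\sum_t\log|\det\Delta_t(\lambda)|$. Let $\|\cdot\|$ be the spectral (for vectors: Euclidean) norm, $\|\cdot\|_F$ the Frobenius norm, $\|\cdot\|_R$ the maximal absolute row sum and $\|x\|_1=\sum_k|x_k|$. All constants below do not depend on $m$. **Conditions.** (C1) The vectors $\varepsilon_1,\dots,\varepsilon_T$ are iid with mean $0$ and covariance $\sigma_0^2I_n$. There is $K$ with $(E|\varepsilon_{it}|^\psi)^{1/\psi}\le K\psi$ for all $\psi\ge1$, $i$, $t$. Moreover $E\prod_i\varepsilon_{it}^{e_i}=\prod_iE\varepsilon_{it}^{e_i}$ for all $t$ and all integers $e_i\ge0$ with $\sum_ie_i\le8$. In addition, either the components $\varepsilon_{1t},\dots,\varepsilon_{nt}$ are mutually independent for every $t$ and $m$, or $T\to\infty$. (C2)–(C3) Let $\Lambda=\{\lambda\in\mathbb{R}^d:\|\lambda\|_1<1-\varsigma\}$ with $\varsigma\in(0,1)$. There are $r_0>0$ and $C_w<\infty$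 such that every $\lambda$ with $\|\lambda-\lambda_0\|_1<r_0$ lies in $\Lambda$ and, for all $t$ and $k$, $\Delta_t(\lambda)$ is invertible and $\|W_k^{(t)}\|_R+\|W_k^{(t)\top}\|_R+\|\Delta_t(\lambda)^{-1}\|_R+\|\{\Delta_t(\lambda)^{\top}\}^{-1}\|_R\le C_w$. (C4) There are positive definite $(d+1)\times(d+1)$ matrices $\mathcal I(\theta_0)$ and $\mathcal J(\theta_0)$ (depending on $m$) whose smallest eigenvalues are bounded away from $0$ and whose largest eigenvalues are $O(d)$. They satisfy $\|\mathcal I_{nT}(\theta_0)-\mathcal I(\theta_0)\|_F\to0$ and $\|\mathcal J_{nT}(\theta_0)-\mathcal J(\theta_0)\|\to0$, where $\mathcal I_{nT}(\theta_0)=-(nT)^{-1}E\{\partial^2\ell(\theta_0)/\partial\theta\partial\theta^\top\}$ and $\mathcal J_{nT}(\theta_0)=(nT)^{-1}\mathrm{var}\{\partial\ell(\theta_0)/\partial\theta\}$. (C5) $d=o\{(nT)^{1/4}\}$, and the number of non-zero entries of $\lambda_0$ is bounded. **Estimator.** A quasi-maximum likelihood estimate is a $\theta=(\lambda^\top,\sigma^2)^\top$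 such that $\lambda\in\Lambda$ is a local maximizer of $\ell_c$ over $\Lambda$, $\sigma^2=\hat\sigma^2(\lambda)$ and $\sigma^2>0$. **Theorem 1.** Under (C1)–(C5) there is $r>0$ such that, with probability tending to one, there is exactly one quasi-maximum likelihood estimate with $\|\lambda-\lambda_0\|_1\le r/d$. Let $\hat\theta=(\hat\lambda^\top,\hat\sigma^2)^\top$ be any sequence of random vectors that, with probability tending to one, are quasi-maximum likelihood estimates with $\|\hat\lambda-\lambda_0\|_1\le r/d$. Then $\|\hat\theta-\theta_0\|=O_p\{(d/(nT))^{1/2}\}$. Moreover, for every fixed $M$, all $M\times(d+1)$ matrices $D$ (depending on $m$) with $\|D\|$ bounded, and every $M\times M$ matrix $G(\theta_0)$ with $d^{-1}D\mathcal J(\theta_0)D^\top\to G(\theta_0)$, $$\sqrt{nT/d}\;D\,\mathcal I(\theta_0)(\hat\theta-\theta_0)\ \xrightarrow{d}\ N\bigl(0,G(\theta_0)\bigr).$$ -/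

import Mathlib

open MeasureTheory ProbabilityTheory Filter Topology
open scoped Matrix ENNReal

namespace MIR

noncomputable section

/-! ### Norms of real matrices -/

/-- Spectral (`L₂` operator) norm of a real matrix. -/
def specNorm {p q : ℕ} (A : Matrix (Fin p) (Fin q) ℝ) : ℝ :=
  ‖LinearMap.toContinuousLinearMap (Matrix.toEuclideanLin A)‖

/-- Frobenius norm `{tr (AᵀA)}^{1/2}`. -/
def frobNorm {p q : ℕ} (A : Matrix (Fin p) (Fin q) ℝ) : ℝ :=
  √((Aᵀ * A).trace)

/-- Maximum absolute row sum. -/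
def rowSumNorm {p q : ℕ} (A : Matrix (Fin p) (Fin q) ℝ) : ℝ :=
  ⨆ i, ∑ j, |A i j|

/-- The `ℓ₁` norm of a vector. -/
def l1Norm {d : ℕ} (x : Fin d → ℝ) : ℝ := ∑ k, |x k|

/-- The Euclidean norm of a vector. -/
def l2Norm {d : ℕ} (x : Fin d → ℝ) : ℝ := √(∑ k, x k ^ 2)

/-! ### The model and the quasi-likelihood

`W t k` is the `k`-th similarity matrix at time `t`, `Y t` is the response vector at time `t`.
A parameter `θ = (λ, σ²)` is a vector of length `d + 1` whose last entry is `σ²`. -/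

/-- The mutual influence matrix `λ₁ W₁ + ⋯ + λ_d W_d` at one time point. -/
def influence {n d : ℕ} (W : Fin d → Matrix (Fin n) (Fin n) ℝ) (lam : Fin d → ℝ) :
    Matrix (Fin n) (Fin n) ℝ :=
  ∑ k, lam k • W k

/-- `Δ(λ) = I - (λ₁ W₁ + ⋯ + λ_d W_d)` at one time point. -/
def delta {n d : ℕ} (W : Fin d → Matrix (Fin n) (Fin n) ℝ) (lam : Fin d → ℝ) :
    Matrix (Fin n) (Fin n) ℝ :=
  1 - influence W lam

/-- The parameter vector `(λ, σ²)`. -/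
def mkParam {d : ℕ} (lam : Fin d → ℝ) (s : ℝ) : Fin (d + 1) → ℝ :=
  Fin.snoc (α := fun _ => ℝ) lam s

/-- The component `λ` of `θ`. -/
def lamPart {d : ℕ} (θ : Fin (d + 1) → ℝ) : Fin d → ℝ := fun k => θ k.castSucc

/-- The component `σ²` of `θ`. -/
def varPart {d : ℕ} (θ : Fin (d + 1) → ℝ) : ℝ := θ (Fin.last d)

/-- The residual sum of squares `∑ₜ Yₜᵀ Δₜ(λ)ᵀ Δₜ(λ) Yₜ`. -/
def rss {n T d : ℕ} (W : Fin T → Fin d → Matrix (Fin n) (Fin n) ℝ) (Y : Fin T → Fin n → ℝ)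
    (lam : Fin d → ℝ) : ℝ :=
  ∑ t, Y t ⬝ᵥ (((delta (W t) lam)ᵀ * delta (W t) lam) *ᵥ Y t)

/-- The quasi-loglikelihood `ℓ(θ)`. -/
def quasiLogLik {n T d : ℕ} (W : Fin T → Fin d → Matrix (Fin n) (Fin n) ℝ)
    (Y : Fin T → Fin n → ℝ) (θ : Fin (d + 1) → ℝ) : ℝ :=
  -((n : ℝ) * T / 2) * Real.log (2 * Real.pi) - ((n : ℝ) * T / 2) * Real.log (varPart θ)
    + ∑ t, Real.log |(delta (W t) (lamPart θ)).det|
    - 1 / (2 * varPart θ) * rss W Y (lamPart θ)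

/-- `σ̂²(λ) = (nT)⁻¹ ∑ₜ Yₜᵀ Δₜ(λ)ᵀ Δₜ(λ) Yₜ`. -/
def sigmaHat {n T d : ℕ} (W : Fin T → Fin d → Matrix (Fin n) (Fin n) ℝ)
    (Y : Fin T → Fin n → ℝ) (lam : Fin d → ℝ) : ℝ :=
  ((n : ℝ) * T)⁻¹ * rss W Y lam

/-- The concentrated quasi-loglikelihood `ℓ_c(λ)`. -/
def concLogLik {n T d : ℕ} (W : Fin T → Fin d → Matrix (Fin n) (Fin n) ℝ)
    (Y : Fin T → Fin n → ℝ) (lam : Fin d → ℝ) : ℝ :=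
  -((n : ℝ) * T / 2) * Real.log (2 * Real.pi) - (n : ℝ) * T / 2
    - ((n : ℝ) * T / 2) * Real.log (sigmaHat W Y lam)
    + ∑ t, Real.log |(delta (W t) lam).det|

/-- The parameter space `Λ = {λ : ∑ |λ_k| < 1 - ς}`. -/
def paramSpace (d : ℕ) (ς : ℝ) : Set (Fin d → ℝ) := {lam | l1Norm lam < 1 - ς}

/-- `θ = (λ, σ²)` is a (local) quasi-maximum likelihood estimate: `λ ∈ Λ`, `λ` locally maximizes
`ℓ_c` over `Λ`, `σ² = σ̂²(λ)`, and `σ² > 0`. -/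
structure IsQMLE {n T d : ℕ} (ς : ℝ) (W : Fin T → Fin d → Matrix (Fin n) (Fin n) ℝ)
    (Y : Fin T → Fin n → ℝ) (θ : Fin (d + 1) → ℝ) : Prop where
  mem : lamPart θ ∈ paramSpace d ς
  localMax : IsLocalMaxOn (concLogLik W Y) (paramSpace d ς) (lamPart θ)
  var_eq : varPart θ = sigmaHat W Y (lamPart θ)
  var_pos : 0 < varPart θ

/-- A quasi-maximum likelihood estimate in the neighbourhood `{‖λ - λ₀‖₁ ≤ r / d}` of `λ₀`. -/
def IsNearQMLE {n T d : ℕ} (ς r : ℝ) (W : Fin T → Fin d → Matrix (Fin n) (Fin n) ℝ)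
    (lam0 : Fin d → ℝ) (Y : Fin T → Fin n → ℝ) (θ : Fin (d + 1) → ℝ) : Prop :=
  IsQMLE ς W Y θ ∧ l1Norm (lamPart θ - lam0) ≤ r / d

/-! ### Information matrices -/

/-- The `k`-th partial derivative of `f`. -/
def partialD {p : ℕ} (f : (Fin p → ℝ) → ℝ) (k : Fin p) (θ : Fin p → ℝ) : ℝ :=
  lineDeriv ℝ f θ (Pi.single k 1)

/-- `𝓘_{nT}(θ) = -(nT)⁻¹ E(∂²ℓ(θ)/∂θ∂θᵀ)`. -/
def infoMat {Ω : Type*} [MeasurableSpace Ω] {n T d : ℕ} (μ : Measure Ω)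
    (W : Fin T → Fin d → Matrix (Fin n) (Fin n) ℝ) (Y : Ω → Fin T → Fin n → ℝ)
    (θ : Fin (d + 1) → ℝ) : Matrix (Fin (d + 1)) (Fin (d + 1)) ℝ :=
  Matrix.of fun k l =>
    -((n : ℝ) * T)⁻¹ * ∫ ω, partialD (partialD (quasiLogLik W (Y ω)) l) k θ ∂μ

/-- `𝓙_{nT}(θ) = (nT)⁻¹ var(∂ℓ(θ)/∂θ)`. -/
def scoreVar {Ω : Type*} [MeasurableSpace Ω] {n T d : ℕ} (μ : Measure Ω)
    (W : Fin T → Fin d → Matrix (Fin n) (Fin n) ℝ) (Y : Ω → Fin T → Fin n → ℝ)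
    (θ : Fin (d + 1) → ℝ) : Matrix (Fin (d + 1)) (Fin (d + 1)) ℝ :=
  Matrix.of fun k l =>
    ((n : ℝ) * T)⁻¹ * cov[fun ω => partialD (quasiLogLik W (Y ω)) k θ,
      fun ω => partialD (quasiLogLik W (Y ω)) l θ; μ]

/-! ### Conditions -/

/-- Moment conditions on the errors: the vectors `ε₁, …, ε_T` are iid with mean `0` and
covariance `s • I`, the entries satisfy `ψ⁻¹ (E|ε|^ψ)^{1/ψ} ≤ K` for all `ψ ≥ 1`, and mixed
moments of distinct entries of one vector, of total order at most `8`, factorize. -/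
structure ErrorCond {Ω : Type*} [MeasurableSpace Ω] {n T : ℕ} (μ : Measure Ω)
    (ε : Ω → Fin T → Fin n → ℝ) (s K : ℝ) : Prop where
  meas : ∀ t i, Measurable fun ω => ε ω t i
  indep : iIndepFun (fun t ω => ε ω t) μ
  ident : ∀ t t', IdentDistrib (fun ω => ε ω t) (fun ω => ε ω t') μ μ
  mean : ∀ t i, ∫ ω, ε ω t i ∂μ = 0
  covar : ∀ t i j, ∫ ω, ε ω t i * ε ω t j ∂μ = if i = j then s else 0
  tail : ∀ t i, ∀ ψ : ℝ, 1 ≤ ψ →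
    eLpNorm (fun ω => ε ω t i) (ENNReal.ofReal ψ) μ ≤ ENNReal.ofReal (K * ψ)
  factor : ∀ t, ∀ e : Fin n → ℕ, ∑ i, e i ≤ 8 →
    ∫ ω, ∏ i, ε ω t i ^ e i ∂μ = ∏ i, ∫ ω, ε ω t i ^ e i ∂μ

/-- Conditions on the similarity matrices in the neighbourhood `{‖λ - λ₀‖₁ < r}` of `λ₀`, which
lies in `Λ`. -/
def WeightCond {n T d : ℕ} (W : Fin T → Fin d → Matrix (Fin n) (Fin n) ℝ) (lam0 : Fin d → ℝ)
    (ς r Cw : ℝ) : Prop :=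
  ∀ lam, l1Norm (lam - lam0) < r →
    lam ∈ paramSpace d ς ∧
    ∀ t, IsUnit (delta (W t) lam).det ∧
      ∀ k, rowSumNorm (W t k) + rowSumNorm (W t k)ᵀ + rowSumNorm (delta (W t) lam)⁻¹
        + rowSumNorm ((delta (W t) lam)ᵀ)⁻¹ ≤ Cw

/-- `A` is positive definite with `c ≤ ϱ_min(A)` and `ϱ_max(A) ≤ C`. -/
def EigenBounds {p : ℕ} (A : Matrix (Fin p) (Fin p) ℝ) (c C : ℝ) : Prop :=
  A.PosDef ∧ ∀ x : Fin p → ℝ, c * (x ⬝ᵥ x) ≤ x ⬝ᵥ (A *ᵥ x) ∧ x ⬝ᵥ (A *ᵥ x) ≤ C * (x ⬝ᵥ x)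

end

end MIR

/-!
In the coordinates `δ = λ - λ₀` and with the whitened weights `U_k = W_k Δ(λ₀)⁻¹` the residual
`Δ(λ) Y` is `(I - ∑ δ_k U_k) ε`. Hence everything the likelihood sees of the data are the
quadratic forms `εᵀε`, `εᵀ U_k ε` and `εᵀ U_kᵀ U_l ε`, averaged over the `N = nT` observations.

*Deterministic part.* Call a sample good (`GoodSample`) when these averages are close to their
expectations, in norms weighted by powers of `d`. On a good sample the derivative of `-ℓ_c / N` is
strongly monotone on the ball `‖δ‖₁ ≤ r / d` (`GoodSample.concGrad_strongMono`): its derivative at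
the true parameter is a Schur complement of the information matrix, which is bounded below by the
condition on `𝓘`, and the bounds for row and column sums control how it varies over the ball. So
there is at most one critical point. The maximizer of `ℓ_c` over the closed ball lies in its
interior (`GoodSample.l2Norm_le`) and is therefore an estimate
(`LocalSetup.existsUnique_nearQMLE`). Expanding the likelihood equations once more shows that
`𝓘_{nT}` maps the estimation error to the score divided by `N`, with a relative error that tends
to zero (`GoodSample.abs_infoForm_sub_scoreForm_le`).

*Stochastic part.* The variance of a quadratic form `∑ₜ εₜᵀ Aₜ εₜ` whose matrices have bounded row
and column sums is of order `N` (`ErrorCond.integral_formSum_sq_le`). The moments of order at most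
eight are those of independent components, so the necessary bounds may be computed under the
product of the marginals. With Markov's inequality a sample is good with probability close to one,
since `d⁴ = o(N)`. This gives existence, uniqueness and, because the score divided by `N` has norm
of order `√(d / N)`, the rate.

*Asymptotic normality.* In a fixed direction the score is a single centred quadratic form, which
is a sum of martingale differences: over the time points when `T → ∞`, and over the individual
components when they are independent. A quantitative form of McLeish's central limit theorem
(`MartDiff.norm_integral_exp_sub_le`) gives the limit of its characteristic function, the variance
being that prescribed by `𝓙_{nT}`, and Lévy's continuity theorem concludes.
-/

namespace MIR

/-! ### Functions with moments of all orders -/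

/-- `f` lies in `Lᵖ(μ)` for every finite `p`. This class is an algebra, which reduces every
integrability question below to the one for single errors. -/
def HasMoments {Ω : Type*} {mΩ : MeasurableSpace Ω} (f : Ω → ℝ) (μ : Measure Ω) : Prop :=
  ∀ p : ℝ≥0∞, p ≠ ∞ → MemLp f p μ

namespace HasMoments

variable {Ω : Type*} {mΩ : MeasurableSpace Ω} {μ : Measure Ω} {f g : Ω → ℝ}

lemma integrable (hf : HasMoments f μ) : Integrable f μ :=
  memLp_one_iff_integrable.1 (hf 1 (by simp))

lemma add (hf : HasMoments f μ) (hg : HasMoments g μ) : HasMoments (fun ω => f ω + g ω) μ :=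
  fun p hp => (hf p hp).add (hg p hp)

lemma sub (hf : HasMoments f μ) (hg : HasMoments g μ) : HasMoments (fun ω => f ω - g ω) μ :=
  fun p hp => (hf p hp).sub (hg p hp)

lemma mul (hf : HasMoments f μ) (hg : HasMoments g μ) : HasMoments (fun ω => f ω * g ω) μ := by
  intro p hp
  have h2 : 2 * p ≠ ∞ := ENNReal.mul_ne_top (by simp) hp
  have : ENNReal.HolderTriple (2 * p) (2 * p) p := by
    constructor
    rw [ENNReal.mul_inv (by simp) (by simp), ← add_mul, ENNReal.inv_two_add_inv_two, one_mul]
  exact (hg _ h2).mul' (hf _ h2)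

lemma const [IsFiniteMeasure μ] (c : ℝ) : HasMoments (fun _ => c) μ :=
  fun _ _ => memLp_const c

lemma const_mul (c : ℝ) (hf : HasMoments f μ) : HasMoments (fun ω => c * f ω) μ :=
  fun p hp => (hf p hp).const_mul c

lemma pow [IsFiniteMeasure μ] (hf : HasMoments f μ) (k : ℕ) :
    HasMoments (fun ω => f ω ^ k) μ := by
  induction k with
  | zero => simpa using const (μ := μ) 1
  | succ k ih => simpa [pow_succ] using ih.mul hf

lemma sum {ι : Type*} (s : Finset ι) {F : ι → Ω → ℝ} (h : ∀ i ∈ s, HasMoments (F i) μ) :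
    HasMoments (fun ω => ∑ i ∈ s, F i ω) μ :=
  fun p hp => memLp_finsetSum s fun i hi => h i hi p hp

lemma prod [IsFiniteMeasure μ] {ι : Type*} (s : Finset ι) {F : ι → Ω → ℝ}
    (h : ∀ i ∈ s, HasMoments (F i) μ) : HasMoments (fun ω => ∏ i ∈ s, F i ω) μ := by
  classical
  induction s using Finset.induction_on with
  | empty => simpa using const (μ := μ) 1
  | insert a s ha ih =>
    simp only [Finset.prod_insert ha]
    exact (h a (by simp)).mul (ih fun i hi => h i (by simp [hi]))

lemma indicator {s : Set Ω} (hs : MeasurableSet s) (hf : HasMoments f μ) :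
    HasMoments (s.indicator f) μ :=
  fun p hp => (hf p hp).indicator hs

end HasMoments

/-! ### A quantitative central limit theorem for martingale differences -/

/-- `ξ` is a sequence of martingale differences with moments of all orders: `ξ i` is determined at
time `i + 1` and is orthogonal to everything that is known at time `i`. -/
structure MartDiff {Ω : Type*} {mΩ : MeasurableSpace Ω} (μ : Measure Ω) (ℱ : Filtration ℕ mΩ)
    (ξ : ℕ → Ω → ℝ) : Prop where
  meas : ∀ i, Measurable[ℱ (i + 1)] (ξ i)
  mom : ∀ i, HasMoments (ξ i) μ
  orth : ∀ i (g : Ω → ℝ), Measurable[ℱ i] g → HasMoments g μ → ∫ ω, g ω * ξ i ω ∂μ = 0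

lemma norm_exp_div_sub_exp_le (x : ℝ) :
    ‖Complex.exp (x * Complex.I) / (1 + x * Complex.I) - Real.exp (-x ^ 2 / 2)‖ ≤ 2 * |x| ^ 3 := by
  have hn : 1 ≤ ‖(1 + x * Complex.I : ℂ)‖ := by
    have h := Complex.abs_re_le_norm (1 + x * Complex.I : ℂ)
    simpa using h
  have hne : (1 + x * Complex.I : ℂ) ≠ 0 := by
    intro h; rw [h] at hn; norm_num at hn
  have he : ‖Complex.exp (x * Complex.I)‖ = 1 := Complex.norm_exp_ofReal_mul_I x
  have hr : ‖((Real.exp (-x ^ 2 / 2) : ℝ) : ℂ)‖ ≤ 1 := by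
    rw [Complex.norm_real, Real.norm_eq_abs, abs_of_pos (Real.exp_pos _)]
    exact Real.exp_le_one_iff.2 (by nlinarith [sq_nonneg x])
  rcases le_or_gt 1 |x| with hx | hx
  · have h1 : ‖Complex.exp (x * Complex.I) / (1 + x * Complex.I)‖ ≤ 1 := by
      rw [norm_div, he]
      exact (div_le_one (by linarith)).2 hn
    have h3 : 1 ≤ |x| ^ 3 := one_le_pow₀ hx
    refine (norm_sub_le _ _).trans ?_
    linarith
  · have hxle : |x| ≤ 1 := hx.le
    rw [div_sub' hne, norm_div]
    refine (div_le_self (norm_nonneg _) hn).trans ?_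
    have h1 := Complex.exp_bound (x := x * Complex.I) (by simpa using hxle) (n := 3) (by norm_num)
    have h2 : |Real.exp (-x ^ 2 / 2) - 1 - (-x ^ 2 / 2)| ≤ (-x ^ 2 / 2) ^ 2 := by
      apply Real.abs_exp_sub_one_sub_id_le
      rw [abs_le]
      have := sq_abs x
      constructor <;> nlinarith [abs_nonneg x]
    set r : ℝ := Real.exp (-x ^ 2 / 2) - 1 - (-x ^ 2 / 2) with hrdef
    have hexp : Real.exp (-x ^ 2 / 2) = 1 - x ^ 2 / 2 + r := by rw [hrdef]; ring
    set s : ℂ := Complex.exp (x * Complex.I)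
      - ∑ m ∈ Finset.range 3, (x * Complex.I) ^ m / (m.factorial : ℂ) with hsdef
    have hE : Complex.exp (x * Complex.I) = 1 + x * Complex.I - x ^ 2 / 2 + s := by
      rw [hsdef]
      simp only [Finset.sum_range_succ, Finset.sum_range_zero, Nat.factorial]
      have : (x * Complex.I) ^ 2 = -(x : ℂ) ^ 2 := by rw [mul_pow, Complex.I_sq]; ring
      push_cast
      rw [this]; ring
    rw [hE, hexp]
    have : (1 + x * Complex.I - x ^ 2 / 2 + s - (1 + x * Complex.I) * ((1 - x ^ 2 / 2 + r : ℝ) : ℂ))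
        = s + (x : ℂ) ^ 3 / 2 * Complex.I - (1 + x * Complex.I) * r := by
      push_cast; ring
    rw [this]
    have hs : ‖s‖ ≤ |x| ^ 3 * (4 / 18) := by
      have h1' := h1
      simp [Nat.factorial] at h1'
      norm_num at h1'
      norm_num
      exact h1'
    have hB : ‖(x : ℂ) ^ 3 / 2 * Complex.I‖ = |x| ^ 3 / 2 := by
      simp
    have hC : ‖(1 + x * Complex.I) * (r : ℂ)‖ ≤ |x| ^ 3 / 2 := by
      rw [norm_mul, Complex.norm_real, Real.norm_eq_abs]
      have h4 : ‖(1 + x * Complex.I : ℂ)‖ ≤ 2 := by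
        refine (norm_add_le _ _).trans ?_
        simp; linarith
      have h5 : |r| ≤ |x| ^ 3 / 4 := by
        refine h2.trans ?_
        have : (-x ^ 2 / 2) ^ 2 = |x| ^ 3 * |x| / 4 := by
          rw [← sq_abs x]; ring
        rw [this]
        have : 0 ≤ |x| ^ 3 := by positivity
        nlinarith
      have := abs_nonneg r
      nlinarith [norm_nonneg (1 + x * Complex.I : ℂ)]
    have := norm_sub_le (s + (x : ℂ) ^ 3 / 2 * Complex.I) ((1 + x * Complex.I) * r)
    have := norm_add_le s ((x : ℂ) ^ 3 / 2 * Complex.I)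
    have : 0 ≤ |x| ^ 3 := by positivity
    linarith

lemma norm_prod_sub_prod_le_sum {ι : Type*} (s : Finset ι) (a b : ι → ℂ)
    (ha : ∀ i ∈ s, ‖a i‖ ≤ 1) (hb : ∀ i ∈ s, ‖b i‖ ≤ 1) :
    ‖∏ i ∈ s, a i - ∏ i ∈ s, b i‖ ≤ ∑ i ∈ s, ‖a i - b i‖ := by
  classical
  induction s using Finset.induction_on with
  | empty => simp
  | insert j s hj ih =>
    rw [Finset.prod_insert hj, Finset.prod_insert hj, Finset.sum_insert hj]
    have h1 : a j * ∏ i ∈ s, a i - b j * ∏ i ∈ s, b i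
        = (a j - b j) * ∏ i ∈ s, a i + b j * (∏ i ∈ s, a i - ∏ i ∈ s, b i) := by ring
    rw [h1]
    refine (norm_add_le _ _).trans ?_
    rw [norm_mul, norm_mul]
    have h2 : ‖∏ i ∈ s, a i‖ ≤ 1 := by
      rw [norm_prod]
      exact Finset.prod_le_one (fun _ _ => norm_nonneg _) fun i hi => ha i (by simp [hi])
    have h3 := ih (fun i hi => ha i (by simp [hi])) (fun i hi => hb i (by simp [hi]))
    have h4 := hb j (by simp)
    have := norm_nonneg (a j - b j)
    have := norm_nonneg (∏ i ∈ s, a i - ∏ i ∈ s, b i)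
    nlinarith [norm_nonneg (b j)]

section McLeish

variable {Ω : Type*} {mΩ : MeasurableSpace Ω} {μ : Measure Ω}

/-- The differences, switched off as soon as the sum of the squares exceeds `a`. -/
noncomputable def stopped (ξ : ℕ → Ω → ℝ) (a : ℝ) (j : ℕ) : Ω → ℝ :=
  {ω | ∑ k ∈ Finset.range j, ξ k ω ^ 2 ≤ a}.indicator (ξ j)

variable {ℱ : Filtration ℕ mΩ} {ξ : ℕ → Ω → ℝ}

lemma MartDiff.measurable (h : MartDiff μ ℱ ξ) (i : ℕ) : Measurable (ξ i) :=
  (h.meas i).mono (ℱ.le _) le_rfl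

lemma MartDiff.stopped (h : MartDiff μ ℱ ξ) (a : ℝ) : MartDiff μ ℱ (stopped ξ a) := by
  have hset : ∀ i, MeasurableSet[ℱ i] {ω | ∑ k ∈ Finset.range i, ξ k ω ^ 2 ≤ a} := by
    intro i
    have : Measurable[ℱ i] fun ω => ∑ k ∈ Finset.range i, ξ k ω ^ 2 := by
      refine Finset.measurable_sum _ fun k hk => ?_
      have hk' : k + 1 ≤ i := Finset.mem_range.1 hk
      exact ((h.meas k).mono (ℱ.mono hk') le_rfl).pow_const 2
    exact this measurableSet_Iic
  refine ⟨fun i => ?_, fun i => ?_, fun i g hg hgm => ?_⟩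
  · exact (h.meas i).indicator (ℱ.mono (Nat.le_succ i) _ (hset i))
  · exact (h.mom i).indicator (ℱ.le i _ (hset i))
  · have h1 := h.orth i _ (hg.indicator (hset i)) (hgm.indicator (ℱ.le i _ (hset i)))
    rw [← h1]
    congr 1
    ext ω
    simp only [MIR.stopped, Set.indicator_apply]
    split_ifs <;> simp

/-- The complex exponential martingale `∏ (1 + i ξ_k)`. -/
noncomputable def expMart (ξ : ℕ → Ω → ℝ) (j : ℕ) (ω : Ω) : ℂ :=
  ∏ k ∈ Finset.range j, (1 + ξ k ω * Complex.I)

lemma MartDiff.expMart_aux [IsProbabilityMeasure μ] (h : MartDiff μ ℱ ξ) (j : ℕ) :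
    (Measurable[ℱ j] fun ω => (expMart ξ j ω).re) ∧ (Measurable[ℱ j] fun ω => (expMart ξ j ω).im) ∧
    HasMoments (fun ω => (expMart ξ j ω).re) μ ∧ HasMoments (fun ω => (expMart ξ j ω).im) μ ∧
    ∫ ω, (expMart ξ j ω).re ∂μ = 1 ∧ ∫ ω, (expMart ξ j ω).im ∂μ = 0 := by
  induction j with
  | zero =>
    simp only [expMart, Finset.range_zero, Finset.prod_empty, Complex.one_re, Complex.one_im]
    exact ⟨measurable_const, measurable_const, HasMoments.const _, HasMoments.const _,
      by simp, by simp⟩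
  | succ j ih =>
    obtain ⟨h1, h2, h3, h4, h5, h6⟩ := ih
    have hre : ∀ ω, (expMart ξ (j + 1) ω).re
        = (expMart ξ j ω).re - (expMart ξ j ω).im * ξ j ω := by
      intro ω; simp [expMart, Finset.prod_range_succ]
    have him : ∀ ω, (expMart ξ (j + 1) ω).im
        = (expMart ξ j ω).im + (expMart ξ j ω).re * ξ j ω := by
      intro ω; simp [expMart, Finset.prod_range_succ]; ring
    have m1 := h1.mono (ℱ.mono (Nat.le_succ j)) le_rfl
    have m2 := h2.mono (ℱ.mono (Nat.le_succ j)) le_rfl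
    simp only [hre, him]
    refine ⟨m1.sub (m2.mul (h.meas j)), m2.add (m1.mul (h.meas j)), h3.sub (h4.mul (h.mom j)),
      h4.add (h3.mul (h.mom j)), ?_, ?_⟩
    · rw [integral_sub h3.integrable (h4.mul (h.mom j)).integrable, h5, h.orth j _ h2 h4, sub_zero]
    · rw [integral_add h4.integrable (h3.mul (h.mom j)).integrable, h6, h.orth j _ h1 h3, zero_add]

lemma norm_expMart_sq (ξ : ℕ → Ω → ℝ) (j : ℕ) (ω : Ω) :
    ‖expMart ξ j ω‖ ^ 2 = ∏ k ∈ Finset.range j, (1 + ξ k ω ^ 2) := by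
  rw [expMart, norm_prod, ← Finset.prod_pow]
  refine Finset.prod_congr rfl fun k _ => ?_
  rw [← Complex.normSq_eq_norm_sq, Complex.normSq_apply]
  simp; ring

/-- Switching off the differences keeps the exponential martingale bounded in `L²`: until the
switch its square is at most `e^a`, and the switching step contributes one factor `1 + ξ²`. -/
lemma norm_expMart_stopped_sq_le (ξ : ℕ → Ω → ℝ) {a : ℝ} (ha : 0 ≤ a) (j : ℕ) (ω : Ω) :
    ‖expMart (stopped ξ a) j ω‖ ^ 2
      ≤ Real.exp a * (2 + ∑ k ∈ Finset.range j, ξ k ω ^ 4) := by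
  rw [norm_expMart_sq]
  suffices H : ((∑ k ∈ Finset.range j, ξ k ω ^ 2 ≤ a) →
      ∏ k ∈ Finset.range j, (1 + stopped ξ a k ω ^ 2)
        ≤ Real.exp (∑ k ∈ Finset.range j, ξ k ω ^ 2)) ∧
      (∏ k ∈ Finset.range j, (1 + stopped ξ a k ω ^ 2)
      ≤ Real.exp a * (2 + ∑ k ∈ Finset.range j, ξ k ω ^ 4)) from H.2
  have hsq : ∀ k, stopped ξ a k ω ^ 2 ≤ ξ k ω ^ 2 := by
    intro k
    simp only [stopped, Set.indicator_apply]
    split_ifs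
    · exact le_rfl
    · simpa using sq_nonneg (ξ k ω)
  induction j with
  | zero => simp; nlinarith [Real.one_le_exp ha]
  | succ j ih =>
    obtain ⟨ih1, ih2⟩ := ih
    simp only [Finset.prod_range_succ, Finset.sum_range_succ]
    have hz := hsq j
    have hp : 0 ≤ ∏ k ∈ Finset.range j, (1 + stopped ξ a k ω ^ 2) :=
      Finset.prod_nonneg fun _ _ => by positivity
    constructor
    · intro hle
      have h1 := ih1 (by nlinarith [sq_nonneg (ξ j ω)])
      rw [Real.exp_add]
      refine mul_le_mul h1 ?_ (by positivity) (Real.exp_pos _).le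
      have := Real.add_one_le_exp (ξ j ω ^ 2)
      linarith
    · have h4 : 0 ≤ ∑ k ∈ Finset.range j, ξ k ω ^ 4 := Finset.sum_nonneg fun _ _ => by positivity
      by_cases hA : ∑ k ∈ Finset.range j, ξ k ω ^ 2 ≤ a
      · have h1 := (ih1 hA).trans (Real.exp_le_exp.2 hA)
        have h2 : 1 + stopped ξ a j ω ^ 2 ≤ 2 + (∑ k ∈ Finset.range j, ξ k ω ^ 4 + ξ j ω ^ 4) := by
          nlinarith [sq_nonneg (ξ j ω ^ 2 - 1)]
        exact mul_le_mul h1 h2 (by positivity) (Real.exp_pos _).le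
      · have h0 : stopped ξ a j ω = 0 := Set.indicator_of_notMem (by simpa using hA) _
        rw [h0]
        have h5 : 0 ≤ Real.exp a * ξ j ω ^ 4 := by positivity
        nlinarith

/-- McLeish's argument in quantitative form: the characteristic function of a sum of martingale
differences is close to the Gaussian one as soon as the sum of the squares is close to `v` in `L²`
and the sum of the fourth moments is small. With `T = ∏ (1 + i Z)` for the stopped differences `Z`
one has `E T = 1`, and `exp (i ∑ Z) = T · ∏ exp (i Z) / (1 + i Z)`, where the second factor is
nearly the constant `exp (- v / 2)`. -/
theorem MartDiff.norm_integral_exp_sub_le [IsProbabilityMeasure μ] (h : MartDiff μ ℱ ξ) (N : ℕ)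
    {v η : ℝ} (hv : 0 ≤ v) (hη : 0 < η) :
    ‖∫ ω, Complex.exp ((∑ j ∈ Finset.range N, ξ j ω : ℝ) * Complex.I) ∂μ
        - (Real.exp (-v / 2) : ℝ)‖ ≤
      η * (Real.exp (v + 1) * (2 + ∑ j ∈ Finset.range N, ∫ ω, ξ j ω ^ 4 ∂μ)) / 2
        + (8 * (v + 1) * ∑ j ∈ Finset.range N, ∫ ω, ξ j ω ^ 4 ∂μ
          + 10 * ∫ ω, (∑ j ∈ Finset.range N, ξ j ω ^ 2 - v) ^ 2 ∂μ) / (2 * η)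
        + 2 * ∫ ω, (∑ j ∈ Finset.range N, ξ j ω ^ 2 - v) ^ 2 ∂μ := by
  set Z := MIR.stopped ξ (v + 1) with hZ
  have hZm : MartDiff μ ℱ Z := h.stopped (v + 1)
  obtain ⟨-, -, hre, him, hre1, him0⟩ := hZm.expMart_aux N
  set c : ℝ := Real.exp (-v / 2) with hc
  have hT : Integrable (fun ω => expMart Z N ω) μ := by
    have h1 := (hre.integrable.ofReal (𝕜 := ℂ)).add
      ((him.integrable.ofReal (𝕜 := ℂ)).mul_const Complex.I)
    refine h1.congr (ae_of_all _ fun ω => ?_)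
    simp [Complex.re_add_im]
  have hT1 : ∫ ω, expMart Z N ω ∂μ = 1 := by
    have h1 : ∫ ω, expMart Z N ω ∂μ = ∫ ω, (((expMart Z N ω).re : ℂ)
        + ((expMart Z N ω).im : ℂ) * Complex.I) ∂μ := by
      congr 1; ext ω; simp [Complex.re_add_im]
    rw [h1, integral_add hre.integrable.ofReal (him.integrable.ofReal.mul_const _),
      integral_mul_const, integral_complex_ofReal, integral_complex_ofReal, hre1, him0]
    simp
  have hSm : Measurable fun ω => ∑ j ∈ Finset.range N, ξ j ω :=
    Finset.measurable_sum _ fun j _ => h.measurable j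
  have hE : Integrable (fun ω => Complex.exp ((∑ j ∈ Finset.range N, ξ j ω : ℝ)
      * Complex.I)) μ := by
    refine (integrable_const (1 : ℝ)).mono' ?_ (ae_of_all _ fun ω => ?_)
    · exact (Complex.measurable_exp.comp
        ((Complex.measurable_ofReal.comp hSm).mul_const _)).aestronglyMeasurable
    · rw [Complex.norm_exp_ofReal_mul_I]
  have hsplit : ∫ ω, Complex.exp ((∑ j ∈ Finset.range N, ξ j ω : ℝ) * Complex.I) ∂μ - (c : ℂ)
      = ∫ ω, (Complex.exp ((∑ j ∈ Finset.range N, ξ j ω : ℝ) * Complex.I)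
        - c * expMart Z N ω) ∂μ := by
    rw [integral_sub hE (hT.const_mul _), integral_const_mul, hT1, mul_one]
  rw [hsplit]
  have h4 : ∀ j, Integrable (fun ω => ξ j ω ^ 4) μ := fun j => ((h.mom j).pow 4).integrable
  have h4s : Integrable (fun ω => ∑ j ∈ Finset.range N, ξ j ω ^ 4) μ :=
    integrable_finsetSum _ fun j _ => h4 j
  have hB : Integrable (fun ω => (∑ j ∈ Finset.range N, ξ j ω ^ 2 - v) ^ 2) μ :=
    (((HasMoments.sum _ fun j _ => (h.mom j).pow 2).sub (HasMoments.const v)).pow 2).integrable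
  set F : Ω → ℝ := fun ω => η * (Real.exp (v + 1) * (2 + ∑ j ∈ Finset.range N, ξ j ω ^ 4)) / 2
        + (8 * (v + 1) * ∑ j ∈ Finset.range N, ξ j ω ^ 4
          + 10 * (∑ j ∈ Finset.range N, ξ j ω ^ 2 - v) ^ 2) / (2 * η)
        + 2 * (∑ j ∈ Finset.range N, ξ j ω ^ 2 - v) ^ 2 with hF
  have hFi1 : Integrable
      (fun ω => η * (Real.exp (v + 1) * (2 + ∑ j ∈ Finset.range N, ξ j ω ^ 4)) / 2) μ :=
    ((((integrable_const 2).add h4s).const_mul _).const_mul _).div_const _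
  have hFi2 : Integrable (fun ω => (8 * (v + 1) * ∑ j ∈ Finset.range N, ξ j ω ^ 4
          + 10 * (∑ j ∈ Finset.range N, ξ j ω ^ 2 - v) ^ 2) / (2 * η)) μ :=
    ((h4s.const_mul _).add (hB.const_mul _)).div_const _
  have hFi : Integrable F μ := (hFi1.add hFi2).add (hB.const_mul _)
  have hFint : ∫ ω, F ω ∂μ =
      η * (Real.exp (v + 1) * (2 + ∑ j ∈ Finset.range N, ∫ ω, ξ j ω ^ 4 ∂μ)) / 2
        + (8 * (v + 1) * ∑ j ∈ Finset.range N, ∫ ω, ξ j ω ^ 4 ∂μ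
          + 10 * ∫ ω, (∑ j ∈ Finset.range N, ξ j ω ^ 2 - v) ^ 2 ∂μ) / (2 * η)
        + 2 * ∫ ω, (∑ j ∈ Finset.range N, ξ j ω ^ 2 - v) ^ 2 ∂μ := by
    have hFi12 : Integrable (fun ω =>
        η * (Real.exp (v + 1) * (2 + ∑ j ∈ Finset.range N, ξ j ω ^ 4)) / 2
        + (8 * (v + 1) * ∑ j ∈ Finset.range N, ξ j ω ^ 4
          + 10 * (∑ j ∈ Finset.range N, ξ j ω ^ 2 - v) ^ 2) / (2 * η)) μ := hFi1.add hFi2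
    simp only [hF]
    rw [integral_add hFi12 (hB.const_mul _), integral_add hFi1 hFi2,
      integral_div, integral_const_mul, integral_const_mul,
      integral_add (integrable_const 2) h4s, integral_div,
      integral_add (h4s.const_mul _) (hB.const_mul _), integral_const_mul, integral_const_mul,
      integral_const_mul, integral_finsetSum _ fun j _ => h4 j]
    simp
  rw [← hFint]
  refine norm_integral_le_of_norm_le hFi (ae_of_all _ fun ω => ?_)
  -- the pointwise estimate
  set S4 := ∑ j ∈ Finset.range N, ξ j ω ^ 4 with hS4
  set V := ∑ j ∈ Finset.range N, ξ j ω ^ 2 with hV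
  have hS4n : 0 ≤ S4 := Finset.sum_nonneg fun _ _ => by positivity
  set S' := ∑ j ∈ Finset.range N, Z j ω with hS'
  set U : ℂ := ∏ j ∈ Finset.range N, Complex.exp (Z j ω * Complex.I) / (1 + Z j ω * Complex.I)
    with hU
  set E2 : ℂ := ∏ j ∈ Finset.range N, ((Real.exp (-(Z j ω) ^ 2 / 2) : ℝ) : ℂ) with hE2
  have hne : ∀ x : ℝ, (1 + x * Complex.I : ℂ) ≠ 0 := by
    intro x hx
    have := congrArg Complex.re hx
    simp at this
  have hTU : Complex.exp ((S' : ℝ) * Complex.I) = expMart Z N ω * U := by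
    rw [hU, expMart, ← Finset.prod_mul_distrib, hS']
    push_cast
    rw [Finset.sum_mul, Complex.exp_sum]
    refine Finset.prod_congr rfl fun j _ => ?_
    rw [mul_div_cancel₀ _ (hne _)]
  have hU1 : ∀ j, ‖Complex.exp (Z j ω * Complex.I) / (1 + Z j ω * Complex.I)‖ ≤ 1 := by
    intro j
    rw [norm_div, Complex.norm_exp_ofReal_mul_I]
    refine div_le_one_of_le₀ ?_ (norm_nonneg _)
    have h := Complex.abs_re_le_norm (1 + Z j ω * Complex.I : ℂ)
    simpa using h
  have hG1 : ∀ j, ‖((Real.exp (-(Z j ω) ^ 2 / 2) : ℝ) : ℂ)‖ ≤ 1 := by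
    intro j
    rw [Complex.norm_real, Real.norm_eq_abs, abs_of_pos (Real.exp_pos _)]
    exact Real.exp_le_one_iff.2 (by nlinarith [sq_nonneg (Z j ω)])
  have hUn : ‖U‖ ≤ 1 := by
    rw [hU, norm_prod]
    exact Finset.prod_le_one (fun _ _ => norm_nonneg _) fun j _ => hU1 j
  have hE2n : ‖E2‖ ≤ 1 := by
    rw [hE2, norm_prod]
    exact Finset.prod_le_one (fun _ _ => norm_nonneg _) fun j _ => hG1 j
  have hE2e : E2 = ((Real.exp (-(∑ j ∈ Finset.range N, Z j ω ^ 2) / 2) : ℝ) : ℂ) := by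
    rw [hE2, ← Complex.ofReal_prod, ← Real.exp_sum, ← Finset.sum_neg_distrib, Finset.sum_div]
  have hUE : ‖U - E2‖ ^ 2 ≤ 4 * (v + 1) * S4 + 4 * (V - v) ^ 2 := by
    by_cases hA : V ≤ v + 1
    · have h1 : ‖U - E2‖ ≤ ∑ j ∈ Finset.range N, 2 * |ξ j ω| ^ 3 := by
        refine (norm_prod_sub_prod_le_sum _ _ _ (fun j _ => hU1 j) (fun j _ => hG1 j)).trans ?_
        refine Finset.sum_le_sum fun j _ => (norm_exp_div_sub_exp_le (Z j ω)).trans ?_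
        have : |Z j ω| ≤ |ξ j ω| := by
          simp only [hZ, MIR.stopped, Set.indicator_apply]
          split_ifs <;> simp
        gcongr
      have h2 : (∑ j ∈ Finset.range N, |ξ j ω| ^ 3) ^ 2 ≤ V * S4 := by
        have := Finset.sum_mul_sq_le_sq_mul_sq (Finset.range N) (fun j => |ξ j ω|)
          (fun j => |ξ j ω| ^ 2)
        have e1 : ∀ j, |ξ j ω| * |ξ j ω| ^ 2 = |ξ j ω| ^ 3 := fun j => by ring
        have e2 : ∀ j, (|ξ j ω| ^ 2) ^ 2 = ξ j ω ^ 4 := fun j => by rw [sq_abs]; ring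
        rw [Finset.sum_congr rfl fun j _ => e1 j, Finset.sum_congr rfl fun j _ => e2 j] at this
        simpa only [sq_abs] using this
      rw [← Finset.mul_sum] at h1
      have h3 : ‖U - E2‖ ^ 2 ≤ (2 * ∑ j ∈ Finset.range N, |ξ j ω| ^ 3) ^ 2 := by
        gcongr
      nlinarith [sq_nonneg (V - v)]
    · have h1 : ‖U - E2‖ ≤ 2 := (norm_sub_le _ _).trans (by linarith)
      have h2 : 1 ≤ V - v := by linarith
      have h3 : 0 ≤ 4 * (v + 1) * S4 := by positivity
      nlinarith [norm_nonneg (U - E2)]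
  have hEc : ‖E2 - c‖ ^ 2 ≤ (V - v) ^ 2 := by
    rw [hE2e, ← Complex.ofReal_sub, Complex.norm_real, Real.norm_eq_abs, sq_abs]
    by_cases hA : V ≤ v + 1
    · have hZV : ∑ j ∈ Finset.range N, Z j ω ^ 2 = V := by
        refine Finset.sum_congr rfl fun j hj => ?_
        have : Z j ω = ξ j ω := by
          refine Set.indicator_of_mem ?_ _
          have : ∑ k ∈ Finset.range j, ξ k ω ^ 2 ≤ V :=
            Finset.sum_le_sum_of_subset_of_nonneg
              (Finset.range_mono (Finset.mem_range.1 hj).le) fun _ _ _ => sq_nonneg _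
          exact this.trans hA
        rw [this]
      rw [hZV]
      have hV0 : 0 ≤ V := Finset.sum_nonneg fun _ _ => sq_nonneg _
      -- `exp` is `1`-Lipschitz on the negative half-line
      have key : ∀ x y : ℝ, x ≤ 0 → y ≤ x → Real.exp x - Real.exp y ≤ x - y := by
        intro x y hx hxy
        have h1 : Real.exp y = Real.exp x * Real.exp (y - x) := by rw [← Real.exp_add]; ring_nf
        have h2 := Real.add_one_le_exp (y - x)
        have h3 : Real.exp x ≤ 1 := Real.exp_le_one_iff.2 hx
        have := Real.exp_pos x
        rw [h1]; nlinarith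
      rw [← sq_abs, ← sq_abs (V - v)]
      have : |Real.exp (-V / 2) - c| ≤ |V - v| := by
        rw [hc]
        rcases le_total V v with hle | hle
        · have h1 := key (-V / 2) (-v / 2) (by linarith) (by linarith)
          have h2 : Real.exp (-v / 2) ≤ Real.exp (-V / 2) := Real.exp_le_exp.2 (by linarith)
          rw [abs_of_nonneg (by linarith), abs_of_nonpos (by linarith)]
          linarith
        · have h1 := key (-v / 2) (-V / 2) (by linarith) (by linarith)
          have h2 : Real.exp (-V / 2) ≤ Real.exp (-v / 2) := Real.exp_le_exp.2 (by linarith)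
          rw [abs_of_nonpos (by linarith), abs_of_nonneg (by linarith)]
          linarith
      gcongr
    · have h1 : 1 ≤ V - v := by linarith
      have h2 : 0 < Real.exp (-(∑ j ∈ Finset.range N, Z j ω ^ 2) / 2) := Real.exp_pos _
      have h3 : Real.exp (-(∑ j ∈ Finset.range N, Z j ω ^ 2) / 2) ≤ 1 := by
        refine Real.exp_le_one_iff.2 ?_
        have : 0 ≤ ∑ j ∈ Finset.range N, Z j ω ^ 2 := Finset.sum_nonneg fun _ _ => sq_nonneg _
        linarith
      have h4 : 0 < c := Real.exp_pos _
      have h5 : c ≤ 1 := Real.exp_le_one_iff.2 (by linarith)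
      nlinarith
  have hD : ‖U - c‖ ^ 2 ≤ 8 * (v + 1) * S4 + 10 * (V - v) ^ 2 := by
    have h1 : ‖U - c‖ ≤ ‖U - E2‖ + ‖E2 - c‖ := by
      have := norm_add_le (U - E2) (E2 - c)
      simpa using this
    nlinarith [norm_nonneg (U - c), sq_nonneg (‖U - E2‖ - ‖E2 - c‖)]
  have hTn := norm_expMart_stopped_sq_le ξ (a := v + 1) (by linarith) N ω
  have hdiff : ‖Complex.exp ((∑ j ∈ Finset.range N, ξ j ω : ℝ) * Complex.I)
      - Complex.exp ((S' : ℝ) * Complex.I)‖ ≤ 2 * (V - v) ^ 2 := by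
    by_cases hA : V ≤ v + 1
    · have : S' = ∑ j ∈ Finset.range N, ξ j ω := by
        refine Finset.sum_congr rfl fun j hj => ?_
        refine Set.indicator_of_mem ?_ _
        have : ∑ k ∈ Finset.range j, ξ k ω ^ 2 ≤ V :=
          Finset.sum_le_sum_of_subset_of_nonneg
            (Finset.range_mono (Finset.mem_range.1 hj).le) fun _ _ _ => sq_nonneg _
        exact this.trans hA
      rw [this, sub_self, norm_zero]
      positivity
    · have h1 : 1 ≤ V - v := by linarith
      refine (norm_sub_le _ _).trans ?_
      rw [Complex.norm_exp_ofReal_mul_I, Complex.norm_exp_ofReal_mul_I]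
      nlinarith
  have htri : ‖Complex.exp ((∑ j ∈ Finset.range N, ξ j ω : ℝ) * Complex.I) - c * expMart Z N ω‖
      ≤ 2 * (V - v) ^ 2 + ‖expMart Z N ω‖ * ‖U - c‖ := by
    have e : Complex.exp ((∑ j ∈ Finset.range N, ξ j ω : ℝ) * Complex.I) - c * expMart Z N ω
        = (Complex.exp ((∑ j ∈ Finset.range N, ξ j ω : ℝ) * Complex.I)
          - Complex.exp ((S' : ℝ) * Complex.I)) + expMart Z N ω * (U - c) := by
      rw [hTU]; ring
    rw [e]
    refine (norm_add_le _ _).trans ?_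
    rw [norm_mul]
    linarith
  have hamgm : ‖expMart Z N ω‖ * ‖U - c‖
      ≤ η * ‖expMart Z N ω‖ ^ 2 / 2 + ‖U - c‖ ^ 2 / (2 * η) := by
    have : η * ‖expMart Z N ω‖ ^ 2 / 2 + ‖U - c‖ ^ 2 / (2 * η) - ‖expMart Z N ω‖ * ‖U - c‖
        = (η * ‖expMart Z N ω‖ - ‖U - c‖) ^ 2 / (2 * η) := by
      field_simp; ring
    have h2 : 0 ≤ (η * ‖expMart Z N ω‖ - ‖U - c‖) ^ 2 / (2 * η) := by positivity
    linarith
  have hx1 : η * ‖expMart Z N ω‖ ^ 2 / 2 ≤ η * (Real.exp (v + 1) * (2 + S4)) / 2 := by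
    gcongr
  have hx2 : ‖U - c‖ ^ 2 / (2 * η) ≤ (8 * (v + 1) * S4 + 10 * (V - v) ^ 2) / (2 * η) := by
    gcongr
  simp only [hF]
  linarith

end McLeish

section Moments

variable {Ω : Type*} {mΩ : MeasurableSpace Ω} {μ : Measure Ω} {ℱ : Filtration ℕ mΩ}
  {ξ ζ : ℕ → Ω → ℝ}

lemma MartDiff.add (h : MartDiff μ ℱ ξ) (h' : MartDiff μ ℱ ζ) :
    MartDiff μ ℱ fun i ω => ξ i ω + ζ i ω := by
  refine ⟨fun i => (h.meas i).add (h'.meas i), fun i => (h.mom i).add (h'.mom i),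
    fun i g hg hgm => ?_⟩
  simp only [mul_add]
  rw [integral_add (hgm.mul (h.mom i)).integrable (hgm.mul (h'.mom i)).integrable,
    h.orth i g hg hgm, h'.orth i g hg hgm, add_zero]

lemma MartDiff.measurable_sum (h : MartDiff μ ℱ ξ) (N : ℕ) :
    Measurable[ℱ N] fun ω => ∑ j ∈ Finset.range N, ξ j ω :=
  Finset.measurable_sum _ fun k hk =>
    (h.meas k).mono (ℱ.mono (Finset.mem_range.1 hk : k + 1 ≤ N)) le_rfl

lemma MartDiff.hasMoments_sum (h : MartDiff μ ℱ ξ) (N : ℕ) :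
    HasMoments (fun ω => ∑ j ∈ Finset.range N, ξ j ω) μ :=
  HasMoments.sum _ fun k _ => h.mom k

lemma MartDiff.integral_sum_sq [IsProbabilityMeasure μ] (h : MartDiff μ ℱ ξ) (N : ℕ) :
    ∫ ω, (∑ j ∈ Finset.range N, ξ j ω) ^ 2 ∂μ = ∑ j ∈ Finset.range N, ∫ ω, ξ j ω ^ 2 ∂μ := by
  induction N with
  | zero => simp
  | succ N ih =>
    rw [Finset.sum_range_succ, ← ih]
    have hS := h.hasMoments_sum N
    have e : ∀ ω, (∑ j ∈ Finset.range (N + 1), ξ j ω) ^ 2 = (∑ j ∈ Finset.range N, ξ j ω) ^ 2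
        + (2 * ((∑ j ∈ Finset.range N, ξ j ω) * ξ N ω) + ξ N ω ^ 2) := by
      intro ω; rw [Finset.sum_range_succ]; ring
    simp only [e]
    have m2 := (hS.mul (h.mom N)).const_mul 2
    have m3 := (h.mom N).pow 2
    rw [integral_add (hS.pow 2).integrable (m2.add m3).integrable,
      integral_add m2.integrable m3.integrable, integral_const_mul,
      h.orth N _ (h.measurable_sum N) hS]
    ring

/-- Sums of `N` martingale differences have fourth moments of order `N ^ 2`. -/
lemma MartDiff.integral_sum_pow_four_le [IsProbabilityMeasure μ] (h : MartDiff μ ℱ ξ) {C : ℝ}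
    (hC : ∀ j, ∫ ω, ξ j ω ^ 4 ∂μ ≤ C) (N : ℕ) :
    ∫ ω, (∑ j ∈ Finset.range N, ξ j ω) ^ 4 ∂μ ≤ 16 * C * N ^ 2 := by
  have hC0 : 0 ≤ C := (integral_nonneg fun ω => by positivity).trans (hC 0)
  induction N with
  | zero => simp
  | succ N ih =>
    rcases Nat.eq_zero_or_pos N with rfl | hN
    · simp only [zero_add, Finset.range_one, Finset.sum_singleton]
      have := hC 0
      norm_num; linarith
    have hS := h.hasMoments_sum N
    have hN' : (0 : ℝ) < N := by exact_mod_cast hN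
    set S : Ω → ℝ := fun ω => ∑ j ∈ Finset.range N, ξ j ω with hSdef
    have hle : ∀ ω, (∑ j ∈ Finset.range (N + 1), ξ j ω) ^ 4 ≤
        (1 + (N : ℝ)⁻¹) * S ω ^ 4 + (4 * (S ω ^ 3 * ξ N ω) + (16 * N + 3) * ξ N ω ^ 4) := by
      intro ω
      rw [Finset.sum_range_succ]
      change (S ω + ξ N ω) ^ 4 ≤ _
      generalize S ω = a
      generalize ξ N ω = b
      have e : (N : ℝ)⁻¹ * a ^ 4 + 16 * N * b ^ 4 - 8 * (a ^ 2 * b ^ 2)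
          = (N : ℝ)⁻¹ * (a ^ 2 - 4 * N * b ^ 2) ^ 2 := by field_simp; ring
      have e2 : 0 ≤ (N : ℝ)⁻¹ * (a ^ 2 - 4 * N * b ^ 2) ^ 2 := by positivity
      nlinarith [mul_nonneg (sq_nonneg b) (sq_nonneg (a - b))]
    have i1 := (((hS.pow 4).const_mul (1 + (N : ℝ)⁻¹))).integrable
    have i2 := (((hS.pow 3).mul (h.mom N)).const_mul 4).integrable
    have i3 := (((h.mom N).pow 4).const_mul (16 * (N : ℝ) + 3)).integrable
    have horth := h.orth N (fun ω => S ω ^ 3) ((h.measurable_sum N).pow_const 3) (hS.pow 3)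
    have hb : ∫ ω, (∑ j ∈ Finset.range (N + 1), ξ j ω) ^ 4 ∂μ ≤
        (1 + (N : ℝ)⁻¹) * ∫ ω, S ω ^ 4 ∂μ + (16 * N + 3) * ∫ ω, ξ N ω ^ 4 ∂μ := by
      refine (integral_mono ((h.hasMoments_sum (N + 1)).pow 4).integrable
        (i1.add (i2.add i3)) hle).trans (le_of_eq ?_)
      rw [integral_add' i1 (i2.add i3), integral_add' i2 i3, integral_const_mul,
        integral_const_mul, integral_const_mul, horth]
      ring
    have hx := hC N
    have h1 : (1 + (N : ℝ)⁻¹) * ∫ ω, S ω ^ 4 ∂μ ≤ (1 + (N : ℝ)⁻¹) * (16 * C * N ^ 2) := by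
      gcongr
    have h2 : (1 + (N : ℝ)⁻¹) * (16 * C * N ^ 2) = 16 * C * N ^ 2 + 16 * C * N := by
      field_simp
    have h3 : (16 * (N : ℝ) + 3) * ∫ ω, ξ N ω ^ 4 ∂μ ≤ (16 * N + 3) * C := by gcongr
    push_cast
    nlinarith

end Moments

/-! ### The filtration of an independent sequence -/

section Past

variable {Ω β : Type*} {mΩ : MeasurableSpace Ω} [mβ : MeasurableSpace β] {μ : Measure Ω} {p : ℕ}

/-- The filtration of a finite sequence: at time `k` the first `k` members are known. -/
def past (X : Fin p → Ω → β) (hX : ∀ i, Measurable (X i)) : Filtration ℕ mΩ where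
  seq k := ⨆ i ∈ {i : Fin p | i.val < k}, mβ.comap (X i)
  mono' _ _ hkl := biSup_mono fun _ hi => lt_of_lt_of_le hi hkl
  le' _ := iSup₂_le fun i _ => (hX i).comap_le

variable {X : Fin p → Ω → β} {hX : ∀ i, Measurable (X i)}

lemma measurable_past {i : Fin p} {k : ℕ} (h : i.val < k) : Measurable[past X hX k] (X i) := by
  have : mβ.comap (X i) ≤ past X hX k :=
    le_iSup₂ (f := fun (i : Fin p) (_ : i ∈ {i : Fin p | i.val < k}) => mβ.comap (X i)) i h
  exact (comap_measurable (X i)).mono this le_rfl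

lemma integral_past_mul (hind : iIndepFun X μ) (i : Fin p) {g : Ω → ℝ} {φ : β → ℝ}
    (hg : Measurable[past X hX i] g) (hφ : Measurable φ) :
    ∫ ω, g ω * φ (X i ω) ∂μ = (∫ ω, g ω ∂μ) * ∫ ω, φ (X i ω) ∂μ := by
  have h1 : Indep (⨆ j ∈ {j : Fin p | j.val < i.val}, mβ.comap (X j))
      (⨆ j ∈ ({i} : Set (Fin p)), mβ.comap (X j)) μ := by
    refine indep_iSup_of_disjoint (fun j => (hX j).comap_le) hind ?_
    simp
  have h2 : IndepFun g (fun ω => φ (X i ω)) μ := by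
    rw [IndepFun_iff_Indep]
    refine indep_of_indep_of_le_left (indep_of_indep_of_le_right h1 ?_) hg.comap_le
    simp only [Set.mem_singleton_iff, iSup_iSup_eq_left]
    exact (hφ.comp (comap_measurable (X i))).comap_le
  exact h2.integral_fun_mul_eq_mul_integral
    (hg.mono ((past X hX).le i) le_rfl).aestronglyMeasurable
    (hφ.comp (hX i)).aestronglyMeasurable

/-- A finite sequence of functions, continued by `0`. -/
def extendZero (f : Fin p → Ω → ℝ) (k : ℕ) (ω : Ω) : ℝ :=
  if h : k < p then f ⟨k, h⟩ ω else 0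

lemma sum_extendZero (f : Fin p → Ω → ℝ) (ω : Ω) :
    ∑ k ∈ Finset.range p, extendZero f k ω = ∑ i, f i ω := by
  rw [Finset.sum_range]; simp [extendZero]

lemma sum_extendZero_pow (f : Fin p → Ω → ℝ) (e : ℕ) (ω : Ω) :
    ∑ k ∈ Finset.range p, extendZero f k ω ^ e = ∑ i, f i ω ^ e := by
  rw [Finset.sum_range]; simp [extendZero]

lemma martDiff_extendZero (hind : iIndepFun X μ) {g : Fin p → Ω → ℝ} {φ : Fin p → β → ℝ}
    (hg : ∀ i : Fin p, Measurable[past X hX i] (g i)) (hgm : ∀ i, HasMoments (g i) μ)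
    (hφ : ∀ i, Measurable (φ i)) (hφm : ∀ i, HasMoments (fun ω => φ i (X i ω)) μ)
    (h0 : ∀ i, ∫ ω, φ i (X i ω) ∂μ = 0) :
    MartDiff μ (past X hX) (extendZero fun i ω => g i ω * φ i (X i ω)) := by
  refine ⟨fun k => ?_, fun k => ?_, fun k f hf hfm => ?_⟩
  · by_cases h : k < p
    · have e : extendZero (fun i ω => g i ω * φ i (X i ω)) k
          = fun ω => g ⟨k, h⟩ ω * φ ⟨k, h⟩ (X ⟨k, h⟩ ω) := by
        ext ω; simp [extendZero, h]
      rw [e]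
      refine Measurable.mul ?_ ?_
      · exact (hg ⟨k, h⟩).mono ((past X hX).mono (Nat.le_succ k)) le_rfl
      · exact (hφ _).comp (measurable_past (Nat.lt_succ_self k))
    · have e : extendZero (fun i ω => g i ω * φ i (X i ω)) k = fun ω => 0 := by
        ext ω; simp [extendZero, h]
      rw [e]; exact measurable_const
  · by_cases h : k < p
    · have e : extendZero (fun i ω => g i ω * φ i (X i ω)) k
          = fun ω => g ⟨k, h⟩ ω * φ ⟨k, h⟩ (X ⟨k, h⟩ ω) := by
        ext ω; simp [extendZero, h]
      rw [e]; exact (hgm ⟨k, h⟩).mul (hφm ⟨k, h⟩)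
    · have e : extendZero (fun i ω => g i ω * φ i (X i ω)) k = fun ω => 0 := by
        ext ω; simp [extendZero, h]
      rw [e]; exact fun p _ => MemLp.zero
  · by_cases h : k < p
    · simp only [extendZero, h, dite_true, ← mul_assoc]
      have h1 := integral_past_mul (hX := hX) hind ⟨k, h⟩ (g := fun ω => f ω * g ⟨k, h⟩ ω)
        (hf.mul (hg ⟨k, h⟩)) (hφ ⟨k, h⟩)
      rw [h1, h0, mul_zero]
    · simp [extendZero, h]

end Past

/-! ### Matrices with bounded row and column sums -/

/-- All absolute row sums and column sums of `A` are at most `c`. -/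
structure SumBdd {p : ℕ} (A : Matrix (Fin p) (Fin p) ℝ) (c : ℝ) : Prop where
  row : ∀ i, ∑ j, |A i j| ≤ c
  col : ∀ j, ∑ i, |A i j| ≤ c

namespace SumBdd

variable {p : ℕ} {A B : Matrix (Fin p) (Fin p) ℝ} {a b : ℝ}

lemma nonneg (h : SumBdd A a) (i : Fin p) : 0 ≤ a :=
  (Finset.sum_nonneg fun _ _ => abs_nonneg _).trans (h.row i)

lemma transpose (h : SumBdd A a) : SumBdd Aᵀ a := ⟨h.col, h.row⟩

lemma mono (h : SumBdd A a) (hab : a ≤ b) : SumBdd A b :=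
  ⟨fun i => (h.row i).trans hab, fun i => (h.col i).trans hab⟩

lemma add (hA : SumBdd A a) (hB : SumBdd B b) : SumBdd (A + B) (a + b) := by
  constructor
  · intro i
    refine le_trans ?_ (add_le_add (hA.row i) (hB.row i))
    rw [← Finset.sum_add_distrib]
    exact Finset.sum_le_sum fun j _ => abs_add_le _ _
  · intro i
    refine le_trans ?_ (add_le_add (hA.col i) (hB.col i))
    rw [← Finset.sum_add_distrib]
    exact Finset.sum_le_sum fun j _ => abs_add_le _ _

lemma smul (hA : SumBdd A a) (c : ℝ) : SumBdd (c • A) (|c| * a) := by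
  constructor
  · intro i
    simp only [Matrix.smul_apply, smul_eq_mul, abs_mul, ← Finset.mul_sum]
    exact mul_le_mul_of_nonneg_left (hA.row i) (abs_nonneg c)
  · intro i
    simp only [Matrix.smul_apply, smul_eq_mul, abs_mul, ← Finset.mul_sum]
    exact mul_le_mul_of_nonneg_left (hA.col i) (abs_nonneg c)

lemma zero : SumBdd (0 : Matrix (Fin p) (Fin p) ℝ) 0 := by
  constructor <;> simp

lemma one : SumBdd (1 : Matrix (Fin p) (Fin p) ℝ) 1 := by
  constructor <;> intro i <;> simp [Matrix.one_apply, apply_ite abs]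

lemma sum {ι : Type*} (s : Finset ι) {F : ι → Matrix (Fin p) (Fin p) ℝ} {f : ι → ℝ}
    (h : ∀ i ∈ s, SumBdd (F i) (f i)) : SumBdd (∑ i ∈ s, F i) (∑ i ∈ s, f i) := by
  classical
  induction s using Finset.induction_on with
  | empty => simpa using zero
  | insert j s hj ih =>
    rw [Finset.sum_insert hj, Finset.sum_insert hj]
    exact (h j (by simp)).add (ih fun i hi => h i (by simp [hi]))

lemma mul (hA : SumBdd A a) (hB : SumBdd B b) : SumBdd (A * B) (a * b) := by
  have key : ∀ {A B : Matrix (Fin p) (Fin p) ℝ} {a b : ℝ}, SumBdd A a → SumBdd B b →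
      ∀ i, ∑ j, |(A * B) i j| ≤ a * b := by
    intro A B a b hA hB i
    have hb := hB.nonneg i
    calc ∑ j, |(A * B) i j| ≤ ∑ j, ∑ k, |A i k| * |B k j| := by
          refine Finset.sum_le_sum fun j _ => ?_
          rw [Matrix.mul_apply]
          refine (Finset.abs_sum_le_sum_abs _ _).trans (le_of_eq ?_)
          simp only [abs_mul]
      _ = ∑ k, |A i k| * ∑ j, |B k j| := by
          rw [Finset.sum_comm]; simp only [Finset.mul_sum]
      _ ≤ ∑ k, |A i k| * b :=
          Finset.sum_le_sum fun k _ => mul_le_mul_of_nonneg_left (hB.row k) (abs_nonneg _)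
      _ = (∑ k, |A i k|) * b := by rw [Finset.sum_mul]
      _ ≤ a * b := mul_le_mul_of_nonneg_right (hA.row i) hb
  refine ⟨key hA hB, fun j => ?_⟩
  have := key hB.transpose hA.transpose j
  rw [← Matrix.transpose_mul, mul_comm b a] at this
  exact this

lemma abs_apply_le (hA : SumBdd A a) (i j : Fin p) : |A i j| ≤ a :=
  (Finset.single_le_sum (f := fun j => |A i j|) (fun _ _ => abs_nonneg _)
    (Finset.mem_univ j)).trans (hA.row i)

lemma abs_trace_le (hA : SumBdd A a) : |A.trace| ≤ p * a := by
  refine (Finset.abs_sum_le_sum_abs _ _).trans ?_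
  refine (Finset.sum_le_sum fun i _ => hA.abs_apply_le i i).trans ?_
  simp

/-- Schur's test. -/
lemma abs_dotProduct_mulVec_le (hA : SumBdd A a) (x : Fin p → ℝ) :
    |x ⬝ᵥ (A *ᵥ x)| ≤ a * (x ⬝ᵥ x) := by
  have h1 : |x ⬝ᵥ (A *ᵥ x)| ≤ ∑ i, ∑ j, (|A i j| * x i ^ 2 / 2 + |A i j| * x j ^ 2 / 2) := by
    refine (Finset.abs_sum_le_sum_abs _ _).trans (Finset.sum_le_sum fun i _ => ?_)
    rw [Matrix.mulVec, dotProduct, Finset.mul_sum]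
    refine (Finset.abs_sum_le_sum_abs _ _).trans (Finset.sum_le_sum fun j _ => ?_)
    rw [abs_mul, abs_mul]
    have := sq_nonneg (|x i| - |x j|)
    have h2 := abs_nonneg (A i j)
    rw [← sq_abs (x i), ← sq_abs (x j)]
    nlinarith
  refine h1.trans ?_
  simp only [Finset.sum_add_distrib]
  have h2 : ∑ i, ∑ j, |A i j| * x i ^ 2 / 2 ≤ a * (x ⬝ᵥ x) / 2 := by
    rw [dotProduct, Finset.mul_sum, Finset.sum_div]
    refine Finset.sum_le_sum fun i _ => ?_
    rw [← Finset.sum_div, ← Finset.sum_mul, ← sq]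
    have := mul_le_mul_of_nonneg_right (hA.row i) (sq_nonneg (x i))
    linarith
  have h3 : ∑ i, ∑ j, |A i j| * x j ^ 2 / 2 ≤ a * (x ⬝ᵥ x) / 2 := by
    rw [Finset.sum_comm, dotProduct, Finset.mul_sum, Finset.sum_div]
    refine Finset.sum_le_sum fun i _ => ?_
    rw [← Finset.sum_div, ← Finset.sum_mul, ← sq]
    have := mul_le_mul_of_nonneg_right (hA.col i) (sq_nonneg (x i))
    linarith
  linarith

end SumBdd

/-! ### Quadratic forms in independent errors -/

lemma sum_mul_sq_le_sum_abs {ι : Type*} (s : Finset ι) (a y : ι → ℝ) :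
    (∑ i ∈ s, a i * y i) ^ 2 ≤ (∑ i ∈ s, |a i|) * ∑ i ∈ s, |a i| * y i ^ 2 := by
  have h := Finset.sum_mul_sq_le_sq_mul_sq s (fun i => √|a i|) (fun i => √|a i| * |y i|)
  have e1 : ∀ i, √|a i| * (√|a i| * |y i|) = |a i| * |y i| := fun i => by
    rw [← mul_assoc, Real.mul_self_sqrt (abs_nonneg _)]
  have e2 : ∀ i, √|a i| ^ 2 = |a i| := fun i => Real.sq_sqrt (abs_nonneg _)
  have e3 : ∀ i, (√|a i| * |y i|) ^ 2 = |a i| * y i ^ 2 := fun i => by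
    rw [mul_pow, e2, sq_abs]
  simp only [e1, e3] at h
  simp only [e2] at h
  refine le_trans ?_ h
  rw [← sq_abs]
  have : |∑ i ∈ s, a i * y i| ≤ ∑ i ∈ s, |a i| * |y i| := by
    refine (Finset.abs_sum_le_sum_abs _ _).trans (le_of_eq ?_)
    simp only [abs_mul]
  gcongr

lemma sum_mul_pow_eight_le {ι : Type*} (s : Finset ι) (a y : ι → ℝ) :
    (∑ i ∈ s, a i * y i) ^ 8 ≤ (∑ i ∈ s, |a i|) ^ 7 * ∑ i ∈ s, |a i| * y i ^ 8 := by
  set A := ∑ i ∈ s, |a i| with hA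
  have hA0 : 0 ≤ A := Finset.sum_nonneg fun _ _ => abs_nonneg _
  have h1 := sum_mul_sq_le_sum_abs s a y
  have h2 := sum_mul_sq_le_sum_abs s (fun i => |a i|) (fun i => y i ^ 2)
  have h3 := sum_mul_sq_le_sum_abs s (fun i => |a i|) (fun i => y i ^ 4)
  simp only [abs_abs, ← pow_mul] at h2 h3
  norm_num at h2 h3
  have e : (∑ i ∈ s, a i * y i) ^ 8 = ((∑ i ∈ s, a i * y i) ^ 2) ^ 4 := by ring
  have n1 : 0 ≤ ∑ i ∈ s, |a i| * y i ^ 2 := Finset.sum_nonneg fun _ _ => by positivity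
  calc (∑ i ∈ s, a i * y i) ^ 8 ≤ (A * ∑ i ∈ s, |a i| * y i ^ 2) ^ 4 := by rw [e]; gcongr
    _ = A ^ 4 * ((∑ i ∈ s, |a i| * y i ^ 2) ^ 2) ^ 2 := by ring
    _ ≤ A ^ 4 * (A * ∑ i ∈ s, |a i| * y i ^ 4) ^ 2 := by gcongr
    _ = A ^ 6 * (∑ i ∈ s, |a i| * y i ^ 4) ^ 2 := by ring
    _ ≤ A ^ 6 * (A * ∑ i ∈ s, |a i| * y i ^ 8) := by gcongr
    _ = A ^ 7 * ∑ i ∈ s, |a i| * y i ^ 8 := by ring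

/-- The strictly lower triangular matrix with the entries of `A + Aᵀ`. -/
def lowerPart {p : ℕ} (A : Matrix (Fin p) (Fin p) ℝ) : Matrix (Fin p) (Fin p) ℝ :=
  Matrix.of fun i j => if j < i then A i j + A j i else 0

lemma SumBdd.lowerPart {p : ℕ} {A : Matrix (Fin p) (Fin p) ℝ} {a : ℝ} (hA : SumBdd A a) :
    SumBdd (lowerPart A) (2 * a) := by
  have h : ∀ i j, |MIR.lowerPart A i j| ≤ |(A + Aᵀ) i j| := by
    intro i j
    simp only [MIR.lowerPart, Matrix.of_apply, Matrix.add_apply, Matrix.transpose_apply]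
    split_ifs <;> simp
  have hs := hA.add hA.transpose
  rw [← two_mul] at hs
  exact ⟨fun i => (Finset.sum_le_sum fun j _ => h i j).trans (hs.row i),
    fun j => (Finset.sum_le_sum fun i _ => h i j).trans (hs.col j)⟩

lemma dotProduct_mulVec_eq_lowerPart {p : ℕ} (A : Matrix (Fin p) (Fin p) ℝ) (x : Fin p → ℝ) :
    x ⬝ᵥ (A *ᵥ x) = ∑ i, (A i i * x i ^ 2 + x i * (lowerPart A *ᵥ x) i) := by
  have e1 : x ⬝ᵥ (A *ᵥ x) = ∑ i, ∑ j, ((if j < i then A i j * x i * x j else 0)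
      + (if i < j then A i j * x i * x j else 0) + (if j = i then A i j * x i * x j else 0)) := by
    simp only [dotProduct, Matrix.mulVec, Finset.mul_sum]
    refine Finset.sum_congr rfl fun i _ => Finset.sum_congr rfl fun j _ => ?_
    rcases lt_trichotomy i j with h | h | h
    · simp [h, h.not_gt, h.ne']; ring
    · simp [h]; ring
    · simp [h, h.not_gt, h.ne]; ring
  have e2 : ∑ i, ∑ j, (if i < j then A i j * x i * x j else 0)
      = ∑ i, ∑ j, (if j < i then A j i * x i * x j else 0) := by
    rw [Finset.sum_comm]
    refine Finset.sum_congr rfl fun i _ => Finset.sum_congr rfl fun j _ => ?_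
    split_ifs <;> ring
  rw [e1]
  simp only [Finset.sum_add_distrib]
  rw [e2]
  simp only [Finset.sum_ite_eq', Finset.mem_univ, if_true]
  rw [add_comm, ← Finset.sum_add_distrib]
  congr 1
  · exact Finset.sum_congr rfl fun i _ => by ring
  · refine Finset.sum_congr rfl fun i _ => ?_
    rw [← Finset.sum_add_distrib, Matrix.mulVec, dotProduct, Finset.mul_sum]
    refine Finset.sum_congr rfl fun j _ => ?_
    simp only [lowerPart, Matrix.of_apply]
    split_ifs <;> ring

/-- Independent centred variables with variance `s` and moments of all orders, the eighth of which
is at most `M`. -/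
structure IndepErrors {Ω : Type*} {mΩ : MeasurableSpace Ω} {p : ℕ} (μ : Measure Ω)
    (X : Fin p → Ω → ℝ) (s M : ℝ) : Prop where
  meas : ∀ i, Measurable (X i)
  indep : iIndepFun X μ
  mom : ∀ i, HasMoments (X i) μ
  mean : ∀ i, ∫ ω, X i ω ∂μ = 0
  var : ∀ i, ∫ ω, X i ω ^ 2 ∂μ = s
  eighth : ∀ i, ∫ ω, X i ω ^ 8 ∂μ ≤ M

namespace IndepErrors

variable {Ω : Type*} {mΩ : MeasurableSpace Ω} {p : ℕ} {μ : Measure Ω} {X : Fin p → Ω → ℝ}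
  {s M : ℝ}

/-- The martingale differences of the quadratic form `XᵀAX`. -/
def quadDiff (X : Fin p → Ω → ℝ) (s : ℝ) (A : Matrix (Fin p) (Fin p) ℝ) (i : Fin p) (ω : Ω) : ℝ :=
  A i i * (X i ω ^ 2 - s) + (lowerPart A *ᵥ fun j => X j ω) i * X i ω

lemma sum_quadDiff (X : Fin p → Ω → ℝ) (s : ℝ) (A : Matrix (Fin p) (Fin p) ℝ) (ω : Ω) :
    ∑ i, quadDiff X s A i ω = (fun j => X j ω) ⬝ᵥ (A *ᵥ fun j => X j ω) - s * A.trace := by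
  rw [dotProduct_mulVec_eq_lowerPart, Matrix.trace, Finset.mul_sum, ← Finset.sum_sub_distrib]
  refine Finset.sum_congr rfl fun i _ => ?_
  simp only [quadDiff, Matrix.diag_apply]
  ring

lemma lin_hasMoments (h : IndepErrors μ X s M) (B : Matrix (Fin p) (Fin p) ℝ) (i : Fin p) :
    HasMoments (fun ω => (B *ᵥ fun j => X j ω) i) μ := by
  simp only [Matrix.mulVec, dotProduct]
  exact HasMoments.sum _ fun j _ => (h.mom j).const_mul _

lemma lin_measurable (h : IndepErrors μ X s M) (A : Matrix (Fin p) (Fin p) ℝ) (i : Fin p) :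
    Measurable[past X h.meas i] (fun ω => (lowerPart A *ᵥ fun j => X j ω) i) := by
  simp only [Matrix.mulVec, dotProduct]
  refine Finset.measurable_sum _ fun j _ => ?_
  by_cases hj : j < i
  · exact (measurable_past (hX := h.meas) (k := i) hj).const_mul _
  · simp only [lowerPart, Matrix.of_apply, hj, if_false, zero_mul]
    exact measurable_const

variable [IsProbabilityMeasure μ]

lemma quadDiff_hasMoments (h : IndepErrors μ X s M) (A : Matrix (Fin p) (Fin p) ℝ) (i : Fin p) :
    HasMoments (quadDiff X s A i) μ :=
  ((((h.mom i).pow 2).sub (HasMoments.const s)).const_mul _).add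
    ((h.lin_hasMoments _ i).mul (h.mom i))

lemma martDiff_quadDiff (h : IndepErrors μ X s M) (A : Matrix (Fin p) (Fin p) ℝ) :
    MartDiff μ (past X h.meas) (extendZero (quadDiff X s A)) := by
  have h1 : MartDiff μ (past X h.meas) (extendZero fun i ω => A i i * (X i ω ^ 2 - s)) :=
    martDiff_extendZero h.indep (g := fun i _ => A i i) (φ := fun _ x => x ^ 2 - s)
      (fun i => measurable_const) (fun i => HasMoments.const _)
      (fun i => (measurable_id.pow_const 2).sub_const s)
      (fun i => ((h.mom i).pow 2).sub (HasMoments.const s))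
      (fun i => by
        rw [integral_sub ((h.mom i).pow 2).integrable (integrable_const s), h.var]; simp)
  have h2 : MartDiff μ (past X h.meas)
      (extendZero fun i ω => (lowerPart A *ᵥ fun j => X j ω) i * X i ω) :=
    martDiff_extendZero h.indep (φ := fun _ x => x) (fun i => h.lin_measurable A i)
      (fun i => h.lin_hasMoments _ i) (fun i => measurable_id) (fun i => h.mom i) h.mean
  convert h1.add h2 using 1
  ext k ω
  simp only [extendZero, quadDiff]
  split_ifs <;> simp

lemma integral_lin_pow_eight_le (h : IndepErrors μ X s M) {B : Matrix (Fin p) (Fin p) ℝ} {b : ℝ}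
    (hB : SumBdd B b) (i : Fin p) :
    ∫ ω, (B *ᵥ fun j => X j ω) i ^ 8 ∂μ ≤ b ^ 8 * M := by
  have hb := hB.nonneg i
  have hM : 0 ≤ M := (integral_nonneg fun ω => by positivity).trans (h.eighth i)
  have i8 : ∀ j, Integrable (fun ω => |B i j| * X j ω ^ 8) μ := fun j =>
    (((h.mom j).pow 8).const_mul _).integrable
  have hr := hB.row i
  have hr0 : 0 ≤ ∑ j, |B i j| := Finset.sum_nonneg fun _ _ => abs_nonneg _
  have h1 : ∫ ω, (B *ᵥ fun j => X j ω) i ^ 8 ∂μ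
      ≤ ∫ ω, (∑ j, |B i j|) ^ 7 * ∑ j, |B i j| * X j ω ^ 8 ∂μ :=
    integral_mono ((h.lin_hasMoments B i).pow 8).integrable
      ((integrable_finsetSum _ fun j _ => i8 j).const_mul _)
      fun ω => sum_mul_pow_eight_le Finset.univ (B i) (fun j => X j ω)
  have h2 : ∑ j, |B i j| * ∫ ω, X j ω ^ 8 ∂μ ≤ (∑ j, |B i j|) * M := by
    rw [Finset.sum_mul]
    exact Finset.sum_le_sum fun j _ => mul_le_mul_of_nonneg_left (h.eighth j) (abs_nonneg _)
  rw [integral_const_mul, integral_finsetSum _ fun j _ => i8 j] at h1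
  simp only [integral_const_mul] at h1
  generalize ∑ j, |B i j| = r at *
  calc ∫ ω, (B *ᵥ fun j => X j ω) i ^ 8 ∂μ ≤ r ^ 7 * (r * M) :=
        h1.trans (mul_le_mul_of_nonneg_left h2 (pow_nonneg hr0 7))
    _ = r ^ 8 * M := by ring
    _ ≤ b ^ 8 * M := mul_le_mul_of_nonneg_right (pow_le_pow_left₀ hr0 hr 8) hM

/-- A bound for the fourth moments of the martingale differences of a quadratic form. -/
def diffBound (c s M : ℝ) : ℝ := 64 * c ^ 4 * (M + s ^ 4) + 4 * M + 4 * ((2 * c) ^ 8 * M)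

lemma integral_quadDiff_pow_four_le (h : IndepErrors μ X s M) {A : Matrix (Fin p) (Fin p) ℝ}
    {c : ℝ} (hA : SumBdd A c) (i : Fin p) :
    ∫ ω, quadDiff X s A i ω ^ 4 ∂μ ≤ diffBound c s M := by
  have hc := hA.nonneg i
  set L : Ω → ℝ := fun ω => (lowerPart A *ᵥ fun j => X j ω) i with hL
  have hLm : HasMoments L μ := h.lin_hasMoments _ i
  have hAi : A i i ^ 4 ≤ c ^ 4 := by
    have := hA.abs_apply_le i i
    have e : A i i ^ 4 = |A i i| ^ 4 := by
      rw [← abs_pow, abs_of_nonneg (by positivity)]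
    rw [e]; gcongr
  have hpt : ∀ ω, quadDiff X s A i ω ^ 4 ≤
      64 * c ^ 4 * (X i ω ^ 8 + s ^ 4) + (4 * X i ω ^ 8 + 4 * L ω ^ 8) := by
    intro ω
    change (A i i * (X i ω ^ 2 - s) + L ω * X i ω) ^ 4 ≤ _
    generalize X i ω = x
    generalize L ω = l
    have f4 : ∀ a b : ℝ, (a + b) ^ 4 ≤ 8 * a ^ 4 + 8 * b ^ 4 := by
      intro a b
      have h1 : (a + b) ^ 2 ≤ 2 * (a ^ 2 + b ^ 2) := by nlinarith [sq_nonneg (a - b)]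
      have h2 : (a + b) ^ 4 = ((a + b) ^ 2) ^ 2 := by ring
      rw [h2]
      have h3 : ((a + b) ^ 2) ^ 2 ≤ (2 * (a ^ 2 + b ^ 2)) ^ 2 := by gcongr
      nlinarith [sq_nonneg (a ^ 2 - b ^ 2)]
    have h1 := f4 (A i i * (x ^ 2 - s)) (l * x)
    have h2 := f4 (x ^ 2) (-s)
    have h3 : (l * x) ^ 4 ≤ (x ^ 8 + l ^ 8) / 2 := by nlinarith [sq_nonneg (x ^ 4 - l ^ 4)]
    have h4 : (A i i * (x ^ 2 - s)) ^ 4 ≤ c ^ 4 * (8 * (x ^ 8 + s ^ 4)) := by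
      rw [mul_pow]
      have : (x ^ 2 - s) ^ 4 ≤ 8 * (x ^ 8 + s ^ 4) := by
        rw [sub_eq_add_neg]; refine h2.trans (le_of_eq ?_); ring
      gcongr
    linarith
  have j1 := (((((h.mom i).pow 8).add (HasMoments.const (s ^ 4))).const_mul (64 * c ^ 4)))
  have j2 := (((h.mom i).pow 8).const_mul 4).add ((hLm.pow 8).const_mul 4)
  refine (integral_mono ((h.quadDiff_hasMoments A i).pow 4).integrable
    (j1.add j2).integrable hpt).trans ?_
  rw [integral_add j1.integrable j2.integrable, integral_const_mul,
    integral_add ((h.mom i).pow 8).integrable (integrable_const _),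
    integral_add (((h.mom i).pow 8).const_mul 4).integrable ((hLm.pow 8).const_mul 4).integrable,
    integral_const_mul, integral_const_mul]
  have k1 := h.eighth i
  have k2 : ∫ ω, L ω ^ 8 ∂μ ≤ (2 * c) ^ 8 * M := h.integral_lin_pow_eight_le hA.lowerPart i
  have k3 : 64 * c ^ 4 * (∫ ω, X i ω ^ 8 ∂μ + s ^ 4) ≤ 64 * c ^ 4 * (M + s ^ 4) := by gcongr
  simp only [integral_const, probReal_univ, smul_eq_mul, one_mul]
  unfold diffBound
  linarith

/-- Fourth moments of centred quadratic forms are of the order of the squared dimension. -/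
lemma integral_quadForm_pow_four_le (h : IndepErrors μ X s M) {A : Matrix (Fin p) (Fin p) ℝ}
    {c : ℝ} (hA : SumBdd A c) :
    ∫ ω, ((fun j => X j ω) ⬝ᵥ (A *ᵥ fun j => X j ω) - s * A.trace) ^ 4 ∂μ
      ≤ 16 * diffBound c s M * p ^ 2 := by
  rcases Nat.eq_zero_or_pos p with rfl | hp
  · simp [Matrix.trace]
  have hD : 0 ≤ diffBound c s M :=
    (integral_nonneg fun ω => by positivity).trans (h.integral_quadDiff_pow_four_le hA ⟨0, hp⟩)
  have h1 := (h.martDiff_quadDiff A).integral_sum_pow_four_le (C := diffBound c s M)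
    (fun k => ?_) p
  · simp only [sum_extendZero, sum_quadDiff] at h1
    exact h1
  · by_cases hk : k < p
    · simpa only [extendZero, hk, dite_true] using h.integral_quadDiff_pow_four_le hA ⟨k, hk⟩
    · simpa [extendZero, hk] using hD

end IndepErrors

lemma integral_sub_integral_sq_le {Ω : Type*} {mΩ : MeasurableSpace Ω} {μ : Measure Ω}
    [IsProbabilityMeasure μ] {f : Ω → ℝ} (hf : HasMoments f μ) (c : ℝ) :
    ∫ ω, (f ω - ∫ ω', f ω' ∂μ) ^ 2 ∂μ ≤ ∫ ω, (f ω - c) ^ 2 ∂μ := by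
  have key : ∀ c : ℝ, ∫ ω, (f ω - c) ^ 2 ∂μ = ∫ ω, f ω ^ 2 ∂μ - 2 * c * ∫ ω, f ω ∂μ + c ^ 2 := by
    intro c
    have e : ∀ ω, (f ω - c) ^ 2 = f ω ^ 2 - 2 * c * f ω + c ^ 2 := fun ω => by ring
    simp only [e]
    rw [integral_add ((hf.pow 2).sub (hf.const_mul (2 * c))).integrable (integrable_const _),
      integral_sub (hf.pow 2).integrable (hf.const_mul (2 * c)).integrable, integral_const_mul]
    simp
  rw [key, key]
  nlinarith [sq_nonneg (∫ ω, f ω ∂μ - c)]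

lemma integral_sq_le_of_pow_four_le {Ω : Type*} {mΩ : MeasurableSpace Ω} {μ : Measure Ω}
    [IsProbabilityMeasure μ] {f : Ω → ℝ} (hf : HasMoments f μ) {p : ℕ} {C : ℝ}
    (h4 : ∫ ω, f ω ^ 4 ∂μ ≤ C * p ^ 2) : ∫ ω, f ω ^ 2 ∂μ ≤ (1 + C) / 2 * p := by
  rcases Nat.eq_zero_or_pos p with rfl | hp
  · have h0 : ∫ ω, f ω ^ 4 ∂μ = 0 :=
      le_antisymm (by simpa using h4) (integral_nonneg fun ω => by positivity)
    rw [integral_eq_zero_iff_of_nonneg (fun ω => by positivity) (hf.pow 4).integrable] at h0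
    have : (fun ω => f ω ^ 2) =ᵐ[μ] 0 := by
      filter_upwards [h0] with ω hω
      have : f ω = 0 := by simpa using hω
      simp [this]
    rw [integral_congr_ae this]; simp
  have hp' : (0 : ℝ) < p := by exact_mod_cast hp
  have hle : ∀ ω, f ω ^ 2 ≤ (p : ℝ) / 2 + (2 * p : ℝ)⁻¹ * f ω ^ 4 := by
    intro ω
    have e : (p : ℝ) / 2 + (2 * p : ℝ)⁻¹ * f ω ^ 4 - f ω ^ 2
        = (2 * p : ℝ)⁻¹ * (f ω ^ 2 - p) ^ 2 := by field_simp; ring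
    have : 0 ≤ (2 * p : ℝ)⁻¹ * (f ω ^ 2 - p) ^ 2 := by positivity
    linarith
  have m4 := (hf.pow 4).const_mul (2 * p : ℝ)⁻¹
  refine (integral_mono (hf.pow 2).integrable
    ((HasMoments.const ((p : ℝ) / 2)).add m4).integrable hle).trans ?_
  rw [integral_add (integrable_const _) m4.integrable, integral_const_mul]
  have h5 : (2 * p : ℝ)⁻¹ * ∫ ω, f ω ^ 4 ∂μ ≤ (2 * p : ℝ)⁻¹ * (C * p ^ 2) := by gcongr
  have h6 : (2 * p : ℝ)⁻¹ * (C * p ^ 2) = C / 2 * p := by field_simp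
  simp only [integral_const, probReal_univ, smul_eq_mul, one_mul]
  linarith

namespace IndepErrors

variable {Ω : Type*} {mΩ : MeasurableSpace Ω} {p : ℕ} {μ : Measure Ω} {X : Fin p → Ω → ℝ}
  {s M : ℝ} [IsProbabilityMeasure μ]

lemma quadForm_hasMoments (h : IndepErrors μ X s M) (A : Matrix (Fin p) (Fin p) ℝ) :
    HasMoments (fun ω => (fun j => X j ω) ⬝ᵥ (A *ᵥ fun j => X j ω) - s * A.trace) μ := by
  simp only [dotProduct]
  exact (HasMoments.sum _ fun i _ => (h.mom i).mul (h.lin_hasMoments A i)).sub (HasMoments.const _)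

/-- A bound for the second moments of the martingale part of the squared differences. -/
def sqDiffBound (c s M : ℝ) : ℝ :=
  4 * (diffBound c s M + c ^ 4 * (2 * (1 + M + s ^ 2)) ^ 2
    + 4 * c ^ 2 * (1 + M) ^ 2 * (1 + (2 * c) ^ 8 * M) + s ^ 2 * (1 + (2 * c) ^ 8 * M))

lemma integral_pow_four_le (h : IndepErrors μ X s M) (i : Fin p) :
    ∫ ω, (X i ω ^ 2 - s) ^ 2 ∂μ ≤ 2 * (1 + M + s ^ 2) := by
  have m := (((HasMoments.const (μ := μ) (1 + s ^ 2)).add ((h.mom i).pow 8)).const_mul 2)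
  refine (integral_mono ((((h.mom i).pow 2).sub (HasMoments.const s)).pow 2).integrable
    m.integrable fun ω => ?_).trans ?_
  · change (X i ω ^ 2 - s) ^ 2 ≤ 2 * (1 + s ^ 2 + X i ω ^ 8)
    nlinarith [sq_nonneg (X i ω ^ 2 + s), sq_nonneg (X i ω ^ 4 - 1)]
  · rw [integral_const_mul, integral_add (integrable_const _) ((h.mom i).pow 8).integrable]
    have := h.eighth i
    simp only [integral_const, probReal_univ, smul_eq_mul, one_mul]
    linarith

lemma abs_integral_pow_three_le (h : IndepErrors μ X s M) (i : Fin p) :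
    |∫ ω, (X i ω ^ 2 - s) * X i ω ∂μ| ≤ 1 + M := by
  have e : ∫ ω, (X i ω ^ 2 - s) * X i ω ∂μ = ∫ ω, X i ω ^ 3 ∂μ := by
    have e1 : ∀ ω, (X i ω ^ 2 - s) * X i ω = X i ω ^ 3 - s * X i ω := fun ω => by ring
    simp only [e1]
    rw [integral_sub ((h.mom i).pow 3).integrable ((h.mom i).const_mul s).integrable,
      integral_const_mul, h.mean, mul_zero, sub_zero]
  rw [e, ← Real.norm_eq_abs]
  have m := (HasMoments.const (μ := μ) 1).add ((h.mom i).pow 8)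
  refine (norm_integral_le_of_norm_le m.integrable (ae_of_all _ fun ω => ?_)).trans ?_
  · rw [Real.norm_eq_abs, abs_pow]
    have h1 : X i ω ^ 8 = |X i ω| ^ 8 := by rw [← abs_pow, abs_of_nonneg (by positivity)]
    rw [h1]
    have h2 := abs_nonneg (X i ω)
    rcases le_total |X i ω| 1 with h3 | h3
    · have := pow_le_one₀ h2 h3 (n := 3)
      have : 0 ≤ |X i ω| ^ 8 := by positivity
      linarith
    · have := pow_le_pow_right₀ h3 (show 3 ≤ 8 by norm_num)
      linarith
  · rw [integral_add (integrable_const _) ((h.mom i).pow 8).integrable]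
    have := h.eighth i
    simpa using this

/-- The sum of the squared martingale differences of a quadratic form has a variance of the order
of the dimension: after subtraction of a constant it is again a sum of martingale differences, a
linear form and a quadratic form. -/
lemma integral_sum_quadDiff_sq_sub_sq_le (h : IndepErrors μ X s M) {A : Matrix (Fin p) (Fin p) ℝ}
    {c : ℝ} (hA : SumBdd A c) (hs : 0 ≤ s) :
    ∫ ω, (∑ i, quadDiff X s A i ω ^ 2 - ∫ ω', ∑ i, quadDiff X s A i ω' ^ 2 ∂μ) ^ 2 ∂μ ≤
      3 * (sqDiffBound c s M + s * (2 * (2 * c * (c * (1 + M)))) ^ 2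
        + s ^ 2 * ((1 + 16 * diffBound (2 * c * (2 * c)) s M) / 2)) * p := by
  rcases Nat.eq_zero_or_pos p with rfl | hp
  · simp
  have hc := hA.nonneg ⟨0, hp⟩
  have hM : 0 ≤ M := (integral_nonneg fun ω => by positivity).trans (h.eighth ⟨0, hp⟩)
  set B := lowerPart A with hB
  have hBb : SumBdd B (2 * c) := hA.lowerPart
  set L : Fin p → Ω → ℝ := fun i ω => (B *ᵥ fun j => X j ω) i with hL
  have hLm : ∀ i, HasMoments (L i) μ := fun i => h.lin_hasMoments B i
  have hLmeas : ∀ i : Fin p, Measurable[past X h.meas i] (L i) := fun i => h.lin_measurable A i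
  set κ : Fin p → ℝ := fun i => ∫ ω, (X i ω ^ 2 - s) ^ 2 ∂μ with hκ
  set m : Fin p → ℝ := fun i => ∫ ω, (X i ω ^ 2 - s) * X i ω ∂μ with hm
  have hsqm : ∀ i, HasMoments (fun ω => X i ω ^ 2 - s) μ :=
    fun i => ((h.mom i).pow 2).sub (HasMoments.const s)
  have hsqmeas : Measurable fun x : ℝ => x ^ 2 - s := (measurable_id.pow_const 2).sub_const s
  -- the martingale part of the squares
  set Z : Fin p → Ω → ℝ := fun i ω => A i i ^ 2 * ((X i ω ^ 2 - s) ^ 2 - κ i)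
    + 2 * A i i * L i ω * ((X i ω ^ 2 - s) * X i ω - m i) + L i ω ^ 2 * (X i ω ^ 2 - s) with hZ
  have hZsq : ∀ i ω, Z i ω = quadDiff X s A i ω ^ 2
      - (A i i ^ 2 * κ i + 2 * (A i i * m i) * L i ω + s * L i ω ^ 2) := by
    intro i ω
    simp only [hZ, quadDiff, hL]
    ring
  have hZmart : MartDiff μ (past X h.meas) (extendZero Z) := by
    have h1 : MartDiff μ (past X h.meas)
        (extendZero fun i ω => A i i ^ 2 * ((X i ω ^ 2 - s) ^ 2 - κ i)) :=
      martDiff_extendZero h.indep (g := fun i _ => A i i ^ 2)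
        (φ := fun i x => (x ^ 2 - s) ^ 2 - κ i) (fun i => measurable_const)
        (fun i => HasMoments.const _) (fun i => (hsqmeas.pow_const 2).sub_const _)
        (fun i => ((hsqm i).pow 2).sub (HasMoments.const _)) (fun i => by
          rw [integral_sub ((hsqm i).pow 2).integrable (integrable_const _)]; simp [hκ])
    have h2 : MartDiff μ (past X h.meas) (extendZero fun i ω =>
        2 * A i i * L i ω * ((X i ω ^ 2 - s) * X i ω - m i)) :=
      martDiff_extendZero h.indep (g := fun i ω => 2 * A i i * L i ω)
        (φ := fun i x => (x ^ 2 - s) * x - m i) (fun i => (hLmeas i).const_mul _)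
        (fun i => (hLm i).const_mul _) (fun i => (hsqmeas.mul measurable_id).sub_const _)
        (fun i => ((hsqm i).mul (h.mom i)).sub (HasMoments.const _)) (fun i => by
          rw [integral_sub ((hsqm i).mul (h.mom i)).integrable (integrable_const _)]; simp [hm])
    have h3 : MartDiff μ (past X h.meas) (extendZero fun i ω =>
        L i ω ^ 2 * (X i ω ^ 2 - s)) :=
      martDiff_extendZero h.indep (g := fun i ω => L i ω ^ 2) (φ := fun i x => x ^ 2 - s)
        (fun i => (hLmeas i).pow_const 2) (fun i => (hLm i).pow 2) (fun i => hsqmeas) hsqm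
        (fun i => by
          rw [integral_sub ((h.mom i).pow 2).integrable (integrable_const _), h.var]; simp)
    convert (h1.add h2).add h3 using 1
    ext k ω
    simp only [extendZero, hZ]
    split_ifs <;> simp
  have hZm : ∀ i, HasMoments (Z i) μ := fun i =>
    ((((hsqm i).pow 2).sub (HasMoments.const (κ i))).const_mul (A i i ^ 2)).add
      (((hLm i).const_mul (2 * A i i)).mul (((hsqm i).mul (h.mom i)).sub (HasMoments.const (m i))))
      |>.add (((hLm i).pow 2).mul (hsqm i))
  have hZb : ∀ i, ∫ ω, Z i ω ^ 2 ∂μ ≤ sqDiffBound c s M := by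
    intro i
    have hAi := hA.abs_apply_le i i
    have hκ0 : 0 ≤ κ i := integral_nonneg fun ω => by positivity
    have hκi : κ i ≤ 2 * (1 + M + s ^ 2) := h.integral_pow_four_le i
    have hmi : |m i| ≤ 1 + M := h.abs_integral_pow_three_le i
    have hL8 : ∫ ω, L i ω ^ 8 ∂μ ≤ (2 * c) ^ 8 * M := h.integral_lin_pow_eight_le hBb i
    have hA2 : A i i ^ 2 ≤ c ^ 2 := by rw [← sq_abs]; gcongr
    have hm2 : m i ^ 2 ≤ (1 + M) ^ 2 := by rw [← sq_abs]; gcongr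
    have hpt : ∀ ω, Z i ω ^ 2 ≤ 4 * (quadDiff X s A i ω ^ 4)
        + (4 * (c ^ 4 * (2 * (1 + M + s ^ 2)) ^ 2)
          + 4 * (4 * c ^ 2 * (1 + M) ^ 2 + s ^ 2) * (1 + L i ω ^ 8)) := by
      intro ω
      rw [hZsq]
      generalize quadDiff X s A i ω = q
      generalize L i ω = l
      have f4 : ∀ a b c d : ℝ, (a - (b + c + d)) ^ 2 ≤ 4 * (a ^ 2 + b ^ 2 + c ^ 2 + d ^ 2) := by
        intro a b c d
        nlinarith [sq_nonneg (a + b), sq_nonneg (a + c), sq_nonneg (a + d), sq_nonneg (b - c),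
          sq_nonneg (b - d), sq_nonneg (c - d)]
      refine (f4 _ _ _ _).trans ?_
      have g1 : (A i i ^ 2 * κ i) ^ 2 ≤ c ^ 4 * (2 * (1 + M + s ^ 2)) ^ 2 := by
        calc (A i i ^ 2 * κ i) ^ 2 ≤ (c ^ 2 * (2 * (1 + M + s ^ 2))) ^ 2 := by gcongr
          _ = _ := by ring
      have l2 : l ^ 2 ≤ 1 + l ^ 8 := by
        nlinarith [sq_nonneg (l ^ 2 - 1), sq_nonneg (l ^ 4 - 1)]
      have l4 : l ^ 4 ≤ 1 + l ^ 8 := by nlinarith [sq_nonneg (l ^ 4 - 1)]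
      have g2 : (2 * (A i i * m i) * l) ^ 2 ≤ 4 * c ^ 2 * (1 + M) ^ 2 * (1 + l ^ 8) := by
        calc (2 * (A i i * m i) * l) ^ 2 = 4 * (A i i ^ 2) * (m i ^ 2) * l ^ 2 := by ring
          _ ≤ 4 * c ^ 2 * (1 + M) ^ 2 * (1 + l ^ 8) := by gcongr
      have g3 : (s * l ^ 2) ^ 2 ≤ s ^ 2 * (1 + l ^ 8) := by
        calc (s * l ^ 2) ^ 2 = s ^ 2 * l ^ 4 := by ring
          _ ≤ _ := by gcongr
      have g0 : (q ^ 2) ^ 2 = q ^ 4 := by ring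
      linarith
    have j1 := ((h.quadDiff_hasMoments A i).pow 4).const_mul 4
    have j3 := ((HasMoments.const (μ := μ) 1).add ((hLm i).pow 8)).const_mul
      (4 * (4 * c ^ 2 * (1 + M) ^ 2 + s ^ 2))
    have j2 := (HasMoments.const (μ := μ) (4 * (c ^ 4 * (2 * (1 + M + s ^ 2)) ^ 2))).add j3
    refine (integral_mono ((hZm i).pow 2).integrable (j1.add j2).integrable hpt).trans ?_
    rw [integral_add j1.integrable j2.integrable, integral_const_mul,
      integral_add (integrable_const _) j3.integrable,
      integral_const_mul (4 * (4 * c ^ 2 * (1 + M) ^ 2 + s ^ 2)),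
      integral_add (integrable_const _) ((hLm i).pow 8).integrable]
    have k1 := h.integral_quadDiff_pow_four_le hA i
    have k2 : 4 * (4 * c ^ 2 * (1 + M) ^ 2 + s ^ 2) * (1 + ∫ ω, L i ω ^ 8 ∂μ)
        ≤ 4 * (4 * c ^ 2 * (1 + M) ^ 2 + s ^ 2) * (1 + (2 * c) ^ 8 * M) := by gcongr
    simp only [integral_const, probReal_univ, smul_eq_mul, one_mul]
    unfold sqDiffBound
    linarith
  have hZsum : ∫ ω, (∑ i, Z i ω) ^ 2 ∂μ ≤ sqDiffBound c s M * p := by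
    have h1 := hZmart.integral_sum_sq p
    simp only [sum_extendZero] at h1
    rw [h1, Finset.sum_range]
    simp only [extendZero, Fin.is_lt, dite_true, Fin.eta]
    refine (Finset.sum_le_sum fun i _ => hZb i).trans (le_of_eq ?_)
    simp; ring
  -- the linear part
  set α : Fin p → ℝ := fun j => 2 * ∑ i, B i j * (A i i * m i) with hα
  have hαb : ∀ j, α j ^ 2 ≤ (2 * (2 * c * (c * (1 + M)))) ^ 2 := by
    intro j
    rw [← sq_abs]
    have h1 : |α j| ≤ 2 * (2 * c * (c * (1 + M))) := by
      simp only [hα, abs_mul, abs_two]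
      refine mul_le_mul_of_nonneg_left ?_ (by norm_num)
      refine (Finset.abs_sum_le_sum_abs _ _).trans ?_
      calc ∑ i, |B i j * (A i i * m i)| ≤ ∑ i, |B i j| * (c * (1 + M)) := by
            refine Finset.sum_le_sum fun i _ => ?_
            rw [abs_mul, abs_mul]
            have := hA.abs_apply_le i i
            have : |m i| ≤ 1 + M := h.abs_integral_pow_three_le i
            gcongr
        _ = (∑ i, |B i j|) * (c * (1 + M)) := by rw [Finset.sum_mul]
        _ ≤ 2 * c * (c * (1 + M)) := by
            have := hBb.col j
            gcongr
    gcongr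
  have hlin : ∀ ω, ∑ i, 2 * (A i i * m i) * L i ω = ∑ j, α j * X j ω := by
    intro ω
    simp only [hα, hL, Matrix.mulVec, dotProduct, Finset.mul_sum, Finset.sum_mul]
    rw [Finset.sum_comm]
    exact Finset.sum_congr rfl fun j _ => Finset.sum_congr rfl fun i _ => by ring
  have hlinb : ∫ ω, (∑ j, α j * X j ω) ^ 2 ∂μ ≤ s * (2 * (2 * c * (c * (1 + M)))) ^ 2 * p := by
    have h1 : MartDiff μ (past X h.meas) (extendZero fun i ω => α i * X i ω) :=
      martDiff_extendZero h.indep (g := fun i _ => α i) (φ := fun _ x => x)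
        (fun i => measurable_const) (fun i => HasMoments.const _) (fun i => measurable_id)
        h.mom h.mean
    have h2 := h1.integral_sum_sq p
    simp only [sum_extendZero] at h2
    rw [h2, Finset.sum_range]
    simp only [extendZero, Fin.is_lt, dite_true, Fin.eta, mul_pow, integral_const_mul, h.var]
    have h3 : ∀ i ∈ Finset.univ, α i ^ 2 * s ≤ s * (2 * (2 * c * (c * (1 + M)))) ^ 2 := by
      intro i _
      rw [mul_comm]
      exact mul_le_mul_of_nonneg_left (hαb i) hs
    refine (Finset.sum_le_sum h3).trans (le_of_eq ?_)
    simp; ring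
  -- the quadratic part
  have hquad : ∀ ω, ∑ i, L i ω ^ 2 = (fun j => X j ω) ⬝ᵥ ((Bᵀ * B) *ᵥ fun j => X j ω) := by
    intro ω
    rw [← Matrix.mulVec_mulVec, Matrix.dotProduct_mulVec, Matrix.vecMul_transpose, dotProduct]
    exact Finset.sum_congr rfl fun i _ => by simp only [hL]; ring
  have hquadb := integral_sq_le_of_pow_four_le (h.quadForm_hasMoments (Bᵀ * B))
    (h.integral_quadForm_pow_four_le (hBb.transpose.mul hBb))
  -- assembling the three parts
  set Q : Ω → ℝ := fun ω => (fun j => X j ω) ⬝ᵥ ((Bᵀ * B) *ᵥ fun j => X j ω)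
    - s * (Bᵀ * B).trace with hQ
  have hQm : HasMoments Q μ := h.quadForm_hasMoments (Bᵀ * B)
  have hlm : HasMoments (fun ω => ∑ j, α j * X j ω) μ :=
    HasMoments.sum _ fun j _ => (h.mom j).const_mul _
  have hZsm : HasMoments (fun ω => ∑ i, Z i ω) μ := HasMoments.sum _ fun i _ => hZm i
  have hYm : HasMoments (fun ω => ∑ i, quadDiff X s A i ω ^ 2) μ :=
    HasMoments.sum _ fun i _ => (h.quadDiff_hasMoments A i).pow 2
  refine (integral_sub_integral_sq_le hYm
    (∑ i, A i i ^ 2 * κ i + s * (s * (Bᵀ * B).trace))).trans ?_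
  have hdec : ∀ ω, (∑ i, quadDiff X s A i ω ^ 2
      - (∑ i, A i i ^ 2 * κ i + s * (s * (Bᵀ * B).trace))) ^ 2 ≤
      3 * (∑ i, Z i ω) ^ 2 + (3 * (∑ j, α j * X j ω) ^ 2 + 3 * s ^ 2 * Q ω ^ 2) := by
    intro ω
    have e : ∑ i, quadDiff X s A i ω ^ 2 - (∑ i, A i i ^ 2 * κ i + s * (s * (Bᵀ * B).trace))
        = ∑ i, Z i ω + ∑ j, α j * X j ω + s * Q ω := by
      have e1 : ∑ i, quadDiff X s A i ω ^ 2 = ∑ i, Z i ω + ∑ i, A i i ^ 2 * κ i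
          + ∑ i, 2 * (A i i * m i) * L i ω + s * ∑ i, L i ω ^ 2 := by
        rw [Finset.mul_sum, ← Finset.sum_add_distrib, ← Finset.sum_add_distrib,
          ← Finset.sum_add_distrib]
        exact Finset.sum_congr rfl fun i _ => by rw [hZsq]; ring
      rw [e1, hlin, hquad]
      simp only [hQ]; ring
    rw [e]
    nlinarith [sq_nonneg (∑ i, Z i ω - ∑ j, α j * X j ω), sq_nonneg (∑ i, Z i ω - s * Q ω),
      sq_nonneg (∑ j, α j * X j ω - s * Q ω)]
  have r1 := (hZsm.pow 2).const_mul 3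
  have r2 := (hlm.pow 2).const_mul 3
  have r3 := (hQm.pow 2).const_mul (3 * s ^ 2)
  refine (integral_mono ((hYm.sub (HasMoments.const _)).pow 2).integrable
    (r1.add (r2.add r3)).integrable hdec).trans ?_
  rw [integral_add r1.integrable (r2.add r3).integrable, integral_add r2.integrable r3.integrable,
    integral_const_mul, integral_const_mul, integral_const_mul]
  have hs2 : 3 * s ^ 2 * ∫ ω, Q ω ^ 2 ∂μ
      ≤ 3 * s ^ 2 * ((1 + 16 * diffBound (2 * c * (2 * c)) s M) / 2 * p) :=
    mul_le_mul_of_nonneg_left hquadb (by positivity)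
  linarith

end IndepErrors

/-- The central limit theorem for martingale differences along a sequence. -/
theorem tendsto_integral_exp_of_martDiff {Ω : ℕ → Type*} {mΩ : ∀ m, MeasurableSpace (Ω m)}
    {μ : ∀ m, Measure (Ω m)} [∀ m, IsProbabilityMeasure (μ m)] {ℱ : ∀ m, Filtration ℕ (mΩ m)}
    {ξ : ∀ m, ℕ → Ω m → ℝ} (h : ∀ m, MartDiff (μ m) (ℱ m) (ξ m)) (N : ℕ → ℕ) {v : ℝ}
    (h4 : Tendsto (fun m => ∑ j ∈ Finset.range (N m), ∫ ω, ξ m j ω ^ 4 ∂μ m) atTop (𝓝 0))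
    (h2 : Tendsto (fun m => ∫ ω, (∑ j ∈ Finset.range (N m), ξ m j ω ^ 2
      - ∫ ω', ∑ j ∈ Finset.range (N m), ξ m j ω' ^ 2 ∂μ m) ^ 2 ∂μ m) atTop (𝓝 0))
    (hv : Tendsto (fun m => ∫ ω, (∑ j ∈ Finset.range (N m), ξ m j ω) ^ 2 ∂μ m) atTop (𝓝 v)) :
    Tendsto (fun m => ∫ ω, Complex.exp ((∑ j ∈ Finset.range (N m), ξ m j ω : ℝ) * Complex.I) ∂μ m)
      atTop (𝓝 (Real.exp (-v / 2) : ℝ)) := by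
  have hv0 : 0 ≤ v := ge_of_tendsto' hv fun m => integral_nonneg fun ω => sq_nonneg _
  set γ : ℕ → ℝ := fun m => ∑ j ∈ Finset.range (N m), ∫ ω, ξ m j ω ^ 4 ∂μ m with hγ
  set β : ℕ → ℝ := fun m => ∫ ω, (∑ j ∈ Finset.range (N m), ξ m j ω ^ 2 - v) ^ 2 ∂μ m with hβ
  have hβ0 : Tendsto β atTop (𝓝 0) := by
    set w : ℕ → ℝ := fun m => ∫ ω, ∑ j ∈ Finset.range (N m), ξ m j ω ^ 2 ∂μ m with hw
    have hwv : Tendsto w atTop (𝓝 v) := by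
      refine hv.congr fun m => ?_
      rw [(h m).integral_sum_sq, hw]
      exact (integral_finsetSum _ fun j _ => (((h m).mom j).pow 2).integrable).symm
    have hlim : Tendsto (fun m => 2 * ∫ ω, (∑ j ∈ Finset.range (N m), ξ m j ω ^ 2
        - w m) ^ 2 ∂μ m + 2 * (w m - v) ^ 2) atTop (𝓝 0) := by
      have := (h2.const_mul 2).add (((hwv.sub_const v).pow 2).const_mul 2)
      simpa using this
    refine squeeze_zero (fun m => integral_nonneg fun ω => sq_nonneg _) (fun m => ?_) hlim
    have hm : HasMoments (fun ω => ∑ j ∈ Finset.range (N m), ξ m j ω ^ 2) (μ m) :=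
      HasMoments.sum _ fun j _ => ((h m).mom j).pow 2
    have m1 := ((hm.sub (HasMoments.const (w m))).pow 2).const_mul 2
    refine (integral_mono ((hm.sub (HasMoments.const v)).pow 2).integrable
      (m1.add (HasMoments.const (2 * (w m - v) ^ 2))).integrable fun ω => ?_).trans ?_
    · change (∑ j ∈ Finset.range (N m), ξ m j ω ^ 2 - v) ^ 2 ≤
        2 * (∑ j ∈ Finset.range (N m), ξ m j ω ^ 2 - w m) ^ 2 + 2 * (w m - v) ^ 2
      nlinarith [sq_nonneg ((∑ j ∈ Finset.range (N m), ξ m j ω ^ 2 - w m) - (w m - v))]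
    · rw [integral_add m1.integrable (integrable_const _), integral_const_mul]
      simp
  rw [tendsto_iff_norm_sub_tendsto_zero]
  -- letting first `m → ∞` and then `η → 0`
  have hbound : ∀ η > 0, ∀ m, ‖∫ ω, Complex.exp ((∑ j ∈ Finset.range (N m), ξ m j ω : ℝ)
      * Complex.I) ∂μ m - (Real.exp (-v / 2) : ℝ)‖ ≤ η * (Real.exp (v + 1) * (2 + γ m)) / 2
        + (8 * (v + 1) * γ m + 10 * β m) / (2 * η) + 2 * β m :=
    fun η hη m => (h m).norm_integral_exp_sub_le (N m) hv0 hη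
  have hlim : ∀ η > 0, Tendsto (fun m => η * (Real.exp (v + 1) * (2 + γ m)) / 2
        + (8 * (v + 1) * γ m + 10 * β m) / (2 * η) + 2 * β m) atTop
        (𝓝 (η * Real.exp (v + 1))) := by
    intro η hη
    have := ((((h4.const_add 2).const_mul (Real.exp (v + 1))).const_mul η).div_const 2).add
      (((h4.const_mul (8 * (v + 1))).add (hβ0.const_mul 10)).div_const (2 * η)) |>.add
      (hβ0.const_mul 2)
    convert this using 2
    ring
  rw [Metric.tendsto_atTop]
  intro ε hε
  set η := ε / (2 * Real.exp (v + 1)) with hη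
  have hη0 : 0 < η := by positivity
  have he : η * Real.exp (v + 1) < ε := by
    rw [hη]; field_simp; norm_num
  obtain ⟨m0, hm0⟩ := eventually_atTop.1 ((hlim η hη0).eventually_lt_const he)
  refine ⟨m0, fun m hm => ?_⟩
  rw [Real.dist_eq, sub_zero, abs_of_nonneg (norm_nonneg _)]
  exact (hbound η hη0 m).trans_lt (hm0 m hm)

/-! ### Quadratic forms in the errors of the model -/

/-- The centred quadratic form `xᵀAx - s tr A`. -/
def centredForm {n : ℕ} (s : ℝ) (A : Matrix (Fin n) (Fin n) ℝ) (x : Fin n → ℝ) : ℝ :=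
  x ⬝ᵥ (A *ᵥ x) - s * A.trace

/-- The sum over time of centred quadratic forms. -/
def formSum {n T : ℕ} (s : ℝ) (A : Fin T → Matrix (Fin n) (Fin n) ℝ) (x : Fin T → Fin n → ℝ) : ℝ :=
  ∑ t, centredForm s (A t) (x t)

lemma measurable_centredForm {n : ℕ} (s : ℝ) (A : Matrix (Fin n) (Fin n) ℝ) :
    Measurable (centredForm s A) := by
  unfold centredForm
  simp only [dotProduct, Matrix.mulVec]
  fun_prop

/-- A bound for the eighth moments of the errors. -/
def eighthBound (K : ℝ) : ℝ := (8 * |K|) ^ 8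

namespace ErrorCond

variable {Ω : Type*} [mΩ : MeasurableSpace Ω] {n T : ℕ} {μ : Measure Ω}
  {ε : Ω → Fin T → Fin n → ℝ} {s K : ℝ}

lemma measurable_row (h : ErrorCond μ ε s K) (t : Fin T) : Measurable fun ω => ε ω t :=
  measurable_pi_iff.2 fun i => h.meas t i

variable [IsProbabilityMeasure μ]

lemma hasMoments (h : ErrorCond μ ε s K) (t : Fin T) (i : Fin n) :
    HasMoments (fun ω => ε ω t i) μ := by
  intro p hp
  have h1 : MemLp (fun ω => ε ω t i) (ENNReal.ofReal (max 1 p.toReal)) μ :=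
    ⟨(h.meas t i).aestronglyMeasurable,
      (h.tail t i _ (le_max_left _ _)).trans_lt ENNReal.ofReal_lt_top⟩
  refine h1.mono_exponent ?_
  rw [← ENNReal.ofReal_toReal hp]
  exact ENNReal.ofReal_le_ofReal (by simp)

lemma integral_pow_eight_le (h : ErrorCond μ ε s K) (t : Fin T) (i : Fin n) :
    ∫ ω, ε ω t i ^ 8 ∂μ ≤ eighthBound K := by
  have h1 := h.tail t i 8 (by norm_num)
  have hm : MemLp (fun ω => ε ω t i) 8 μ := h.hasMoments t i 8 (by simp)
  have e8 : ENNReal.ofReal 8 = 8 := by norm_num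
  rw [e8, hm.eLpNorm_eq_integral_rpow_norm (by norm_num) (by norm_num)] at h1
  have h2 : (∫ ω, ‖ε ω t i‖ ^ (8 : ℝ≥0∞).toReal ∂μ) = ∫ ω, ε ω t i ^ 8 ∂μ := by
    congr 1; ext ω
    have : (8 : ℝ≥0∞).toReal = ((8 : ℕ) : ℝ) := by norm_num
    rw [this, Real.rpow_natCast, Real.norm_eq_abs, ← abs_pow, abs_of_nonneg (by positivity)]
  rw [h2] at h1
  have h3 : (∫ ω, ε ω t i ^ 8 ∂μ) ^ ((8 : ℝ≥0∞).toReal)⁻¹ ≤ 8 * |K| := by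
    refine (ENNReal.ofReal_le_ofReal_iff (by positivity)).1 (h1.trans ?_)
    exact ENNReal.ofReal_le_ofReal (by nlinarith [le_abs_self K])
  have h0 : 0 ≤ ∫ ω, ε ω t i ^ 8 ∂μ := integral_nonneg fun ω => by positivity
  have h4 : ∫ ω, ε ω t i ^ 8 ∂μ = ((∫ ω, ε ω t i ^ 8 ∂μ) ^ ((8 : ℝ≥0∞).toReal)⁻¹) ^ 8 := by
    have : (8 : ℝ≥0∞).toReal = ((8 : ℕ) : ℝ) := by norm_num
    rw [this, Real.rpow_inv_natCast_pow h0 (by norm_num)]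
  rw [h4]
  exact pow_le_pow_left₀ (Real.rpow_nonneg h0 _) h3 8

lemma hasMoments_centredForm (h : ErrorCond μ ε s K) (t : Fin T) (A : Matrix (Fin n) (Fin n) ℝ) :
    HasMoments (fun ω => centredForm s A (ε ω t)) μ := by
  simp only [centredForm, dotProduct, Matrix.mulVec]
  exact (HasMoments.sum _ fun i _ => (h.hasMoments t i).mul
    (HasMoments.sum _ fun j _ => (h.hasMoments t j).const_mul _)).sub (HasMoments.const _)

lemma integral_quadForm (h : ErrorCond μ ε s K) (t : Fin T) (A : Matrix (Fin n) (Fin n) ℝ) :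
    ∫ ω, ε ω t ⬝ᵥ (A *ᵥ ε ω t) ∂μ = s * A.trace := by
  have m : ∀ i j, HasMoments (fun ω => A i j * (ε ω t i * ε ω t j)) μ := fun i j =>
    ((h.hasMoments t i).mul (h.hasMoments t j)).const_mul _
  have e : ∀ ω, ε ω t ⬝ᵥ (A *ᵥ ε ω t) = ∑ i, ∑ j, A i j * (ε ω t i * ε ω t j) := by
    intro ω
    simp only [dotProduct, Matrix.mulVec, Finset.mul_sum]
    exact Finset.sum_congr rfl fun i _ => Finset.sum_congr rfl fun j _ => by ring
  simp only [e]
  rw [integral_finsetSum _ fun i _ => (HasMoments.sum _ fun j _ => m i j).integrable]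
  simp only [Matrix.trace, Matrix.diag_apply, Finset.mul_sum]
  refine Finset.sum_congr rfl fun i _ => ?_
  rw [integral_finsetSum _ fun j _ => (m i j).integrable]
  simp only [integral_const_mul, h.covar]
  simp [mul_comm]

lemma integral_centredForm (h : ErrorCond μ ε s K) (t : Fin T) (A : Matrix (Fin n) (Fin n) ℝ) :
    ∫ ω, centredForm s A (ε ω t) ∂μ = 0 := by
  have m : HasMoments (fun ω => ε ω t ⬝ᵥ (A *ᵥ ε ω t)) μ := by
    simp only [dotProduct, Matrix.mulVec]
    exact HasMoments.sum _ fun i _ => (h.hasMoments t i).mul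
      (HasMoments.sum _ fun j _ => (h.hasMoments t j).const_mul _)
  simp only [centredForm]
  rw [integral_sub m.integrable (integrable_const _), h.integral_quadForm]
  simp

/-- The product of the marginal distributions of the errors at one time point. -/
noncomputable def marginals (μ : Measure Ω) (ε : Ω → Fin T → Fin n → ℝ) (t : Fin T) :
    Measure (Fin n → ℝ) :=
  Measure.pi fun i => μ.map fun ω => ε ω t i

lemma isProbabilityMeasure_map (h : ErrorCond μ ε s K) (t : Fin T) (i : Fin n) :
    IsProbabilityMeasure (μ.map fun ω => ε ω t i) :=
  Measure.isProbabilityMeasure_map (h.meas t i).aemeasurable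

/-- Up to total degree eight, the factorization of the mixed moments makes polynomials of the
errors have the same expectation as under independence. -/
lemma integral_eval_eq (h : ErrorCond μ ε s K) (t : Fin T) (P : MvPolynomial (Fin n) ℝ)
    (hP : P.totalDegree ≤ 8) :
    ∫ ω, MvPolynomial.eval (ε ω t) P ∂μ
      = ∫ x, MvPolynomial.eval x P ∂(marginals μ ε t) := by
  have := h.isProbabilityMeasure_map t
  have hmom : ∀ i, HasMoments (fun x : ℝ => x) (μ.map fun ω => ε ω t i) := by
    intro i p hp
    exact (memLp_map_measure_iff measurable_id.aestronglyMeasurable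
      (h.meas t i).aemeasurable).2 (h.hasMoments t i p hp)
  have hmon : ∀ e : Fin n →₀ ℕ, Integrable (fun ω => ∏ i, ε ω t i ^ e i) μ := fun e =>
    (HasMoments.prod _ fun i _ => (h.hasMoments t i).pow _).integrable
  have hmon' : ∀ e : Fin n →₀ ℕ, Integrable (fun x : Fin n → ℝ => ∏ i, x i ^ e i)
      (marginals μ ε t) := fun e =>
    Integrable.fintype_prod (f := fun i x => x ^ e i) fun i => ((hmom i).pow _).integrable
  simp only [MvPolynomial.eval_eq']
  rw [integral_finsetSum _ fun e _ => (hmon e).const_mul _,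
    integral_finsetSum _ fun e _ => (hmon' e).const_mul _]
  refine Finset.sum_congr rfl fun e he => ?_
  rw [integral_const_mul, integral_const_mul]
  congr 1
  have hdeg : ∑ i, e i ≤ 8 := by
    have := MvPolynomial.le_totalDegree he
    rw [Finsupp.sum_fintype _ _ (fun _ => rfl)] at this
    exact this.trans hP
  rw [h.factor t e hdeg]
  have h1 := integral_fintype_prod_eq_prod (fun (i : Fin n) (x : ℝ) => x ^ e i)
    (μ := fun i => μ.map fun ω => ε ω t i)
  rw [marginals, h1]
  refine Finset.prod_congr rfl fun i _ => ?_
  rw [integral_map (h.meas t i).aemeasurable (by fun_prop)]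

lemma indepErrors_marginals (h : ErrorCond μ ε s K) (t : Fin T) :
    IndepErrors (marginals μ ε t) (fun i x => x i) s (eighthBound K) := by
  have := h.isProbabilityMeasure_map t
  have hmp : ∀ i, (marginals μ ε t).map (fun x => x i) = μ.map fun ω => ε ω t i := fun i =>
    (measurePreserving_eval (fun i => μ.map fun ω => ε ω t i) i).map_eq
  have hint : ∀ (i : Fin n) (k : ℕ), ∫ x, x i ^ k ∂(marginals μ ε t) = ∫ ω, ε ω t i ^ k ∂μ := by
    intro i k
    have h1 := integral_map (μ := marginals μ ε t) (φ := fun x => x i)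
      (measurable_pi_apply i).aemeasurable (f := fun y : ℝ => y ^ k)
      (measurable_id.pow_const k).aestronglyMeasurable
    rw [← h1, hmp, integral_map (h.meas t i).aemeasurable
      (f := fun y : ℝ => y ^ k) (measurable_id.pow_const k).aestronglyMeasurable]
  refine ⟨fun i => measurable_pi_apply i, ?_, fun i p hp => ?_, fun i => ?_, fun i => ?_,
    fun i => ?_⟩
  · exact iIndepFun_pi (μ := fun i => μ.map fun ω => ε ω t i) (X := fun i x => x)
      fun i => aemeasurable_id
  · have h1 : MemLp (fun x : ℝ => x) p ((marginals μ ε t).map fun x => x i) := by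
      rw [hmp]
      exact (memLp_map_measure_iff measurable_id.aestronglyMeasurable
        (h.meas t i).aemeasurable).2 (h.hasMoments t i p hp)
    exact (memLp_map_measure_iff measurable_id.aestronglyMeasurable
      (measurable_pi_apply i).aemeasurable).1 h1
  · have := hint i 1
    simp only [pow_one] at this
    rw [this, h.mean]
  · rw [hint]
    have := h.covar t i i
    simp only [if_true, ← sq] at this
    exact this
  · rw [hint]; exact h.integral_pow_eight_le t i

lemma isProbabilityMeasure_marginals (h : ErrorCond μ ε s K) (t : Fin T) :
    IsProbabilityMeasure (marginals μ ε t) := by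
  have := h.isProbabilityMeasure_map t
  unfold marginals
  infer_instance

lemma integral_centredForm_pow_four_le (h : ErrorCond μ ε s K) (t : Fin T)
    {A : Matrix (Fin n) (Fin n) ℝ} {c : ℝ} (hA : SumBdd A c) :
    ∫ ω, centredForm s A (ε ω t) ^ 4 ∂μ
      ≤ 16 * IndepErrors.diffBound c s (eighthBound K) * n ^ 2 := by
  have := h.isProbabilityMeasure_marginals t
  set P : MvPolynomial (Fin n) ℝ := (∑ i, ∑ j, MvPolynomial.C (A i j) *
    (MvPolynomial.X i * MvPolynomial.X j) - MvPolynomial.C (s * A.trace)) ^ 4 with hP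
  have hev : ∀ x : Fin n → ℝ, MvPolynomial.eval x P = centredForm s A x ^ 4 := by
    intro x
    simp only [hP, map_pow, map_sub, map_sum, map_mul, MvPolynomial.eval_C, MvPolynomial.eval_X,
      centredForm, dotProduct, Matrix.mulVec, Finset.mul_sum]
    congr 2
    exact Finset.sum_congr rfl fun i _ => Finset.sum_congr rfl fun j _ => by ring
  have hdeg : P.totalDegree ≤ 8 := by
    refine (MvPolynomial.totalDegree_pow _ _).trans ?_
    suffices H : (∑ i, ∑ j, MvPolynomial.C (A i j) *
        (MvPolynomial.X i * MvPolynomial.X j) - MvPolynomial.C (s * A.trace) :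
        MvPolynomial (Fin n) ℝ).totalDegree ≤ 2 by omega
    refine (MvPolynomial.totalDegree_sub _ _).trans (max_le ?_ ?_)
    · refine MvPolynomial.totalDegree_finsetSum_le fun i _ =>
        MvPolynomial.totalDegree_finsetSum_le fun j _ => ?_
      refine (MvPolynomial.totalDegree_mul _ _).trans ?_
      rw [MvPolynomial.totalDegree_C, zero_add]
      refine (MvPolynomial.totalDegree_mul _ _).trans ?_
      simp
    · rw [MvPolynomial.totalDegree_C]; norm_num
  have h1 := h.integral_eval_eq t P hdeg
  simp only [hev] at h1
  rw [h1]
  exact (h.indepErrors_marginals t).integral_quadForm_pow_four_le hA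

lemma martDiff_centredForm (h : ErrorCond μ ε s K) (A : Fin T → Matrix (Fin n) (Fin n) ℝ) (a : ℝ) :
    MartDiff μ (past (fun t ω => ε ω t) h.measurable_row)
      (extendZero fun t ω => a * centredForm s (A t) (ε ω t)) :=
  martDiff_extendZero h.indep (g := fun _ _ => a) (φ := fun t x => centredForm s (A t) x)
    (fun _ => measurable_const) (fun _ => HasMoments.const _)
    (fun t => measurable_centredForm s (A t)) (fun t => h.hasMoments_centredForm t (A t))
    (fun t => h.integral_centredForm t (A t))

lemma hasMoments_formSum (h : ErrorCond μ ε s K) (A : Fin T → Matrix (Fin n) (Fin n) ℝ) :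
    HasMoments (fun ω => formSum s A (ε ω)) μ :=
  HasMoments.sum _ fun t _ => h.hasMoments_centredForm t (A t)

lemma integral_formSum (h : ErrorCond μ ε s K) (A : Fin T → Matrix (Fin n) (Fin n) ℝ) :
    ∫ ω, formSum s A (ε ω) ∂μ = 0 := by
  simp only [formSum]
  rw [integral_finsetSum _ fun t _ => (h.hasMoments_centredForm t (A t)).integrable]
  exact Finset.sum_eq_zero fun t _ => h.integral_centredForm t (A t)

/-- A bound for the variance of `formSum` per observation. -/
noncomputable def formBound (c s K : ℝ) : ℝ :=
  (1 + 16 * IndepErrors.diffBound c s (eighthBound K)) / 2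

lemma integral_formSum_sq_le (h : ErrorCond μ ε s K) {A : Fin T → Matrix (Fin n) (Fin n) ℝ}
    {c : ℝ} (hA : ∀ t, SumBdd (A t) c) :
    ∫ ω, formSum s A (ε ω) ^ 2 ∂μ ≤ formBound c s K * (n * T) := by
  have h1 := (h.martDiff_centredForm A 1).integral_sum_sq T
  simp only [sum_extendZero, one_mul] at h1
  simp only [formSum]
  rw [h1, Finset.sum_range]
  simp only [extendZero, Fin.is_lt, dite_true, Fin.eta]
  refine (Finset.sum_le_sum fun t _ => integral_sq_le_of_pow_four_le
    (h.hasMoments_centredForm t (A t)) (h.integral_centredForm_pow_four_le t (hA t))).trans ?_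
  simp only [Finset.sum_const, Finset.card_univ, Fintype.card_fin, nsmul_eq_mul, formBound]
  linarith

end ErrorCond

section Flatten

variable {n T : ℕ}

/-- The block diagonal matrix with blocks `A t`, indexed by the pairs `(t, i)` in lexicographic
order. -/
def flatMat (A : Fin T → Matrix (Fin n) (Fin n) ℝ) : Matrix (Fin (T * n)) (Fin (T * n)) ℝ :=
  Matrix.of fun k l =>
    if (finProdFinEquiv.symm k).1 = (finProdFinEquiv.symm l).1 then
      A (finProdFinEquiv.symm k).1 (finProdFinEquiv.symm k).2 (finProdFinEquiv.symm l).2 else 0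

lemma sum_flat (f : Fin T × Fin n → ℝ) :
    ∑ k : Fin (T * n), f (finProdFinEquiv.symm k) = ∑ t, ∑ i, f (t, i) := by
  rw [Equiv.sum_comp finProdFinEquiv.symm f, Fintype.sum_prod_type]

lemma SumBdd.flatMat {A : Fin T → Matrix (Fin n) (Fin n) ℝ} {c : ℝ} (hA : ∀ t, SumBdd (A t) c) :
    SumBdd (flatMat A) c := by
  constructor
  · intro k
    simp only [MIR.flatMat, Matrix.of_apply]
    rw [sum_flat (fun q => |if (finProdFinEquiv.symm k).1 = q.1 then
      A (finProdFinEquiv.symm k).1 (finProdFinEquiv.symm k).2 q.2 else 0|)]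
    rw [Finset.sum_eq_single (finProdFinEquiv.symm k).1]
    · simpa using (hA _).row _
    · intro t _ ht
      exact Finset.sum_eq_zero fun i _ => by simp only [if_neg ht.symm, abs_zero]
    · simp
  · intro k
    simp only [MIR.flatMat, Matrix.of_apply]
    rw [sum_flat (fun q => |if q.1 = (finProdFinEquiv.symm k).1 then
      A q.1 q.2 (finProdFinEquiv.symm k).2 else 0|)]
    rw [Finset.sum_eq_single (finProdFinEquiv.symm k).1]
    · simpa using (hA _).col _
    · intro t _ ht
      exact Finset.sum_eq_zero fun i _ => by simp only [if_neg ht, abs_zero]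
    · simp

lemma formSum_eq_flat (s : ℝ) (A : Fin T → Matrix (Fin n) (Fin n) ℝ) (x : Fin T → Fin n → ℝ) :
    formSum s A x = (fun k => x (finProdFinEquiv.symm k).1 (finProdFinEquiv.symm k).2) ⬝ᵥ
      (flatMat A *ᵥ fun k => x (finProdFinEquiv.symm k).1 (finProdFinEquiv.symm k).2)
      - s * (flatMat A).trace := by
  have h1 : (flatMat A).trace = ∑ t, (A t).trace := by
    simp only [Matrix.trace, Matrix.diag_apply, flatMat, Matrix.of_apply, if_true]
    exact sum_flat (fun q => A q.1 q.2 q.2)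
  have h2 : ∀ k : Fin (T * n),
      (flatMat A *ᵥ fun k => x (finProdFinEquiv.symm k).1 (finProdFinEquiv.symm k).2) k
      = (A (finProdFinEquiv.symm k).1 *ᵥ x (finProdFinEquiv.symm k).1)
        (finProdFinEquiv.symm k).2 := by
    intro k
    simp only [Matrix.mulVec, dotProduct, flatMat, Matrix.of_apply]
    rw [sum_flat (fun q => (if (finProdFinEquiv.symm k).1 = q.1 then
      A (finProdFinEquiv.symm k).1 (finProdFinEquiv.symm k).2 q.2 else 0) * x q.1 q.2)]
    rw [Finset.sum_eq_single (finProdFinEquiv.symm k).1]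
    · simp
    · intro t _ ht
      exact Finset.sum_eq_zero fun i _ => by simp only [if_neg ht.symm, zero_mul]
    · simp
  rw [h1, dotProduct]
  simp only [h2]
  rw [sum_flat (fun q => x q.1 q.2 * (A q.1 *ᵥ x q.1) q.2), Finset.mul_sum,
    ← Finset.sum_sub_distrib]
  rfl

lemma ErrorCond.indepErrors_flat {Ω : Type*} [mΩ : MeasurableSpace Ω] {μ : Measure Ω}
    [IsProbabilityMeasure μ] {ε : Ω → Fin T → Fin n → ℝ} {s K : ℝ} (h : ErrorCond μ ε s K)
    (hi : ∀ t, iIndepFun (fun i ω => ε ω t i) μ) :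
    IndepErrors μ (fun k ω => ε ω (finProdFinEquiv.symm k).1 (finProdFinEquiv.symm k).2)
      s (eighthBound K) := by
  refine ⟨fun k => h.meas _ _, ?_, fun k => h.hasMoments _ _, fun k => h.mean _ _, fun k => ?_,
    fun k => h.integral_pow_eight_le _ _⟩
  · have h1 := iIndepFun_uncurry' (X := fun t i ω => ε ω t i) (P := μ) (fun t i => h.meas t i)
      h.indep hi
    exact h1.precomp finProdFinEquiv.symm.injective
  · have := h.covar (finProdFinEquiv.symm k).1 (finProdFinEquiv.symm k).2
      (finProdFinEquiv.symm k).2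
    simp only [if_true, ← sq] at this
    exact this

end Flatten

lemma MartDiff.const_mul {Ω : Type*} {mΩ : MeasurableSpace Ω} {μ : Measure Ω}
    {ℱ : Filtration ℕ mΩ} {ξ : ℕ → Ω → ℝ} (h : MartDiff μ ℱ ξ) (a : ℝ) :
    MartDiff μ ℱ fun i ω => a * ξ i ω := by
  refine ⟨fun i => (h.meas i).const_mul a, fun i => (h.mom i).const_mul a, fun i g hg hgm => ?_⟩
  have e : ∀ ω, g ω * (a * ξ i ω) = a * (g ω * ξ i ω) := fun ω => by ring
  simp only [e, integral_const_mul, h.orth i g hg hgm, mul_zero]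

section CLT

variable {n T : ℕ → ℕ} {Ω : ℕ → Type*} [mΩ : ∀ m, MeasurableSpace (Ω m)]
  {μ : ∀ m, Measure (Ω m)} [∀ m, IsProbabilityMeasure (μ m)]
  {ε : ∀ m, Ω m → Fin (T m) → Fin (n m) → ℝ} {s K c v : ℝ}
  {A : ∀ m, Fin (T m) → Matrix (Fin (n m)) (Fin (n m)) ℝ}

lemma tendsto_inv_natCast_mul (hnT : Tendsto (fun m => n m * T m) atTop atTop) (C : ℝ) :
    Tendsto (fun m => C * ((n m : ℝ) * T m)⁻¹) atTop (𝓝 0) := by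
  have h1 : Tendsto (fun m => (((n m * T m : ℕ) : ℝ))⁻¹) atTop (𝓝 0) :=
    tendsto_inv_atTop_zero.comp (tendsto_natCast_atTop_atTop.comp hnT)
  simpa using h1.const_mul C

/-- Central limit theorem for quadratic forms when the number of independent vectors diverges: here
the forms at the single time points are the martingale differences. -/
theorem tendsto_integral_exp_formSum_of_tendsto (hnT : Tendsto (fun m => n m * T m) atTop atTop)
    (herr : ∀ m, ErrorCond (μ m) (ε m) s K) (hT : Tendsto T atTop atTop)
    (hA : ∀ m t, SumBdd (A m t) c)
    (hv : Tendsto (fun m => ∫ ω, ((√((n m : ℝ) * T m))⁻¹ * formSum s (A m) (ε m ω)) ^ 2 ∂μ m)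
      atTop (𝓝 v)) :
    Tendsto (fun m => ∫ ω, Complex.exp
      (((√((n m : ℝ) * T m))⁻¹ * formSum s (A m) (ε m ω) : ℝ) * Complex.I) ∂μ m)
      atTop (𝓝 (Real.exp (-v / 2) : ℝ)) := by
  set a : ℕ → ℝ := fun m => (√((n m : ℝ) * T m))⁻¹ with ha
  set ξ : ∀ m, Fin (T m) → Ω m → ℝ := fun m t ω => a m * centredForm s (A m t) (ε m ω t) with hξ
  have hmart : ∀ m, MartDiff (μ m) _ (extendZero (ξ m)) :=
    fun m => (herr m).martDiff_centredForm (A m) (a m)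
  have hξm : ∀ m t, HasMoments (ξ m t) (μ m) := fun m t =>
    ((herr m).hasMoments_centredForm t (A m t)).const_mul _
  have hsum : ∀ m ω, a m * formSum s (A m) (ε m ω) = ∑ t, ξ m t ω := by
    intro m ω
    simp only [formSum, Finset.mul_sum, hξ]
  set D := 16 * IndepErrors.diffBound c s (eighthBound K) with hD
  have h4le : ∀ m, n m * T m ≠ 0 → ∑ t, ∫ ω, ξ m t ω ^ 4 ∂μ m ≤ D * (T m : ℝ)⁻¹ := by
    intro m hm
    have hn : (n m : ℝ) ≠ 0 := by
      intro h; apply hm; rw [Nat.cast_eq_zero] at h; simp [h]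
    have hTm : (T m : ℝ) ≠ 0 := by
      intro h; apply hm; rw [Nat.cast_eq_zero] at h; simp [h]
    have ha4 : a m ^ 4 = ((n m : ℝ) * T m)⁻¹ ^ 2 := by
      simp only [ha]
      rw [← Real.sqrt_inv]
      have : (0 : ℝ) ≤ ((n m : ℝ) * T m)⁻¹ := by positivity
      calc √((n m : ℝ) * T m)⁻¹ ^ 4 = (√((n m : ℝ) * T m)⁻¹ ^ 2) ^ 2 := by ring
        _ = _ := by rw [Real.sq_sqrt this]
    calc ∑ t, ∫ ω, ξ m t ω ^ 4 ∂μ m ≤ ∑ _t : Fin (T m), a m ^ 4 * (D * (n m : ℝ) ^ 2) := by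
          refine Finset.sum_le_sum fun t _ => ?_
          simp only [hξ, mul_pow, integral_const_mul]
          exact mul_le_mul_of_nonneg_left
            ((herr m).integral_centredForm_pow_four_le t (hA m t)) (by positivity)
      _ = D * (T m : ℝ)⁻¹ := by
          rw [Finset.sum_const, Finset.card_univ, Fintype.card_fin, nsmul_eq_mul, ha4]
          field_simp
  have hTinv : Tendsto (fun m => D * (T m : ℝ)⁻¹) atTop (𝓝 0) := by
    have := ((tendsto_inv_atTop_zero.comp (tendsto_natCast_atTop_atTop.comp hT)).const_mul D)
    simpa using this
  have hev : ∀ᶠ m in atTop, n m * T m ≠ 0 := by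
    filter_upwards [hnT.eventually_gt_atTop 0] with m hm using hm.ne'
  have h4 : Tendsto (fun m => ∑ t, ∫ ω, ξ m t ω ^ 4 ∂μ m) atTop (𝓝 0) :=
    squeeze_zero' (Eventually.of_forall fun m =>
      Finset.sum_nonneg fun t _ => integral_nonneg fun ω => by positivity)
      (hev.mono h4le) hTinv
  have hconv := tendsto_integral_exp_of_martDiff hmart T (v := v) ?_ ?_ ?_
  · simpa only [sum_extendZero, ← hsum] using hconv
  · refine h4.congr fun m => ?_
    rw [Finset.sum_range]
    simp only [extendZero, Fin.is_lt, dite_true, Fin.eta]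
  · -- the squares are independent, so their variances add up
    refine squeeze_zero (fun m => integral_nonneg fun ω => sq_nonneg _) (fun m => ?_) h4
    simp only [sum_extendZero_pow]
    have hm2 : MartDiff (μ m) (past (fun t ω => ε m ω t) (herr m).measurable_row)
        (extendZero fun t ω => (1 : ℝ) * ((a m * centredForm s (A m t) (ε m ω t)) ^ 2
          - ∫ ω', ξ m t ω' ^ 2 ∂μ m)) :=
      martDiff_extendZero (herr m).indep (g := fun _ _ => (1 : ℝ))
        (φ := fun t x => (a m * centredForm s (A m t) x) ^ 2 - ∫ ω', ξ m t ω' ^ 2 ∂μ m)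
        (fun _ => measurable_const) (fun _ => HasMoments.const _)
        (fun t => (((measurable_centredForm s (A m t)).const_mul _).pow_const 2).sub_const _)
        (fun t => ((hξm m t).pow 2).sub (HasMoments.const _)) (fun t => by
          have := integral_sub ((hξm m t).pow 2).integrable
            (integrable_const (μ := μ m) (∫ ω', ξ m t ω' ^ 2 ∂μ m))
          simp only [hξ] at this ⊢
          rw [this]; simp)
    have h2 := hm2.integral_sum_sq (T m)
    simp only [sum_extendZero, one_mul] at h2
    rw [Finset.sum_range] at h2
    simp only [extendZero, Fin.is_lt, dite_true, Fin.eta] at h2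
    rw [integral_finsetSum _ fun t _ => ((hξm m t).pow 2).integrable]
    simp only [← Finset.sum_sub_distrib]
    refine (le_of_eq h2).trans (Finset.sum_le_sum fun t _ => ?_)
    refine (integral_sub_integral_sq_le ((hξm m t).pow 2) 0).trans (le_of_eq ?_)
    congr 1; ext ω; ring
  · simpa only [sum_extendZero, ← hsum] using hv

/-- Central limit theorem for quadratic forms in independent errors. -/
theorem tendsto_integral_exp_formSum_of_indep (hnT : Tendsto (fun m => n m * T m) atTop atTop)
    (herr : ∀ m, ErrorCond (μ m) (ε m) s K)
    (hind : ∀ m t, iIndepFun (fun i ω => ε m ω t i) (μ m)) (hs : 0 ≤ s)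
    (hA : ∀ m t, SumBdd (A m t) c)
    (hv : Tendsto (fun m => ∫ ω, ((√((n m : ℝ) * T m))⁻¹ * formSum s (A m) (ε m ω)) ^ 2 ∂μ m)
      atTop (𝓝 v)) :
    Tendsto (fun m => ∫ ω, Complex.exp
      (((√((n m : ℝ) * T m))⁻¹ * formSum s (A m) (ε m ω) : ℝ) * Complex.I) ∂μ m)
      atTop (𝓝 (Real.exp (-v / 2) : ℝ)) := by
  set a : ℕ → ℝ := fun m => (√((n m : ℝ) * T m))⁻¹ with ha
  set X : ∀ m, Fin (T m * n m) → Ω m → ℝ :=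
    fun m k ω => ε m ω (finProdFinEquiv.symm k).1 (finProdFinEquiv.symm k).2 with hX
  have hXi : ∀ m, IndepErrors (μ m) (X m) s (eighthBound K) :=
    fun m => (herr m).indepErrors_flat (hind m)
  set q : ∀ m, Fin (T m * n m) → Ω m → ℝ :=
    fun m => IndepErrors.quadDiff (X m) s (flatMat (A m)) with hq
  have hqm : ∀ m k, HasMoments (q m k) (μ m) := fun m k => (hXi m).quadDiff_hasMoments _ k
  have hF : ∀ m, SumBdd (flatMat (A m)) c := fun m => SumBdd.flatMat (hA m)
  have hmart : ∀ m, MartDiff (μ m) _ fun k ω => a m * extendZero (q m) k ω :=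
    fun m => ((hXi m).martDiff_quadDiff (flatMat (A m))).const_mul (a m)
  have hsum : ∀ m ω, ∑ k ∈ Finset.range (T m * n m), a m * extendZero (q m) k ω
      = a m * formSum s (A m) (ε m ω) := by
    intro m ω
    rw [← Finset.mul_sum, sum_extendZero, hq, IndepErrors.sum_quadDiff, formSum_eq_flat]
  have hsum2 : ∀ m ω, ∑ k ∈ Finset.range (T m * n m), (a m * extendZero (q m) k ω) ^ 2
      = a m ^ 2 * ∑ k, q m k ω ^ 2 := by
    intro m ω
    simp only [mul_pow]
    rw [← Finset.mul_sum, sum_extendZero_pow]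
  have ha2 : ∀ m, a m ^ 2 = ((n m : ℝ) * T m)⁻¹ := by
    intro m
    simp only [ha]
    rw [← Real.sqrt_inv, Real.sq_sqrt (by positivity)]
  have hev : ∀ᶠ m in atTop, ((n m : ℝ) * T m) ≠ 0 := by
    filter_upwards [hnT.eventually_gt_atTop 0] with m hm
    have : ((n m * T m : ℕ) : ℝ) ≠ 0 := by exact_mod_cast hm.ne'
    simpa using this
  have hconv := tendsto_integral_exp_of_martDiff hmart (fun m => T m * n m) (v := v) ?_ ?_ ?_
  · simpa only [hsum] using hconv
  · set D := IndepErrors.diffBound c s (eighthBound K) with hD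
    refine squeeze_zero' (Eventually.of_forall fun m => Finset.sum_nonneg fun k _ =>
      integral_nonneg fun ω => by positivity) ?_ (tendsto_inv_natCast_mul hnT D)
    filter_upwards [hev] with m hm
    calc ∑ k ∈ Finset.range (T m * n m), ∫ ω, (a m * extendZero (q m) k ω) ^ 4 ∂μ m
        = ∑ k : Fin (T m * n m), a m ^ 4 * ∫ ω, q m k ω ^ 4 ∂μ m := by
          rw [Finset.sum_range]
          simp only [extendZero, Fin.is_lt, dite_true, Fin.eta, mul_pow, integral_const_mul]
      _ ≤ ∑ _k : Fin (T m * n m), a m ^ 4 * D := by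
          refine Finset.sum_le_sum fun k _ => mul_le_mul_of_nonneg_left ?_ (by positivity)
          exact (hXi m).integral_quadDiff_pow_four_le (hF m) k
      _ = D * ((n m : ℝ) * T m)⁻¹ := by
          rw [Finset.sum_const, Finset.card_univ, Fintype.card_fin, nsmul_eq_mul]
          have : a m ^ 4 = (a m ^ 2) ^ 2 := by ring
          rw [this, ha2]
          push_cast
          field_simp
  · set D := 3 * (IndepErrors.sqDiffBound c s (eighthBound K)
        + s * (2 * (2 * c * (c * (1 + eighthBound K)))) ^ 2
        + s ^ 2 * ((1 + 16 * IndepErrors.diffBound (2 * c * (2 * c)) s (eighthBound K)) / 2))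
      with hD
    refine squeeze_zero' (Eventually.of_forall fun m => integral_nonneg fun ω => sq_nonneg _) ?_
      (tendsto_inv_natCast_mul hnT D)
    filter_upwards [hev] with m hm
    simp only [hsum2, integral_const_mul]
    have e : ∀ ω, (a m ^ 2 * ∑ k, q m k ω ^ 2 - a m ^ 2 * ∫ ω', ∑ k, q m k ω' ^ 2 ∂μ m) ^ 2
        = (((n m : ℝ) * T m)⁻¹) ^ 2
          * (∑ k, q m k ω ^ 2 - ∫ ω', ∑ k, q m k ω' ^ 2 ∂μ m) ^ 2 := by
      intro ω; rw [ha2]; ring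
    simp only [e, integral_const_mul]
    have h1 := (hXi m).integral_sum_quadDiff_sq_sub_sq_le (hF m) hs
    rw [← hD] at h1
    refine (mul_le_mul_of_nonneg_left h1 (by positivity)).trans (le_of_eq ?_)
    push_cast
    field_simp
  · simpa only [hsum] using hv

end CLT

/-! ### Influence matrices and their averages over time -/

section Influence

variable {n d : ℕ} (W : Fin d → Matrix (Fin n) (Fin n) ℝ)

lemma influence_add (x z : Fin d → ℝ) : influence W (x + z) = influence W x + influence W z := by
  simp [influence, add_smul, Finset.sum_add_distrib]

lemma influence_smul (c : ℝ) (x : Fin d → ℝ) : influence W (c • x) = c • influence W x := by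
  simp [influence, Finset.smul_sum, smul_smul]

lemma influence_sub (x z : Fin d → ℝ) : influence W (x - z) = influence W x - influence W z := by
  simp [influence, sub_smul, Finset.sum_sub_distrib]

lemma delta_add (x z : Fin d → ℝ) : delta W (x + z) = delta W x - influence W z := by
  rw [delta, delta, influence_add]; abel

lemma delta_zero : delta W 0 = 1 := by simp [delta, influence]

lemma SumBdd.influence {W : Fin d → Matrix (Fin n) (Fin n) ℝ} {a : ℝ} (h : ∀ k, SumBdd (W k) a)
    (x : Fin d → ℝ) : SumBdd (influence W x) (a * l1Norm x) := by
  have := SumBdd.sum Finset.univ (F := fun k => x k • W k) (f := fun k => |x k| * a)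
    fun k _ => (h k).smul (x k)
  rw [← Finset.sum_mul] at this
  rwa [mul_comm a]

end Influence

lemma l1Norm_nonneg {d : ℕ} (x : Fin d → ℝ) : 0 ≤ l1Norm x :=
  Finset.sum_nonneg fun _ _ => abs_nonneg _

lemma l1Norm_smul {d : ℕ} (c : ℝ) (x : Fin d → ℝ) : l1Norm (c • x) = |c| * l1Norm x := by
  simp [l1Norm, abs_mul, Finset.mul_sum]

lemma l2Norm_nonneg {d : ℕ} (x : Fin d → ℝ) : 0 ≤ l2Norm x := Real.sqrt_nonneg _

lemma l2Norm_sq {d : ℕ} (x : Fin d → ℝ) : l2Norm x ^ 2 = ∑ k, x k ^ 2 :=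
  Real.sq_sqrt (Finset.sum_nonneg fun _ _ => sq_nonneg _)

lemma l1Norm_le_sqrt_mul {d : ℕ} (x : Fin d → ℝ) : l1Norm x ≤ √d * l2Norm x := by
  unfold l1Norm l2Norm
  rw [← Real.sqrt_mul (by positivity)]
  refine Real.le_sqrt_of_sq_le ?_
  have := sq_sum_le_card_mul_sum_sq (s := Finset.univ) (f := fun k => |x k|)
  simpa using this

lemma sum_mul_le_l2Norm {d : ℕ} (x z : Fin d → ℝ) : |∑ k, x k * z k| ≤ l2Norm x * l2Norm z := by
  unfold l2Norm
  rw [← Real.sqrt_mul (Finset.sum_nonneg fun _ _ => sq_nonneg _)]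
  refine Real.le_sqrt_of_sq_le ?_
  rw [sq_abs]
  exact Finset.sum_mul_sq_le_sq_mul_sq _ _ _

/-- The sum over time, divided by the number `nT` of observations. -/
noncomputable def avg (n : ℕ) {T : ℕ} (f : Fin T → ℝ) : ℝ := ((n : ℝ) * T)⁻¹ * ∑ t, f t

section Avg

variable {n T : ℕ}

lemma avg_add (f g : Fin T → ℝ) : avg n (fun t => f t + g t) = avg n f + avg n g := by
  simp [avg, Finset.sum_add_distrib, mul_add]

lemma avg_sub (f g : Fin T → ℝ) : avg n (fun t => f t - g t) = avg n f - avg n g := by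
  simp [avg, Finset.sum_sub_distrib, mul_sub]

lemma avg_const_mul (c : ℝ) (f : Fin T → ℝ) : avg n (fun t => c * f t) = c * avg n f := by
  simp only [avg, ← Finset.mul_sum]; ring

lemma abs_avg_le {f g : Fin T → ℝ} (h : ∀ t, |f t| ≤ g t) : |avg n f| ≤ avg n g := by
  unfold avg
  rw [abs_mul, abs_of_nonneg (by positivity : (0 : ℝ) ≤ ((n : ℝ) * T)⁻¹)]
  exact mul_le_mul_of_nonneg_left
    ((Finset.abs_sum_le_sum_abs _ _).trans (Finset.sum_le_sum fun t _ => h t)) (by positivity)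

lemma abs_avg_trace_le {A : Fin T → Matrix (Fin n) (Fin n) ℝ} {c : ℝ} (hc : 0 ≤ c)
    (hA : ∀ t, SumBdd (A t) c) : |avg n fun t => (A t).trace| ≤ c := by
  refine (abs_avg_le fun t => (hA t).abs_trace_le).trans ?_
  simp only [avg, Finset.sum_const, Finset.card_univ, Fintype.card_fin, nsmul_eq_mul]
  have e : ((n : ℝ) * T)⁻¹ * (T * (n * c)) = (((n : ℝ) * T)⁻¹ * (n * T)) * c := by ring
  rw [e]
  refine mul_le_of_le_one_left hc ?_
  rcases eq_or_ne ((n : ℝ) * T) 0 with h | h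
  · rw [h]; simp
  · rw [inv_mul_cancel₀ h]

end Avg

section Forms

variable {n T d : ℕ} (U : Fin T → Fin d → Matrix (Fin n) (Fin n) ℝ) (y : Fin T → Fin n → ℝ)

/-- The mean square of the errors. -/
noncomputable def meanSq (y : Fin T → Fin n → ℝ) : ℝ := avg n fun t => y t ⬝ᵥ y t

/-- The average of `yᵀ V(x) y`, where `V(x) = ∑ x_k U_k`. -/
noncomputable def linForm (x : Fin d → ℝ) : ℝ := avg n fun t => y t ⬝ᵥ (influence (U t) x *ᵥ y t)

/-- The average of `(V(x) y)ᵀ V(z) y`. -/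
noncomputable def gramForm (x z : Fin d → ℝ) : ℝ :=
  avg n fun t => (influence (U t) x *ᵥ y t) ⬝ᵥ (influence (U t) z *ᵥ y t)

/-- The average of `tr V(x)`. -/
noncomputable def traceForm (x : Fin d → ℝ) : ℝ := avg n fun t => (influence (U t) x).trace

/-- The average of `tr (V(x) V(z))`. -/
noncomputable def traceProd (x z : Fin d → ℝ) : ℝ :=
  avg n fun t => (influence (U t) x * influence (U t) z).trace

/-- The average of `tr (V(x)ᵀ V(z))`. -/
noncomputable def traceGram (x z : Fin d → ℝ) : ℝ :=
  avg n fun t => ((influence (U t) x)ᵀ * influence (U t) z).trace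

/-- The average of `tr (Δ(δ)⁻¹ V(x))`, the negative derivative of the average log-determinant. -/
noncomputable def resolventForm (δ x : Fin d → ℝ) : ℝ :=
  avg n fun t => ((delta (U t) δ)⁻¹ * influence (U t) x).trace

/-- The derivative of `-(nT)⁻¹ ℓ_c` at `δ` in the direction `x`. -/
noncomputable def concGrad (δ x : Fin d → ℝ) : ℝ :=
  (-linForm U y x + gramForm U y δ x) / sigmaHat U y δ + resolventForm U δ x

lemma gramForm_comm (x z : Fin d → ℝ) : gramForm U y x z = gramForm U y z x := by
  simp only [gramForm, dotProduct_comm]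

lemma linForm_sub (x z : Fin d → ℝ) : linForm U y (x - z) = linForm U y x - linForm U y z := by
  simp only [linForm, ← avg_sub, influence_sub, Matrix.sub_mulVec, dotProduct_sub]

lemma gramForm_sub_left (x x' z : Fin d → ℝ) :
    gramForm U y (x - x') z = gramForm U y x z - gramForm U y x' z := by
  simp only [gramForm, ← avg_sub, influence_sub, Matrix.sub_mulVec, sub_dotProduct]

lemma gramForm_sub_right (x z z' : Fin d → ℝ) :
    gramForm U y x (z - z') = gramForm U y x z - gramForm U y x z' := by
  rw [gramForm_comm, gramForm_sub_left, gramForm_comm, gramForm_comm U y z']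

lemma resolventForm_sub_right (δ x z : Fin d → ℝ) :
    resolventForm U δ (x - z) = resolventForm U δ x - resolventForm U δ z := by
  simp only [resolventForm, ← avg_sub, influence_sub, mul_sub, Matrix.trace_sub]

lemma concGrad_sub_right (δ x z : Fin d → ℝ) :
    concGrad U y δ (x - z) = concGrad U y δ x - concGrad U y δ z := by
  simp only [concGrad, linForm_sub, gramForm_sub_right, resolventForm_sub_right]
  ring

lemma dotProduct_delta_mulVec (W : Fin d → Matrix (Fin n) (Fin n) ℝ) (v : Fin n → ℝ)
    (x : Fin d → ℝ) : v ⬝ᵥ (((delta W x)ᵀ * delta W x) *ᵥ v)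
      = (delta W x *ᵥ v) ⬝ᵥ (delta W x *ᵥ v) := by
  rw [← Matrix.mulVec_mulVec, Matrix.dotProduct_mulVec, Matrix.vecMul_transpose]

lemma rss_eq (W : Fin T → Fin d → Matrix (Fin n) (Fin n) ℝ) (Y : Fin T → Fin n → ℝ)
    (x : Fin d → ℝ) : rss W Y x = ∑ t, (delta (W t) x *ᵥ Y t) ⬝ᵥ (delta (W t) x *ᵥ Y t) := by
  simp only [rss, dotProduct_delta_mulVec]

lemma sigmaHat_eq (x : Fin d → ℝ) :
    sigmaHat U y x = meanSq y - 2 * linForm U y x + gramForm U y x x := by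
  have e : sigmaHat U y x = avg n fun t =>
      (delta (U t) x *ᵥ y t) ⬝ᵥ (delta (U t) x *ᵥ y t) := by
    rw [sigmaHat, rss_eq, avg]
  rw [e, meanSq, linForm, gramForm, ← avg_const_mul, ← avg_sub, ← avg_add]
  congr 1; ext t
  simp only [delta, Matrix.sub_mulVec, Matrix.one_mulVec, sub_dotProduct, dotProduct_sub]
  rw [dotProduct_comm (influence (U t) x *ᵥ y t) (y t)]
  ring

variable {U y} {a r₀ : ℝ}

lemma abs_linForm_le (hU : ∀ t k, SumBdd (U t k) a) (x : Fin d → ℝ) :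
    |linForm U y x| ≤ a * l1Norm x * meanSq y := by
  rw [meanSq, ← avg_const_mul]
  exact abs_avg_le fun t => (SumBdd.influence (hU t) x).abs_dotProduct_mulVec_le (y t)

lemma abs_gramForm_le (hU : ∀ t k, SumBdd (U t k) a) (x z : Fin d → ℝ) :
    |gramForm U y x z| ≤ a ^ 2 * l1Norm x * l1Norm z * meanSq y := by
  rw [meanSq, ← avg_const_mul]
  refine abs_avg_le fun t => ?_
  have h1 := ((SumBdd.influence (hU t) x).transpose.mul
    (SumBdd.influence (hU t) z)).abs_dotProduct_mulVec_le (y t)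
  rw [← Matrix.mulVec_mulVec, Matrix.dotProduct_mulVec, Matrix.vecMul_transpose] at h1
  refine h1.trans (le_of_eq ?_)
  ring

lemma abs_traceForm_le (ha : 0 ≤ a) (hU : ∀ t k, SumBdd (U t k) a) (x : Fin d → ℝ) :
    |traceForm U x| ≤ a * l1Norm x :=
  abs_avg_trace_le (mul_nonneg ha (l1Norm_nonneg x)) fun t => SumBdd.influence (hU t) x

lemma abs_traceProd_le (hU : ∀ t k, SumBdd (U t k) a) (x z : Fin d → ℝ) (ha : 0 ≤ a) :
    |traceProd U x z| ≤ a ^ 2 * l1Norm x * l1Norm z := by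
  have h0 := l1Norm_nonneg x
  have h1 := l1Norm_nonneg z
  refine (abs_avg_trace_le (by positivity) fun t =>
    (SumBdd.influence (hU t) x).mul (SumBdd.influence (hU t) z)).trans (le_of_eq (by ring))

lemma abs_traceGram_le (hU : ∀ t k, SumBdd (U t k) a) (x z : Fin d → ℝ) (ha : 0 ≤ a) :
    |traceGram U x z| ≤ a ^ 2 * l1Norm x * l1Norm z := by
  have h0 := l1Norm_nonneg x
  have h1 := l1Norm_nonneg z
  refine (abs_avg_trace_le (by positivity) fun t =>
    (SumBdd.influence (hU t) x).transpose.mul (SumBdd.influence (hU t) z)).trans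
      (le_of_eq (by ring))

/-- The matrices `Δ(δ)` are invertible with inverses of bounded row and column sums in the
`ℓ₁`-ball of radius `r₀`. -/
def ResolventBdd (U : Fin T → Fin d → Matrix (Fin n) (Fin n) ℝ) (r₀ a : ℝ) : Prop :=
  ∀ δ, l1Norm δ < r₀ → ∀ t, IsUnit (delta (U t) δ).det ∧ SumBdd (delta (U t) δ)⁻¹ a

lemma inv_delta_sub_one {W : Fin d → Matrix (Fin n) (Fin n) ℝ} {δ : Fin d → ℝ}
    (h : IsUnit (delta W δ).det) : (delta W δ)⁻¹ - 1 = (delta W δ)⁻¹ * influence W δ := by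
  have h1 := Matrix.nonsing_inv_mul _ h
  have h2 : influence W δ = 1 - delta W δ := by simp [delta]
  rw [h2, mul_sub, h1, mul_one]

lemma inv_delta_sub_inv_delta {W : Fin d → Matrix (Fin n) (Fin n) ℝ} {δ δ' : Fin d → ℝ}
    (h : IsUnit (delta W δ).det) (h' : IsUnit (delta W δ').det) :
    (delta W δ)⁻¹ - (delta W δ')⁻¹
      = (delta W δ)⁻¹ * influence W (δ - δ') * (delta W δ')⁻¹ := by
  have h2 : influence W (δ - δ') = delta W δ' - delta W δ := by
    rw [influence_sub]; simp only [delta]; abel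
  rw [h2, mul_sub, sub_mul, Matrix.nonsing_inv_mul _ h, one_mul, mul_assoc,
    Matrix.mul_nonsing_inv _ h', mul_one]

/-- The resolvent form is increasing up to third order terms: its increment from `δ'` to `δ` in the
direction `δ - δ'` is nearly `traceProd`. -/
lemma abs_resolventForm_sub_le (ha : 0 ≤ a) (hU : ∀ t k, SumBdd (U t k) a)
    (hR : ResolventBdd U r₀ a) {δ δ' : Fin d → ℝ} {ρ : ℝ} (hρ : ρ < r₀) (hδ : l1Norm δ ≤ ρ)
    (hδ' : l1Norm δ' ≤ ρ) :
    |resolventForm U δ (δ - δ') - resolventForm U δ' (δ - δ') - traceProd U (δ - δ') (δ - δ')|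
      ≤ (a ^ 5 + a ^ 4) * ρ * l1Norm (δ - δ') ^ 2 := by
  set x := δ - δ' with hx
  have hx0 := l1Norm_nonneg x
  have hρ0 : 0 ≤ ρ := (l1Norm_nonneg δ).trans hδ
  have e : resolventForm U δ x - resolventForm U δ' x - traceProd U x x = avg n fun t =>
      ((delta (U t) δ)⁻¹ * influence (U t) δ * influence (U t) x * (delta (U t) δ')⁻¹
        * influence (U t) x + influence (U t) x * ((delta (U t) δ')⁻¹ * influence (U t) δ')
        * influence (U t) x).trace := by
    rw [resolventForm, resolventForm, traceProd, ← avg_sub, ← avg_sub]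
    congr 1; ext t
    rw [← Matrix.trace_sub, ← Matrix.trace_sub, ← sub_mul,
      inv_delta_sub_inv_delta (hR δ (hδ.trans_lt hρ) t).1 (hR δ' (hδ'.trans_lt hρ) t).1, ← hx,
      ← inv_delta_sub_one (hR δ (hδ.trans_lt hρ) t).1,
      ← inv_delta_sub_one (hR δ' (hδ'.trans_lt hρ) t).1]
    congr 1
    noncomm_ring
  rw [e]
  refine abs_avg_trace_le (by positivity) fun t => ?_
  have hV := SumBdd.influence (hU t) x
  have hVδ := (SumBdd.influence (hU t) δ).mono (mul_le_mul_of_nonneg_left hδ ha)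
  have hVδ' := (SumBdd.influence (hU t) δ').mono (mul_le_mul_of_nonneg_left hδ' ha)
  have hRt := (hR δ (hδ.trans_lt hρ) t).2
  have hRt' := (hR δ' (hδ'.trans_lt hρ) t).2
  have := ((((hRt.mul hVδ).mul hV).mul hRt').mul hV).add ((hV.mul (hRt'.mul hVδ')).mul hV)
  refine this.mono (le_of_eq ?_)
  ring

/-- First order expansion of the resolvent form at `0`. -/
lemma abs_resolventForm_sub_traceForm_le (hU : ∀ t k, SumBdd (U t k) a)
    (hR : ResolventBdd U r₀ a) {δ : Fin d → ℝ} (hδ : l1Norm δ < r₀) (x : Fin d → ℝ) :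
    |resolventForm U δ x - traceForm U x - traceProd U δ x|
      ≤ a ^ 4 * l1Norm δ ^ 2 * l1Norm x := by
  have hx0 := l1Norm_nonneg x
  have hδ0 := l1Norm_nonneg δ
  have e : resolventForm U δ x - traceForm U x - traceProd U δ x = avg n fun t =>
      ((delta (U t) δ)⁻¹ * influence (U t) δ * influence (U t) δ * influence (U t) x).trace := by
    rw [resolventForm, traceForm, traceProd, ← avg_sub, ← avg_sub]
    congr 1; ext t
    rw [← Matrix.trace_sub, ← Matrix.trace_sub, ← inv_delta_sub_one (hR δ hδ t).1, sub_mul,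
      ← inv_delta_sub_one (hR δ hδ t).1]
    congr 1
    noncomm_ring
  rw [e]
  refine abs_avg_trace_le (by positivity) fun t => ?_
  have hV := SumBdd.influence (hU t) x
  have hVδ := SumBdd.influence (hU t) δ
  have := (((hR δ hδ t).2.mul hVδ).mul hVδ).mul hV
  refine this.mono (le_of_eq ?_)
  ring

end Forms

/-! ### Strong monotonicity of the concentrated score -/

lemma abs_mul_sub_mul_le {x y x' y' ex ey bx by' : ℝ} (h1 : |x - x'| ≤ ex) (h2 : |y - y'| ≤ ey)
    (h3 : |y| ≤ by') (h4 : |x'| ≤ bx) : |x * y - x' * y'| ≤ ex * by' + bx * ey := by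
  have e : x * y - x' * y' = (x - x') * y + x' * (y - y') := by ring
  rw [e]
  refine (abs_add_le _ _).trans ?_
  rw [abs_mul, abs_mul]
  have := abs_nonneg (x - x')
  have := abs_nonneg (y - y')
  have := abs_nonneg y
  have := abs_nonneg x'
  exact add_le_add (mul_le_mul h1 h3 ‹_› (by linarith)) (mul_le_mul h4 h2 ‹_› (by linarith))

/-- The increment of the ratio of the derivative of `q` to `q`, where `q` is a quadratic polynomial
close to `1`. The comparison rests on
`β / q - β' / q' = p (1 / q + 1 / q') / 2 - (β + β')² / (2 q q')`. -/
lemma ratio_sub_ratio_ge {a ρ X p b β β' q q' : ℝ} (ha : 1 ≤ a) (hρ0 : 0 ≤ ρ)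
    (hρ : a ^ 2 * ρ ≤ 1 / 6) (hX : 0 ≤ X) (hp : |p| ≤ a ^ 2 * X ^ 2) (hb : |b| ≤ a * X)
    (hpd : β - β' = p) (hqd : q - q' = β + β') (hβ : |β + b| ≤ a ^ 2 * ρ * X)
    (hβ' : |β' + b| ≤ a ^ 2 * ρ * X) (hq : |q - 1| ≤ 3 * (a ^ 2 * ρ))
    (hq' : |q' - 1| ≤ 3 * (a ^ 2 * ρ)) :
    p - 2 * b ^ 2 - 66 * a ^ 4 * ρ * X ^ 2 ≤ β / q - β' / q' := by
  set e := a ^ 2 * ρ with he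
  have he0 : 0 ≤ e := by positivity
  have hinv : ∀ q : ℝ, |q - 1| ≤ 3 * e → 1 / 2 ≤ q ∧ |1 / q - 1| ≤ 6 * e ∧ |1 / q| ≤ 2 := by
    intro q hq
    have h1 : 1 / 2 ≤ q := by have := (abs_le.1 hq).1; linarith
    have hq0 : 0 < q := by linarith
    have h2 : |1 / q| ≤ 2 := by
      rw [abs_of_pos (by positivity), div_le_iff₀ hq0]; linarith
    refine ⟨h1, ?_, h2⟩
    have e1 : 1 / q - 1 = -(q - 1) * (1 / q) := by field_simp; ring
    rw [e1, abs_mul, abs_neg]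
    have := abs_nonneg (q - 1)
    have := abs_nonneg (1 / q)
    nlinarith
  obtain ⟨hq1, hq2, hq3⟩ := hinv q hq
  obtain ⟨hq1', hq2', hq3'⟩ := hinv q' hq'
  have hid : β / q - β' / q' = p * ((1 / q + 1 / q') / 2)
      - 2 * (((β + β') / 2) ^ 2 * (1 / q * (1 / q'))) := by
    have h1 : q ≠ 0 := by linarith
    have h2 : q' ≠ 0 := by linarith
    have h3 : ((β + β') / 2) ^ 2 = (β + β') * (q - q') / 4 := by rw [hqd]; ring
    rw [h3, ← hpd]
    field_simp
    ring
  set mid := (β + β') / 2 with hmid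
  have hm1 : |mid + b| ≤ e * X := by
    have e1 : mid + b = ((β + b) + (β' + b)) / 2 := by rw [hmid]; ring
    rw [e1, abs_div, abs_two]
    have := abs_add_le (β + b) (β' + b)
    linarith
  have hm2 : |mid| ≤ 2 * a * X := by
    have e1 : mid = (mid + b) - b := by ring
    rw [e1]
    have h1 := abs_sub (mid + b) b
    have h2 : e * X ≤ a * X := mul_le_mul_of_nonneg_right (by linarith) hX
    linarith
  have hsq : |mid ^ 2 - b ^ 2| ≤ 3 * a * X * (e * X) := by
    have e1 : mid ^ 2 - b ^ 2 = (mid - b) * (mid + b) := by ring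
    rw [e1, abs_mul]
    have h1 := abs_sub mid b
    have : |mid - b| ≤ 3 * a * X := by linarith
    exact mul_le_mul this hm1 (abs_nonneg _) (by positivity)
  have hprod : |1 / q * (1 / q') - 1 * 1| ≤ 6 * e * 2 + 1 * (6 * e) :=
    abs_mul_sub_mul_le hq2 hq2' hq3' (by simp)
  have hprod4 : |1 / q * (1 / q')| ≤ 4 := by
    rw [abs_mul]
    have := abs_nonneg (1 / q)
    have := abs_nonneg (1 / q')
    nlinarith
  have hb2 : |b ^ 2| ≤ a ^ 2 * X ^ 2 := by
    rw [abs_pow, ← mul_pow]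
    exact pow_le_pow_left₀ (abs_nonneg _) hb 2
  have t2 : |mid ^ 2 * (1 / q * (1 / q')) - b ^ 2 * (1 * 1)|
      ≤ 3 * a * X * (e * X) * 4 + a ^ 2 * X ^ 2 * (6 * e * 2 + 1 * (6 * e)) :=
    abs_mul_sub_mul_le hsq hprod hprod4 hb2
  have t1 : |p * ((1 / q + 1 / q') / 2) - p * 1| ≤ a ^ 2 * X ^ 2 * (6 * e) := by
    have h1 : |(1 / q + 1 / q') / 2 - 1| ≤ 6 * e := by
      have e1 : (1 / q + 1 / q') / 2 - 1 = ((1 / q - 1) + (1 / q' - 1)) / 2 := by ring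
      rw [e1, abs_div, abs_two]
      have := abs_add_le (1 / q - 1) (1 / q' - 1)
      linarith
    rw [← mul_sub, abs_mul]
    exact mul_le_mul hp h1 (abs_nonneg _) (by positivity)
  have g1 := (abs_le.1 t1).1
  have g2 := (abs_le.1 t2).2
  rw [hid]
  have haX : a * (e * X ^ 2) ≤ a ^ 2 * (e * X ^ 2) := by
    refine mul_le_mul_of_nonneg_right ?_ (by positivity)
    nlinarith
  have e66 : 66 * a ^ 4 * ρ * X ^ 2 = 66 * (a ^ 2 * (e * X ^ 2)) := by rw [he]; ring
  rw [e66]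
  linarith

section Deterministic

variable {n T d : ℕ} {U : Fin T → Fin d → Matrix (Fin n) (Fin n) ℝ} {y : Fin T → Fin n → ℝ}
  {a r₀ s c r κ : ℝ}

lemma sigmaHat_sub_sigmaHat (δ δ' : Fin d → ℝ) :
    sigmaHat U y δ - sigmaHat U y δ' = (-linForm U y (δ - δ') + gramForm U y δ (δ - δ'))
      + (-linForm U y (δ - δ') + gramForm U y δ' (δ - δ')) := by
  simp only [sigmaHat_eq, linForm_sub, gramForm_sub_right]
  rw [gramForm_comm U y δ' δ]
  ring

lemma abs_sigmaHat_div_sub_one_le (ha : 1 ≤ a) (hU : ∀ t k, SumBdd (U t k) a)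
    (hq0 : 0 < meanSq y) {ρ : ℝ} (hρ : a ^ 2 * ρ ≤ 1 / 6) {δ : Fin d → ℝ} (hδ : l1Norm δ ≤ ρ) :
    |sigmaHat U y δ / meanSq y - 1| ≤ 3 * (a ^ 2 * ρ) := by
  have h0 := l1Norm_nonneg δ
  have hρ0 : 0 ≤ ρ := h0.trans hδ
  have ha2 : a ≤ a ^ 2 := by nlinarith
  have ha1 : 1 ≤ a ^ 2 := by nlinarith
  have hρ1 : ρ ≤ 1 := by nlinarith
  have e : sigmaHat U y δ / meanSq y - 1
      = (-(2 * linForm U y δ) + gramForm U y δ δ) / meanSq y := by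
    rw [sigmaHat_eq]; field_simp; ring
  rw [e, abs_div, abs_of_pos hq0, div_le_iff₀ hq0]
  have h1 := abs_linForm_le (y := y) hU δ
  have h2 := abs_gramForm_le (y := y) hU δ δ
  refine (abs_add_le _ _).trans ?_
  rw [abs_neg, abs_mul, abs_two]
  have h3 : a * l1Norm δ ≤ a ^ 2 * ρ := mul_le_mul ha2 hδ h0 (by positivity)
  have h4 : a ^ 2 * l1Norm δ * l1Norm δ ≤ a ^ 2 * ρ := by
    have : l1Norm δ * l1Norm δ ≤ ρ := by nlinarith
    calc a ^ 2 * l1Norm δ * l1Norm δ = a ^ 2 * (l1Norm δ * l1Norm δ) := by ring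
      _ ≤ _ := mul_le_mul_of_nonneg_left this (by positivity)
  have h5 := mul_le_mul_of_nonneg_right h3 hq0.le
  have h6 := mul_le_mul_of_nonneg_right h4 hq0.le
  linarith

/-- Near the true parameter, the increments of the concentrated score are bounded below by its
linearization at the true parameter, up to a term of third order. -/
lemma concGrad_sub_ge (ha : 1 ≤ a) (hU : ∀ t k, SumBdd (U t k) a) (hR : ResolventBdd U r₀ a)
    (hq0 : 0 < meanSq y) {ρ : ℝ} (hρ : a ^ 2 * ρ ≤ 1 / 6) (hρr : ρ < r₀) {δ δ' : Fin d → ℝ}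
    (hδ : l1Norm δ ≤ ρ) (hδ' : l1Norm δ' ≤ ρ) :
    gramForm U y (δ - δ') (δ - δ') / meanSq y - 2 * (linForm U y (δ - δ') / meanSq y) ^ 2
        + traceProd U (δ - δ') (δ - δ') - 68 * a ^ 5 * ρ * l1Norm (δ - δ') ^ 2
      ≤ concGrad U y δ (δ - δ') - concGrad U y δ' (δ - δ') := by
  have hρ0 : 0 ≤ ρ := (l1Norm_nonneg δ).trans hδ
  have hres := (abs_le.1 (abs_resolventForm_sub_le (by linarith) hU hR hρr hδ hδ')).1
  set x := δ - δ' with hx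
  have hX := l1Norm_nonneg x
  have hg : ∀ z w, |gramForm U y z w / meanSq y| ≤ a ^ 2 * l1Norm z * l1Norm w := by
    intro z w
    rw [abs_div, abs_of_pos hq0, div_le_iff₀ hq0]
    exact abs_gramForm_le hU z w
  have hgρ : ∀ z, l1Norm z ≤ ρ → |gramForm U y z x / meanSq y| ≤ a ^ 2 * ρ * l1Norm x := by
    intro z hz
    exact (hg z x).trans (by gcongr)
  have hl : |linForm U y x / meanSq y| ≤ a * l1Norm x := by
    rw [abs_div, abs_of_pos hq0, div_le_iff₀ hq0]
    exact abs_linForm_le hU x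
  have hmain := ratio_sub_ratio_ge (a := a) (ρ := ρ) (X := l1Norm x)
    (p := gramForm U y x x / meanSq y) (b := linForm U y x / meanSq y)
    (β := (-linForm U y x + gramForm U y δ x) / meanSq y)
    (β' := (-linForm U y x + gramForm U y δ' x) / meanSq y)
    (q := sigmaHat U y δ / meanSq y) (q' := sigmaHat U y δ' / meanSq y) ha hρ0 hρ hX
    ((hg x x).trans (le_of_eq (by ring))) hl
    (by rw [← sub_div]; congr 1; nth_rw 3 [hx]; rw [gramForm_sub_left]; ring)
    (by rw [← sub_div, ← add_div, sigmaHat_sub_sigmaHat])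
    (by rw [← add_div]; convert hgρ δ hδ using 3; ring)
    (by rw [← add_div]; convert hgρ δ' hδ' using 3; ring)
    (abs_sigmaHat_div_sub_one_le ha hU hq0 hρ hδ)
    (abs_sigmaHat_div_sub_one_le ha hU hq0 hρ hδ')
  rw [div_div_div_cancel_right₀ hq0.ne', div_div_div_cancel_right₀ hq0.ne'] at hmain
  have hpow : 66 * a ^ 4 * ρ * l1Norm x ^ 2 + (a ^ 5 + a ^ 4) * ρ * l1Norm x ^ 2
      ≤ 68 * a ^ 5 * ρ * l1Norm x ^ 2 := by
    have h45 : a ^ 4 ≤ a ^ 5 := pow_le_pow_right₀ ha (by norm_num)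
    have h0 : 0 ≤ ρ * l1Norm x ^ 2 := by positivity
    nlinarith
  simp only [concGrad]
  linarith

/-- The sample moments of the errors are close to their expectations. The powers of `d` are those
for which `κ` may be chosen of the order `d ^ 2 / √(nT)`. -/
structure GoodSample (U : Fin T → Fin d → Matrix (Fin n) (Fin n) ℝ) (y : Fin T → Fin n → ℝ)
    (s κ : ℝ) : Prop where
  meanSq : (d : ℝ) ^ 2 * |meanSq y - s| ≤ κ
  lin : ∀ x, (d : ℝ) * √d * |linForm U y x - s * traceForm U x| ≤ κ * l2Norm x
  gram : ∀ x z, (d : ℝ) * |gramForm U y x z - s * traceGram U x z| ≤ κ * l2Norm x * l2Norm z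

/-- A lower bound for the Schur complement of the last entry of the information matrix. -/
def SchurBound (U : Fin T → Fin d → Matrix (Fin n) (Fin n) ℝ) (c : ℝ) : Prop :=
  ∀ x, c * l2Norm x ^ 2 ≤ traceGram U x x + traceProd U x x - 2 * traceForm U x ^ 2

lemma GoodSample.half_le (h : GoodSample U y s κ) (hd : 1 ≤ d) (hκ : κ ≤ s / 2) :
    s / 2 ≤ MIR.meanSq y ∧ MIR.meanSq y ≤ 2 * s ∧ |MIR.meanSq y - s| ≤ κ := by
  have hd1 : (1 : ℝ) ≤ (d : ℝ) ^ 2 := one_le_pow₀ (by exact_mod_cast hd)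
  have h1 : |MIR.meanSq y - s| ≤ κ := by
    have := h.meanSq
    nlinarith [abs_nonneg (MIR.meanSq y - s)]
  have h2 := abs_le.1 h1
  refine ⟨by linarith, by linarith [abs_nonneg (MIR.meanSq y - s)], h1⟩

/-- The Hessian of the concentrated criterion at the true parameter is bounded below. -/
lemma GoodSample.hessian_ge (h : GoodSample U y s κ) (hd : 1 ≤ d) (ha : 1 ≤ a)
    (hU : ∀ t k, SumBdd (U t k) a) (hs : 0 < s) (hκ : κ ≤ s / 2) (hS : SchurBound U c)
    (x : Fin d → ℝ) :
    (c - 20 * a ^ 2 * κ / s) * l2Norm x ^ 2 ≤ gramForm U y x x / MIR.meanSq y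
      - 2 * (linForm U y x / MIR.meanSq y) ^ 2 + traceProd U x x := by
  obtain ⟨hm1, hm2, hm3⟩ := h.half_le hd hκ
  have hκ0 : 0 ≤ κ := (abs_nonneg _).trans hm3
  set q := MIR.meanSq y with hq
  have hq0 : 0 < q := by linarith
  set X := l2Norm x with hX
  have hX0 : 0 ≤ X := l2Norm_nonneg x
  have hd1 : (1 : ℝ) ≤ d := by exact_mod_cast hd
  have hsd1 : 1 ≤ √(d : ℝ) := Real.one_le_sqrt.2 hd1
  have hsd : √(d : ℝ) * √d = d := Real.mul_self_sqrt (by linarith)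
  have hl1 := l1Norm_le_sqrt_mul x
  have hl0 := l1Norm_nonneg x
  have hl1sq : l1Norm x * l1Norm x ≤ d * X ^ 2 := by
    calc l1Norm x * l1Norm x ≤ (√d * X) * (√d * X) := mul_le_mul hl1 hl1 hl0 (by positivity)
      _ = (√d * √d) * X ^ 2 := by ring
      _ = d * X ^ 2 := by rw [hsd]
  have hda : (d : ℝ) * |q - s| ≤ κ := by
    have := h.meanSq
    have h0 := abs_nonneg (q - s)
    have : (d : ℝ) * |q - s| ≤ (d : ℝ) ^ 2 * |q - s| :=
      mul_le_mul_of_nonneg_right (by nlinarith) h0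
    linarith
  -- the Gram part
  have hA : |gramForm U y x x / q - traceGram U x x| ≤ (κ + a ^ 2 * κ) * X ^ 2 / q := by
    have e : gramForm U y x x / q - traceGram U x x
        = ((gramForm U y x x - s * traceGram U x x) - traceGram U x x * (q - s)) / q := by
      field_simp; ring
    rw [e, abs_div, abs_of_pos hq0]
    refine div_le_div_of_nonneg_right ?_ hq0.le
    refine (abs_sub _ _).trans ?_
    rw [abs_mul]
    have h1 : |gramForm U y x x - s * traceGram U x x| ≤ κ * X ^ 2 := by
      have h1 := h.gram x x
      have h2 := abs_nonneg (gramForm U y x x - s * traceGram U x x)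
      nlinarith
    have h2 : |traceGram U x x| * |q - s| ≤ a ^ 2 * κ * X ^ 2 := by
      have h3 := abs_traceGram_le hU x x (by linarith)
      calc |traceGram U x x| * |q - s| ≤ (a ^ 2 * (d * X ^ 2)) * |q - s| := by
            refine mul_le_mul_of_nonneg_right (h3.trans ?_) (abs_nonneg _)
            rw [mul_assoc]
            exact mul_le_mul_of_nonneg_left hl1sq (by positivity)
        _ = a ^ 2 * X ^ 2 * (d * |q - s|) := by ring
        _ ≤ a ^ 2 * X ^ 2 * κ := mul_le_mul_of_nonneg_left hda (by positivity)
        _ = _ := by ring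
    linarith
  -- the linear part
  have hB : |linForm U y x / q - traceForm U x| * (√d * X) ≤ (κ + a * κ) * X ^ 2 / q := by
    have e : linForm U y x / q - traceForm U x
        = ((linForm U y x - s * traceForm U x) - traceForm U x * (q - s)) / q := by
      field_simp; ring
    rw [e, abs_div, abs_of_pos hq0, div_mul_eq_mul_div]
    refine div_le_div_of_nonneg_right ?_ hq0.le
    have h0 := abs_sub (linForm U y x - s * traceForm U x) (traceForm U x * (q - s))
    rw [abs_mul] at h0
    have h1 : |linForm U y x - s * traceForm U x| * √d ≤ κ * X := by
      have h1 := h.lin x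
      have h2 := abs_nonneg (linForm U y x - s * traceForm U x)
      have h3 : 0 ≤ √(d : ℝ) * |linForm U y x - s * traceForm U x| := by positivity
      nlinarith
    have h2 : |traceForm U x| * |q - s| * √d ≤ a * κ * X := by
      have h3 := abs_traceForm_le (by linarith) hU x
      calc |traceForm U x| * |q - s| * √d ≤ (a * (√d * X)) * |q - s| * √d := by
            gcongr
            exact h3.trans (mul_le_mul_of_nonneg_left hl1 (by linarith))
        _ = a * X * ((√d * √d) * |q - s|) := by ring
        _ ≤ a * X * κ := by
            rw [hsd]; exact mul_le_mul_of_nonneg_left hda (by positivity)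
        _ = _ := by ring
    calc _ ≤ (|linForm U y x - s * traceForm U x| + |traceForm U x| * |q - s|) * (√d * X) := by
          gcongr
      _ = (|linForm U y x - s * traceForm U x| * √d + |traceForm U x| * |q - s| * √d) * X := by
          ring
      _ ≤ (κ * X + a * κ * X) * X := by gcongr
      _ = _ := by ring
  have hsum : |linForm U y x / q + traceForm U x| ≤ 2 * a * (√d * X) := by
    have h1 : |linForm U y x / q| ≤ a * l1Norm x := by
      rw [abs_div, abs_of_pos hq0, div_le_iff₀ hq0]; exact abs_linForm_le hU x
    have h2 := abs_traceForm_le (by linarith) hU x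
    have h3 := abs_add_le (linForm U y x / q) (traceForm U x)
    have h4 : a * l1Norm x ≤ a * (√d * X) := mul_le_mul_of_nonneg_left hl1 (by linarith)
    linarith
  have hC : |(linForm U y x / q) ^ 2 - traceForm U x ^ 2| ≤ 2 * a * ((κ + a * κ) * X ^ 2 / q) := by
    have e : (linForm U y x / q) ^ 2 - traceForm U x ^ 2
        = (linForm U y x / q - traceForm U x) * (linForm U y x / q + traceForm U x) := by ring
    rw [e, abs_mul]
    calc _ ≤ |linForm U y x / q - traceForm U x| * (2 * a * (√d * X)) :=
          mul_le_mul_of_nonneg_left hsum (abs_nonneg _)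
      _ = 2 * a * (|linForm U y x / q - traceForm U x| * (√d * X)) := by ring
      _ ≤ _ := mul_le_mul_of_nonneg_left hB (by linarith)
  have hfin : (κ + a ^ 2 * κ) * X ^ 2 / q + 2 * (2 * a * ((κ + a * κ) * X ^ 2 / q))
      ≤ 20 * a ^ 2 * κ / s * X ^ 2 := by
    have e : (κ + a ^ 2 * κ) * X ^ 2 / q + 2 * (2 * a * ((κ + a * κ) * X ^ 2 / q))
        = (1 + 5 * a ^ 2 + 4 * a) * (κ * X ^ 2) / q := by ring
    rw [e, div_mul_eq_mul_div, div_le_div_iff₀ hq0 hs]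
    have h1 : (1 + 5 * a ^ 2 + 4 * a) ≤ 10 * a ^ 2 := by nlinarith
    have h2 : 0 ≤ κ * X ^ 2 := by positivity
    calc (1 + 5 * a ^ 2 + 4 * a) * (κ * X ^ 2) * s ≤ 10 * a ^ 2 * (κ * X ^ 2) * (2 * q) := by
          gcongr; linarith
      _ = _ := by ring
  have g1 := (abs_le.1 hA).1
  have g2 := (abs_le.1 hC).2
  have g3 := hS x
  rw [sub_mul]
  linarith

/-- Strong monotonicity of the concentrated score in the `ℓ₁`-ball of radius `r / d`. -/
lemma GoodSample.concGrad_strongMono (h : GoodSample U y s κ) (hd : 1 ≤ d) (ha : 1 ≤ a)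
    (hU : ∀ t k, SumBdd (U t k) a) (hR : ResolventBdd U r₀ a) (hs : 0 < s) (hS : SchurBound U c)
    (hr0 : 0 ≤ r) (hr1 : a ^ 2 * r ≤ 1 / 6) (hr : r < r₀) (hrc : 68 * a ^ 5 * r ≤ c / 4)
    (hκ : κ ≤ s / 2) (hκc : 20 * a ^ 2 * κ / s ≤ c / 4)
    {δ δ' : Fin d → ℝ} (hδ : l1Norm δ ≤ r / d) (hδ' : l1Norm δ' ≤ r / d) :
    c / 2 * l2Norm (δ - δ') ^ 2 ≤ concGrad U y δ (δ - δ') - concGrad U y δ' (δ - δ') := by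
  have hd1 : (1 : ℝ) ≤ d := by exact_mod_cast hd
  have hrd : r / d ≤ r := div_le_self hr0 hd1
  obtain ⟨hm1, -, -⟩ := h.half_le hd hκ
  have h1 := concGrad_sub_ge ha hU hR (by linarith : 0 < MIR.meanSq y) (ρ := r / d)
    ((mul_le_mul_of_nonneg_left hrd (by positivity)).trans hr1) (hrd.trans_lt hr) hδ hδ'
  have h2 := h.hessian_ge hd ha hU hs hκ hS (δ - δ')
  set x := δ - δ' with hx
  have h3 : 68 * a ^ 5 * (r / d) * l1Norm x ^ 2 ≤ c / 4 * l2Norm x ^ 2 := by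
    have h4 : l1Norm x ^ 2 ≤ d * l2Norm x ^ 2 := by
      have := pow_le_pow_left₀ (l1Norm_nonneg x) (l1Norm_le_sqrt_mul x) 2
      rwa [mul_pow, Real.sq_sqrt (by linarith)] at this
    calc 68 * a ^ 5 * (r / d) * l1Norm x ^ 2
        ≤ 68 * a ^ 5 * (r / d) * (d * l2Norm x ^ 2) := by gcongr
      _ = 68 * a ^ 5 * r * l2Norm x ^ 2 := by field_simp
      _ ≤ _ := mul_le_mul_of_nonneg_right hrc (sq_nonneg _)
  have h5 : (c - 20 * a ^ 2 * κ / s) * l2Norm x ^ 2 ≥ (c - c / 4) * l2Norm x ^ 2 :=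
    mul_le_mul_of_nonneg_right (by linarith) (sq_nonneg _)
  nlinarith [sq_nonneg (l2Norm x)]

lemma concGrad_zero_left (x : Fin d → ℝ) :
    concGrad U y 0 x = -linForm U y x / meanSq y + traceForm U x := by
  have h1 : ∀ z, gramForm U y 0 z = 0 := by
    intro z
    have := gramForm_sub_left U y 0 0 z
    simpa using this
  have h2 : linForm U y 0 = 0 := by
    have := linForm_sub U y 0 0
    simpa using this
  simp [concGrad, sigmaHat_eq, h1, h2, resolventForm, delta_zero, traceForm]

/-- A point at which the criterion does not decrease towards the true parameter is close to it. -/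
lemma GoodSample.l2Norm_le (h : GoodSample U y s κ) (hd : 1 ≤ d) (ha : 1 ≤ a)
    (hU : ∀ t k, SumBdd (U t k) a) (hs : 0 < s) (hκ : κ ≤ s / 2) (hc : 0 < c)
    {δ : Fin d → ℝ} (hcrit : concGrad U y δ δ ≤ 0)
    (hmono : c / 2 * l2Norm δ ^ 2 ≤ concGrad U y δ δ - concGrad U y 0 δ) :
    (d : ℝ) * √d * l2Norm δ ≤ 8 * a / (c * s) * κ := by
  obtain ⟨hm1, hm2, hm3⟩ := h.half_le hd hκ
  have hκ0 : 0 ≤ κ := (abs_nonneg _).trans hm3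
  set q := MIR.meanSq y with hq
  have hq0 : 0 < q := by linarith
  set X := l2Norm δ with hX
  have hX0 : 0 ≤ X := l2Norm_nonneg δ
  have hd1 : (1 : ℝ) ≤ d := by exact_mod_cast hd
  have hsd : √(d : ℝ) * √d = d := Real.mul_self_sqrt (by linarith)
  have hg : (d : ℝ) * √d * |concGrad U y 0 δ| ≤ 4 * a / s * κ * X := by
    have e : concGrad U y 0 δ
        = (traceForm U δ * (q - s) - (linForm U y δ - s * traceForm U δ)) / q := by
      rw [concGrad_zero_left, ← hq]; field_simp; ring
    rw [e, abs_div, abs_of_pos hq0, mul_div_assoc', div_le_iff₀ hq0]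
    have h0 := abs_sub (traceForm U δ * (q - s)) (linForm U y δ - s * traceForm U δ)
    rw [abs_mul] at h0
    have h1 := h.lin δ
    have h2 : (d : ℝ) * √d * (|traceForm U δ| * |q - s|) ≤ a * κ * X := by
      have h3 := (abs_traceForm_le (by linarith) hU δ).trans
        (mul_le_mul_of_nonneg_left (l1Norm_le_sqrt_mul δ) (by linarith : 0 ≤ a))
      calc (d : ℝ) * √d * (|traceForm U δ| * |q - s|)
          ≤ (d : ℝ) * √d * ((a * (√d * X)) * |q - s|) := by gcongr
        _ = a * X * ((d * (√d * √d)) * |q - s|) := by ring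
        _ = a * X * ((d : ℝ) ^ 2 * |q - s|) := by rw [hsd]; ring
        _ ≤ a * X * κ := mul_le_mul_of_nonneg_left h.meanSq (by positivity)
        _ = _ := by ring
    calc (d : ℝ) * √d * |traceForm U δ * (q - s) - (linForm U y δ - s * traceForm U δ)|
        ≤ (d : ℝ) * √d * (|traceForm U δ| * |q - s| + |linForm U y δ - s * traceForm U δ|) := by
          gcongr
      _ ≤ a * κ * X + κ * X := by rw [mul_add]; linarith
      _ ≤ 2 * a * (κ * X) := by nlinarith [mul_nonneg hκ0 hX0]
      _ ≤ 4 * a / s * κ * X * q := by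
          have e2 : 4 * a / s * κ * X * q = 2 * a * (κ * X) * (2 * q / s) := by ring
          rw [e2]
          refine le_mul_of_one_le_right (by positivity) ?_
          rw [le_div_iff₀ hs]; linarith
  have h1 : c / 2 * X ^ 2 ≤ |concGrad U y 0 δ| := by
    have := neg_abs_le (concGrad U y 0 δ)
    linarith
  have h2 : (d : ℝ) * √d * (c / 2 * X ^ 2) ≤ 4 * a / s * κ * X :=
    (mul_le_mul_of_nonneg_left h1 (by positivity)).trans hg
  rcases hX0.eq_or_lt with h0 | h0
  · rw [← h0, mul_zero]; positivity
  · have h3 : ((d : ℝ) * √d * X) * (c / 2 * X) ≤ (8 * a / (c * s) * κ) * (c / 2 * X) := by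
      have e1 : (8 * a / (c * s) * κ) * (c / 2 * X) = 4 * a / s * κ * X := by
        field_simp; ring
      rw [e1]; linarith
    exact le_of_mul_le_mul_right h3 (by positivity)

/-- The information matrix, as a bilinear form. -/
noncomputable def infoForm (U : Fin T → Fin d → Matrix (Fin n) (Fin n) ℝ) (s : ℝ)
    (δ : Fin d → ℝ) (η : ℝ) (x : Fin d → ℝ) (w : ℝ) : ℝ :=
  traceGram U δ x + traceProd U δ x + η * traceForm U x / s + w * traceForm U δ / s
    + w * η / (2 * s ^ 2)

/-- The score at the true parameter divided by `nT`, as a linear form. -/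
noncomputable def scoreForm (U : Fin T → Fin d → Matrix (Fin n) (Fin n) ℝ) (y : Fin T → Fin n → ℝ)
    (s : ℝ) (x : Fin d → ℝ) (w : ℝ) : ℝ :=
  (linForm U y x - s * traceForm U x) / s + w * (meanSq y - s) / (2 * s ^ 2)

/-- The constant of the linearization error. -/
noncomputable def linConst (a s c : ℝ) : ℝ :=
  (1 + 4 * s * a ^ 4 * (8 * a / (c * s)) + a ^ 2 * (1 + 4 * s * a * (8 * a / (c * s))
    + 2 * s * a ^ 2 * (8 * a / (c * s)))) / s + (1 + s * a ^ 2 * (8 * a / (c * s))) / s ^ 2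

set_option maxHeartbeats 1000000 in
/-- Linearization of the likelihood equations: at a critical point the information matrix maps the
estimation error to the score, up to a relative error of order `κ`. -/
lemma GoodSample.abs_infoForm_sub_scoreForm_le (h : GoodSample U y s κ) (hd : 1 ≤ d) (ha : 1 ≤ a)
    (hU : ∀ t k, SumBdd (U t k) a) (hR : ResolventBdd U r₀ a) (hs : 0 < s) (hκ : κ ≤ s / 2)
    (hc : 0 < c) (hr0 : 0 ≤ r) (hr1 : a ^ 2 * r ≤ 1 / 6) (hr : r < r₀)
    {δ : Fin d → ℝ} (hδ : l1Norm δ ≤ r / d) (hcrit : ∀ x, concGrad U y δ x = 0)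
    (hsize : (d : ℝ) * √d * l2Norm δ ≤ 8 * a / (c * s) * κ) (x : Fin d → ℝ) (w : ℝ) :
    |infoForm U s δ (sigmaHat U y δ - s) x w - scoreForm U y s x w|
      ≤ linConst a s c * κ * l2Norm δ * (l2Norm x + |w|) := by
  obtain ⟨hm1, hm2, hm3⟩ := h.half_le hd hκ
  have hκ0 : 0 ≤ κ := (abs_nonneg _).trans hm3
  set q := MIR.meanSq y with hq
  have hq0 : 0 < q := by linarith
  have hd1 : (1 : ℝ) ≤ d := by exact_mod_cast hd
  have hsd1 : 1 ≤ √(d : ℝ) := Real.one_le_sqrt.2 hd1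
  have hsd : √(d : ℝ) * √d = d := Real.mul_self_sqrt (by linarith)
  have hrd : r / d ≤ r := div_le_self hr0 hd1
  set L := 8 * a / (c * s) with hL
  have hL0 : 0 ≤ L := by positivity
  set X := l2Norm x with hX
  have hX0 : 0 ≤ X := l2Norm_nonneg x
  set E := l2Norm δ with hE
  have hE0 : 0 ≤ E := l2Norm_nonneg δ
  have hx1 : l1Norm x ≤ √d * X := l1Norm_le_sqrt_mul x
  have hδ1 : l1Norm δ ≤ √d * E := l1Norm_le_sqrt_mul δ
  have hδ0 := l1Norm_nonneg δ
  have hx0 := l1Norm_nonneg x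
  have hr1' : r ≤ 1 := by
    have : 1 ≤ a ^ 2 := one_le_pow₀ ha
    nlinarith
  set S := sigmaHat U y δ with hSdef
  have hSq := abs_sigmaHat_div_sub_one_le ha hU hq0
    ((mul_le_mul_of_nonneg_left hrd (by positivity)).trans hr1) hδ
  have hS3 : 3 * (a ^ 2 * (r / d)) ≤ 1 / 2 := by
    have := mul_le_mul_of_nonneg_left hrd (by positivity : 0 ≤ a ^ 2)
    linarith
  have hSq2 := abs_le.1 (hSq.trans hS3)
  have hS0 : 0 < S := by
    have : 1 / 2 ≤ S / q := by linarith
    rw [le_div_iff₀ hq0] at this; linarith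
  have hS4 : S ≤ 4 * s := by
    have : S / q ≤ 3 / 2 := by linarith
    rw [div_le_iff₀ hq0] at this; linarith
  -- the score equation in the direction `x`
  have hfoc : -linForm U y x + gramForm U y δ x + S * resolventForm U δ x = 0 := by
    have := hcrit x
    simp only [concGrad, ← hSdef] at this
    field_simp at this
    linarith
  have hη : (d : ℝ) * |S - s| ≤ (1 + 4 * s * a * L + 2 * s * a ^ 2 * L) * κ := by
    have e : S - s = (q - s) + (-(2 * linForm U y δ) + gramForm U y δ δ) := by
      rw [hSdef, sigmaHat_eq]; ring
    have h1 : |S - s| ≤ |q - s| + (2 * |linForm U y δ| + |gramForm U y δ δ|) := by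
      rw [e]
      refine (abs_add_le _ _).trans (add_le_add le_rfl ((abs_add_le _ _).trans ?_))
      rw [abs_neg, abs_mul, abs_two]
    have h2 : (d : ℝ) * |q - s| ≤ κ := by
      have h3 := h.meanSq
      have : (d : ℝ) * |q - s| ≤ (d : ℝ) ^ 2 * |q - s| :=
        mul_le_mul_of_nonneg_right (by nlinarith) (abs_nonneg _)
      linarith
    have h3 : (d : ℝ) * |linForm U y δ| ≤ 2 * s * a * L * κ := by
      have h4 := abs_linForm_le (y := y) hU δ
      calc (d : ℝ) * |linForm U y δ| ≤ d * (a * (√d * E) * (2 * s)) := by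
            refine mul_le_mul_of_nonneg_left (h4.trans ?_) (by positivity)
            gcongr
        _ = 2 * s * a * (d * √d * E) := by ring
        _ ≤ 2 * s * a * (L * κ) := mul_le_mul_of_nonneg_left hsize (by positivity)
        _ = _ := by ring
    have h5 : (d : ℝ) * |gramForm U y δ δ| ≤ 2 * s * a ^ 2 * L * κ := by
      have h6 := abs_gramForm_le (y := y) hU δ δ
      calc (d : ℝ) * |gramForm U y δ δ| ≤ d * (a ^ 2 * (√d * E) * (r / d) * (2 * s)) := by
            refine mul_le_mul_of_nonneg_left (h6.trans ?_) (by positivity)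
            gcongr
        _ = 2 * s * a ^ 2 * (√d * E) * r := by field_simp
        _ ≤ 2 * s * a ^ 2 * (d * √d * E) * 1 := by
            gcongr
            exact le_mul_of_one_le_left (by positivity) hd1
        _ ≤ 2 * s * a ^ 2 * (L * κ) * 1 := by gcongr
        _ = _ := by ring
    calc (d : ℝ) * |S - s| ≤ d * (|q - s| + (2 * |linForm U y δ| + |gramForm U y δ δ|)) := by
          gcongr
      _ ≤ _ := by linarith
  have hxpart : |traceGram U δ x + traceProd U δ x + (S - s) * traceForm U x / s
      - (linForm U y x - s * traceForm U x) / s|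
      ≤ (1 + 4 * s * a ^ 4 * L + a ^ 2 * (1 + 4 * s * a * L + 2 * s * a ^ 2 * L)) / s
        * κ * E * X := by
    have e : traceGram U δ x + traceProd U δ x + (S - s) * traceForm U x / s
        - (linForm U y x - s * traceForm U x) / s
        = (-(gramForm U y δ x - s * traceGram U δ x)
          + (-(S * (resolventForm U δ x - traceForm U x - traceProd U δ x))
          + -((S - s) * traceProd U δ x))) / s := by
      have : linForm U y x = gramForm U y δ x + S * resolventForm U δ x := by linarith
      rw [this]; field_simp; ring
    rw [e, abs_div, abs_of_pos hs]
    have h1 : |gramForm U y δ x - s * traceGram U δ x| ≤ κ * E * X := by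
      have h1 := h.gram δ x
      have h2 := abs_nonneg (gramForm U y δ x - s * traceGram U δ x)
      nlinarith
    have h2 : |S * (resolventForm U δ x - traceForm U x - traceProd U δ x)|
        ≤ 4 * s * a ^ 4 * L * κ * E * X := by
      rw [abs_mul, abs_of_pos hS0]
      have h3 := abs_resolventForm_sub_traceForm_le hU hR (hδ.trans_lt (hrd.trans_lt hr)) x
      calc S * |resolventForm U δ x - traceForm U x - traceProd U δ x|
          ≤ (4 * s) * (a ^ 4 * (√d * E) ^ 2 * (√d * X)) := by
            refine mul_le_mul hS4 (h3.trans ?_) (abs_nonneg _) (by positivity)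
            gcongr
        _ = 4 * s * a ^ 4 * ((√d * √d) * √d * E) * E * X := by ring
        _ ≤ 4 * s * a ^ 4 * (L * κ) * E * X := by
            rw [hsd]; gcongr
        _ = _ := by ring
    have h4 : |(S - s) * traceProd U δ x|
        ≤ a ^ 2 * (1 + 4 * s * a * L + 2 * s * a ^ 2 * L) * κ * E * X := by
      rw [abs_mul]
      have h5 := abs_traceProd_le hU δ x (by linarith)
      calc |S - s| * |traceProd U δ x| ≤ |S - s| * (a ^ 2 * (√d * E) * (√d * X)) := by
            refine mul_le_mul_of_nonneg_left (h5.trans ?_) (abs_nonneg _)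
            gcongr
        _ = a ^ 2 * ((√d * √d) * |S - s|) * E * X := by ring
        _ ≤ a ^ 2 * ((1 + 4 * s * a * L + 2 * s * a ^ 2 * L) * κ) * E * X := by
            rw [hsd]; gcongr
        _ = _ := by ring
    have h6 : |(-(gramForm U y δ x - s * traceGram U δ x)
          + (-(S * (resolventForm U δ x - traceForm U x - traceProd U δ x))
          + -((S - s) * traceProd U δ x)))| ≤ κ * E * X + (4 * s * a ^ 4 * L * κ * E * X
          + a ^ 2 * (1 + 4 * s * a * L + 2 * s * a ^ 2 * L) * κ * E * X) := by
      refine (abs_add_le _ _).trans (add_le_add (by rwa [abs_neg]) ((abs_add_le _ _).trans ?_))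
      rw [abs_neg, abs_neg]
      exact add_le_add h2 h4
    rw [div_le_iff₀ hs]
    refine h6.trans (le_of_eq ?_)
    field_simp
    ring
  have hwpart : |w * traceForm U δ / s + w * (S - s) / (2 * s ^ 2)
      - w * (q - s) / (2 * s ^ 2)| ≤ (1 + s * a ^ 2 * L) / s ^ 2 * κ * E * |w| := by
    have e : w * traceForm U δ / s + w * (S - s) / (2 * s ^ 2) - w * (q - s) / (2 * s ^ 2)
        = (-(2 * (linForm U y δ - s * traceForm U δ)) + gramForm U y δ δ) * w / (2 * s ^ 2) := by
      rw [hSdef, sigmaHat_eq, ← hq]; field_simp; ring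
    rw [e, abs_div, abs_mul, abs_of_pos (by positivity : 0 < 2 * s ^ 2)]
    have h1 : |linForm U y δ - s * traceForm U δ| ≤ κ * E := by
      have h1 := h.lin δ
      have h2 := abs_nonneg (linForm U y δ - s * traceForm U δ)
      have h3 : 1 ≤ (d : ℝ) * √d := by nlinarith
      nlinarith
    have h2 : |gramForm U y δ δ| ≤ 2 * s * a ^ 2 * L * κ * E := by
      have h3 := abs_gramForm_le (y := y) hU δ δ
      calc |gramForm U y δ δ| ≤ a ^ 2 * (√d * E) * (√d * E) * (2 * s) := by
            refine h3.trans ?_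
            gcongr
        _ = 2 * s * a ^ 2 * ((√d * √d) * 1 * E) * E := by ring
        _ ≤ 2 * s * a ^ 2 * (d * √d * E) * E := by
            rw [hsd]; gcongr
        _ ≤ 2 * s * a ^ 2 * (L * κ) * E := by gcongr
        _ = _ := by ring
    have h3 : |-(2 * (linForm U y δ - s * traceForm U δ)) + gramForm U y δ δ|
        ≤ 2 * (κ * E) + 2 * s * a ^ 2 * L * κ * E := by
      refine (abs_add_le _ _).trans ?_
      rw [abs_neg, abs_mul, abs_two]
      linarith
    rw [div_le_iff₀ (by positivity)]
    refine (mul_le_mul_of_nonneg_right h3 (abs_nonneg w)).trans (le_of_eq ?_)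
    field_simp
  have e : infoForm U s δ (S - s) x w - scoreForm U y s x w
      = (traceGram U δ x + traceProd U δ x + (S - s) * traceForm U x / s
        - (linForm U y x - s * traceForm U x) / s)
        + (w * traceForm U δ / s + w * (S - s) / (2 * s ^ 2) - w * (q - s) / (2 * s ^ 2)) := by
    simp only [infoForm, scoreForm]; ring
  rw [e]
  refine (abs_add_le _ _).trans ((add_le_add hxpart hwpart).trans ?_)
  rw [linConst, ← hL]
  set A1 := (1 + 4 * s * a ^ 4 * L + a ^ 2 * (1 + 4 * s * a * L + 2 * s * a ^ 2 * L)) / s with hA1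
  set A2 := (1 + s * a ^ 2 * L) / s ^ 2 with hA2
  have hA10 : 0 ≤ A1 := by positivity
  have hA20 : 0 ≤ A2 := by positivity
  have hw := abs_nonneg w
  have e2 : (A1 + A2) * κ * E * (X + |w|) = A1 * κ * E * X + A2 * κ * E * |w|
      + (A1 * κ * E * |w| + A2 * κ * E * X) := by ring
  rw [e2]
  have : 0 ≤ A1 * κ * E * |w| + A2 * κ * E * X := by positivity
  linarith

end Deterministic

/-! ### Derivatives of the likelihood -/

/-- Jacobi's formula, from the expansion `det (1 + s M) = 1 + s tr M + O(s²)`. -/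
lemma hasDerivAt_log_abs_det {n : ℕ} {A : Matrix (Fin n) (Fin n) ℝ} (B : Matrix (Fin n) (Fin n) ℝ)
    (hA : IsUnit A.det) :
    HasDerivAt (fun s : ℝ => Real.log |(A - s • B).det|) (-(A⁻¹ * B).trace) 0 := by
  have h0 : A.det ≠ 0 := hA.ne_zero
  set M := -(A⁻¹ * B) with hM
  have hdet : ∀ s : ℝ, (A - s • B).det = A.det * (1 + s • M).det := by
    intro s
    rw [← Matrix.det_mul, mul_add, mul_one, hM, Matrix.mul_smul, mul_neg, ← mul_assoc,
      Matrix.mul_nonsing_inv _ hA, one_mul, smul_neg, sub_eq_add_neg]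
  have hderiv : HasDerivAt (fun s : ℝ => (1 + s • M).det) M.trace 0 := by
    set P := (Matrix.det (1 + (Polynomial.X : Polynomial ℝ) • M.map Polynomial.C)).divX.divX with hP
    have hexp : (fun s : ℝ => (1 + s • M).det) = fun s => 1 + M.trace * s + P.eval s * s ^ 2 :=
      funext fun s => Matrix.det_one_add_smul s M
    rw [hexp]
    have h1 : HasDerivAt (fun s : ℝ => 1 + M.trace * s + P.eval s * s ^ 2)
        (M.trace * 1 + (P.derivative.eval 0 * 0 ^ 2 + P.eval 0 * (2 * 0 ^ (2 - 1)))) 0 := by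
      refine (((hasDerivAt_id (0 : ℝ)).const_mul M.trace).const_add 1).add ?_
      refine (P.hasDerivAt 0).mul ?_
      simpa using hasDerivAt_pow 2 (0 : ℝ)
    convert h1 using 1
    simp
  have h2 : HasDerivAt (fun s : ℝ => (A - s • B).det) (A.det * M.trace) 0 := by
    simp only [hdet]
    exact hderiv.const_mul _
  simp only [Real.log_abs]
  have h3 := h2.log (by simpa using h0)
  convert h3 using 1
  simp only [zero_smul, sub_zero]
  rw [mul_div_cancel_left₀ _ h0, hM, Matrix.trace_neg]

section Model

variable {n T d : ℕ} (W : Fin T → Fin d → Matrix (Fin n) (Fin n) ℝ) (Y : Fin T → Fin n → ℝ)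

lemma delta_add_smul (V : Fin d → Matrix (Fin n) (Fin n) ℝ) (lam x : Fin d → ℝ) (s : ℝ) :
    delta V (lam + s • x) = delta V lam - s • influence V x := by
  rw [delta_add, influence_smul]

lemma rss_add_smul (lam x : Fin d → ℝ) (s : ℝ) :
    rss W Y (lam + s • x) = rss W Y lam
      - 2 * s * ∑ t, (delta (W t) lam *ᵥ Y t) ⬝ᵥ (influence (W t) x *ᵥ Y t)
      + s ^ 2 * ∑ t, (influence (W t) x *ᵥ Y t) ⬝ᵥ (influence (W t) x *ᵥ Y t) := by
  simp only [rss_eq, Finset.mul_sum]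
  rw [← Finset.sum_sub_distrib, ← Finset.sum_add_distrib]
  refine Finset.sum_congr rfl fun t _ => ?_
  rw [delta_add_smul, Matrix.sub_mulVec, Matrix.smul_mulVec, sub_dotProduct, dotProduct_sub,
    dotProduct_sub, smul_dotProduct, dotProduct_smul, dotProduct_smul, smul_dotProduct,
    dotProduct_comm (influence (W t) x *ᵥ Y t) (delta (W t) lam *ᵥ Y t)]
  simp only [smul_eq_mul]
  ring

lemma hasDerivAt_rss (lam x : Fin d → ℝ) :
    HasDerivAt (fun s : ℝ => rss W Y (lam + s • x))
      (-2 * ∑ t, (delta (W t) lam *ᵥ Y t) ⬝ᵥ (influence (W t) x *ᵥ Y t)) 0 := by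
  simp only [rss_add_smul]
  have h1 := ((((hasDerivAt_id (0 : ℝ)).const_mul 2).mul_const
    (∑ t, (delta (W t) lam *ᵥ Y t) ⬝ᵥ (influence (W t) x *ᵥ Y t))).const_sub (rss W Y lam)).add
    ((hasDerivAt_pow 2 (0 : ℝ)).mul_const
    (∑ t, (influence (W t) x *ᵥ Y t) ⬝ᵥ (influence (W t) x *ᵥ Y t)))
  refine h1.congr_deriv ?_
  rw [Nat.add_one_sub_one, pow_one]
  ring

lemma hasDerivAt_sum_log_abs_det {lam : Fin d → ℝ} (hdet : ∀ t, IsUnit (delta (W t) lam).det)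
    (x : Fin d → ℝ) :
    HasDerivAt (fun s : ℝ => ∑ t, Real.log |(delta (W t) (lam + s • x)).det|)
      (-∑ t, ((delta (W t) lam)⁻¹ * influence (W t) x).trace) 0 := by
  rw [← Finset.sum_neg_distrib]
  refine HasDerivAt.fun_sum fun t _ => ?_
  refine (hasDerivAt_log_abs_det (influence (W t) x) (hdet t)).congr_of_eventuallyEq ?_
  refine Eventually.of_forall fun s => ?_
  have e := delta_add_smul (W t) lam x s
  simp only [e]

lemma hasDerivAt_concLogLik {lam : Fin d → ℝ} (hdet : ∀ t, IsUnit (delta (W t) lam).det)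
    (hpos : 0 < sigmaHat W Y lam) (x : Fin d → ℝ) :
    HasDerivAt (fun s : ℝ => concLogLik W Y (lam + s • x))
      ((∑ t, (delta (W t) lam *ᵥ Y t) ⬝ᵥ (influence (W t) x *ᵥ Y t)) / sigmaHat W Y lam
        - ∑ t, ((delta (W t) lam)⁻¹ * influence (W t) x).trace) 0 := by
  have hN : ((n : ℝ) * T) ≠ 0 := by
    intro h
    simp [sigmaHat, h] at hpos
  have h1 : HasDerivAt (fun s : ℝ => sigmaHat W Y (lam + s • x)) (((n : ℝ) * T)⁻¹ *
      (-2 * ∑ t, (delta (W t) lam *ᵥ Y t) ⬝ᵥ (influence (W t) x *ᵥ Y t))) 0 :=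
    (hasDerivAt_rss W Y lam x).const_mul _
  have h2 := h1.log (by simpa using hpos.ne')
  have h3 := ((h2.const_mul ((n : ℝ) * T / 2)).const_sub
    (-((n : ℝ) * T / 2) * Real.log (2 * Real.pi) - (n : ℝ) * T / 2)).add
    (hasDerivAt_sum_log_abs_det W hdet x)
  refine h3.congr_deriv ?_
  simp only [zero_smul, add_zero]
  generalize (n : ℝ) * T = N at hN
  field_simp
  ring

/-- The weight matrices in the coordinates in which the responses are the errors. -/
noncomputable def whiten (lam0 : Fin d → ℝ) : Fin T → Fin d → Matrix (Fin n) (Fin n) ℝ :=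
  fun t k => W t k * (delta (W t) lam0)⁻¹

variable {W Y} {lam0 : Fin d → ℝ} {y : Fin T → Fin n → ℝ}

lemma influence_whiten (t : Fin T) (x : Fin d → ℝ) :
    influence (whiten W lam0 t) x = influence (W t) x * (delta (W t) lam0)⁻¹ := by
  simp only [influence, whiten, Finset.sum_mul, Matrix.smul_mul]

lemma delta_whiten_mul (h0 : ∀ t, IsUnit (delta (W t) lam0).det) (t : Fin T) (δ : Fin d → ℝ) :
    delta (whiten W lam0 t) δ * delta (W t) lam0 = delta (W t) (lam0 + δ) := by
  rw [delta, influence_whiten, sub_mul, one_mul, mul_assoc, Matrix.nonsing_inv_mul _ (h0 t),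
    mul_one, delta_add]

lemma delta_add_mulVec (h0 : ∀ t, IsUnit (delta (W t) lam0).det)
    (hy : ∀ t, delta (W t) lam0 *ᵥ Y t = y t) (t : Fin T) (δ : Fin d → ℝ) :
    delta (W t) (lam0 + δ) *ᵥ Y t = delta (whiten W lam0 t) δ *ᵥ y t := by
  rw [← delta_whiten_mul h0, ← hy, Matrix.mulVec_mulVec]

lemma influence_mulVec (h0 : ∀ t, IsUnit (delta (W t) lam0).det)
    (hy : ∀ t, delta (W t) lam0 *ᵥ Y t = y t) (t : Fin T) (x : Fin d → ℝ) :
    influence (W t) x *ᵥ Y t = influence (whiten W lam0 t) x *ᵥ y t := by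
  rw [influence_whiten, ← hy, Matrix.mulVec_mulVec, mul_assoc, Matrix.nonsing_inv_mul _ (h0 t),
    mul_one]

lemma sigmaHat_whiten (h0 : ∀ t, IsUnit (delta (W t) lam0).det)
    (hy : ∀ t, delta (W t) lam0 *ᵥ Y t = y t) (δ : Fin d → ℝ) :
    sigmaHat W Y (lam0 + δ) = sigmaHat (whiten W lam0) y δ := by
  simp only [sigmaHat, rss_eq, delta_add_mulVec h0 hy]

lemma isUnit_det_whiten (h0 : ∀ t, IsUnit (delta (W t) lam0).det) {t : Fin T} {δ : Fin d → ℝ}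
    (h : IsUnit (delta (W t) (lam0 + δ)).det) : IsUnit (delta (whiten W lam0 t) δ).det := by
  rw [← delta_whiten_mul h0, Matrix.det_mul] at h
  exact isUnit_of_mul_isUnit_left h

lemma trace_inv_delta_mul (h0 : ∀ t, IsUnit (delta (W t) lam0).det) (t : Fin T)
    (δ x : Fin d → ℝ) :
    ((delta (W t) (lam0 + δ))⁻¹ * influence (W t) x).trace
      = ((delta (whiten W lam0 t) δ)⁻¹ * influence (whiten W lam0 t) x).trace := by
  rw [← delta_whiten_mul h0, Matrix.mul_inv_rev, influence_whiten, mul_assoc, Matrix.trace_mul_comm,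
    mul_assoc]

lemma sum_eq_mul_avg (hN : ((n : ℝ) * T) ≠ 0) (f : Fin T → ℝ) :
    ∑ t, f t = (n : ℝ) * T * avg n f := by
  rw [avg, mul_inv_cancel_left₀ hN]

lemma delta_mulVec_dotProduct (U : Fin T → Fin d → Matrix (Fin n) (Fin n) ℝ) (δ x : Fin d → ℝ) :
    (avg n fun t => (delta (U t) δ *ᵥ y t) ⬝ᵥ (influence (U t) x *ᵥ y t))
      = linForm U y x - gramForm U y δ x := by
  rw [linForm, gramForm, ← avg_sub]
  simp only [delta, Matrix.sub_mulVec, Matrix.one_mulVec, sub_dotProduct]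

lemma hasDerivAt_concLogLik_whiten (h0 : ∀ t, IsUnit (delta (W t) lam0).det)
    (hy : ∀ t, delta (W t) lam0 *ᵥ Y t = y t) {δ : Fin d → ℝ}
    (hdet : ∀ t, IsUnit (delta (W t) (lam0 + δ)).det)
    (hpos : 0 < sigmaHat (whiten W lam0) y δ) (x : Fin d → ℝ) :
    HasDerivAt (fun s : ℝ => concLogLik W Y (lam0 + δ + s • x))
      (-((n : ℝ) * T * concGrad (whiten W lam0) y δ x)) 0 := by
  have hN : ((n : ℝ) * T) ≠ 0 := by
    intro h
    simp [sigmaHat, h] at hpos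
  refine (hasDerivAt_concLogLik W Y hdet (by rwa [sigmaHat_whiten h0 hy]) x).congr_deriv ?_
  simp only [delta_add_mulVec h0 hy, influence_mulVec h0 hy, sigmaHat_whiten h0 hy,
    trace_inv_delta_mul h0]
  rw [sum_eq_mul_avg hN, sum_eq_mul_avg hN, delta_mulVec_dotProduct]
  simp only [concGrad, resolventForm]
  ring

end Model

/-! ### Existence and uniqueness of the estimate -/

lemma continuous_l1Norm {d : ℕ} : Continuous (l1Norm : (Fin d → ℝ) → ℝ) := by
  unfold l1Norm; fun_prop

lemma isOpen_paramSpace (d : ℕ) (ς : ℝ) : IsOpen (paramSpace d ς) :=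
  isOpen_lt continuous_l1Norm continuous_const

lemma isCompact_l1Ball {d : ℕ} (x0 : Fin d → ℝ) (r : ℝ) :
    IsCompact {x : Fin d → ℝ | l1Norm (x - x0) ≤ r} := by
  refine Metric.isCompact_of_isClosed_isBounded
    (isClosed_le (continuous_l1Norm.comp (continuous_id.sub continuous_const)) continuous_const) ?_
  refine (Metric.isBounded_closedBall (x := x0) (r := max r 0)).subset fun x hx => ?_
  rw [Metric.mem_closedBall, dist_pi_le_iff (le_max_right _ _)]
  intro k
  have h1 : |x k - x0 k| ≤ l1Norm (x - x0) :=
    Finset.single_le_sum (f := fun k => |(x - x0) k|) (fun _ _ => abs_nonneg _) (Finset.mem_univ k)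
  exact (h1.trans hx).trans (le_max_left _ _)

@[simp] lemma lamPart_mkParam {d : ℕ} (lam : Fin d → ℝ) (s : ℝ) :
    lamPart (mkParam lam s) = lam := by
  ext k; simp [lamPart, mkParam]

@[simp] lemma varPart_mkParam {d : ℕ} (lam : Fin d → ℝ) (s : ℝ) : varPart (mkParam lam s) = s := by
  simp [varPart, mkParam]

lemma param_ext {d : ℕ} {θ θ' : Fin (d + 1) → ℝ} (h1 : lamPart θ = lamPart θ')
    (h2 : varPart θ = varPart θ') : θ = θ' := by
  ext k
  refine Fin.lastCases ?_ (fun i => ?_) k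
  · exact h2
  · exact congrFun h1 i

lemma l2Norm_eq_zero {d : ℕ} {x : Fin d → ℝ} (h : l2Norm x ^ 2 ≤ 0) : x = 0 := by
  rw [l2Norm_sq] at h
  have h0 := le_antisymm h (Finset.sum_nonneg fun _ _ => sq_nonneg _)
  rw [Finset.sum_eq_zero_iff_of_nonneg fun _ _ => sq_nonneg _] at h0
  ext k
  simpa using h0 k (Finset.mem_univ k)

section QMLE

variable {n T d : ℕ} {W : Fin T → Fin d → Matrix (Fin n) (Fin n) ℝ} {Y : Fin T → Fin n → ℝ}
  {lam0 : Fin d → ℝ} {y : Fin T → Fin n → ℝ} {ς r₀ Cw a s c r κ : ℝ}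

/-- The deterministic conditions under which the likelihood equations are solved: bounds for the
matrices, curvature, a good sample, and smallness of the radius `r` and of `κ`. -/
structure LocalSetup (W : Fin T → Fin d → Matrix (Fin n) (Fin n) ℝ) (Y : Fin T → Fin n → ℝ)
    (lam0 : Fin d → ℝ) (y : Fin T → Fin n → ℝ) (ς r₀ a s c r κ : ℝ) : Prop where
  dim : 1 ≤ d
  space : ∀ lam, l1Norm (lam - lam0) < r₀ → lam ∈ paramSpace d ς
  unit : ∀ lam, l1Norm (lam - lam0) < r₀ → ∀ t, IsUnit (delta (W t) lam).det
  model : ∀ t, delta (W t) lam0 *ᵥ Y t = y t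
  one_le : 1 ≤ a
  bdd : ∀ t k, SumBdd (whiten W lam0 t k) a
  res : ResolventBdd (whiten W lam0) r₀ a
  s_pos : 0 < s
  c_pos : 0 < c
  schur : SchurBound (whiten W lam0) c
  good : GoodSample (whiten W lam0) y s κ
  r_pos : 0 < r
  r_le : a ^ 2 * r ≤ 1 / 6
  r_lt : r < r₀
  r_curv : 68 * a ^ 5 * r ≤ c / 4
  κ_le : κ ≤ s / 2
  κ_curv : 20 * a ^ 2 * κ / s ≤ c / 4
  κ_lt : 8 * a / (c * s) * κ < r

namespace LocalSetup

variable (h : LocalSetup W Y lam0 y ς r₀ a s c r κ)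

include h

lemma r_div_le : r / d ≤ r := div_le_self h.r_pos.le (by exact_mod_cast h.dim)

lemma lt_of_le {lam : Fin d → ℝ} (hl : l1Norm (lam - lam0) ≤ r / d) : l1Norm (lam - lam0) < r₀ :=
  hl.trans_lt (h.r_div_le.trans_lt h.r_lt)

lemma unit0 (t : Fin T) : IsUnit (delta (W t) lam0).det := by
  refine h.unit lam0 ?_ t
  have : l1Norm (lam0 - lam0) = 0 := by simp [l1Norm]
  rw [this]; exact h.r_pos.trans h.r_lt

lemma meanSq_pos : 0 < meanSq y := by
  have := (h.good.half_le h.dim h.κ_le).1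
  have := h.s_pos
  linarith

lemma sigmaHat_pos {δ : Fin d → ℝ} (hδ : l1Norm δ ≤ r / d) :
    0 < sigmaHat (whiten W lam0) y δ := by
  have hq0 := h.meanSq_pos
  have ha := h.one_le
  have h1 : a ^ 2 * (r / d) ≤ 1 / 6 :=
    (mul_le_mul_of_nonneg_left h.r_div_le (by positivity)).trans h.r_le
  have h2 := (abs_le.1 (abs_sigmaHat_div_sub_one_le h.one_le h.bdd hq0 h1 hδ)).1
  have : 0 < sigmaHat (whiten W lam0) y δ / meanSq y := by linarith
  exact (div_pos_iff_of_pos_right hq0).1 this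

lemma hasDerivAt {lam : Fin d → ℝ} (hl : l1Norm (lam - lam0) ≤ r / d) (x : Fin d → ℝ) :
    HasDerivAt (fun s : ℝ => concLogLik W Y (lam + s • x))
      (-((n : ℝ) * T * concGrad (whiten W lam0) y (lam - lam0) x)) 0 := by
  have := hasDerivAt_concLogLik_whiten (y := y) h.unit0 h.model (δ := lam - lam0)
    (by simpa using h.unit lam (h.lt_of_le hl)) (h.sigmaHat_pos hl) x
  simpa using this

lemma mul_pos : 0 < (n : ℝ) * T := by
  have h1 := h.meanSq_pos
  rcases (by positivity : (0 : ℝ) ≤ (n : ℝ) * T).eq_or_lt with h0 | h0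
  · simp [meanSq, avg, ← h0] at h1
  · exact h0

/-- A local maximizer in the ball is a zero of the concentrated score. -/
lemma concGrad_eq_zero {lam : Fin d → ℝ} (hl : l1Norm (lam - lam0) ≤ r / d)
    (hmax : IsLocalMaxOn (concLogLik W Y) (paramSpace d ς) lam) (x : Fin d → ℝ) :
    concGrad (whiten W lam0) y (lam - lam0) x = 0 := by
  have hmem : paramSpace d ς ∈ 𝓝 lam := (isOpen_paramSpace d ς).mem_nhds (h.space _ (h.lt_of_le hl))
  have h1 : IsLocalMax (concLogLik W Y) lam := hmax.isLocalMax hmem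
  have hcont : Continuous fun s : ℝ => lam + s • x := by fun_prop
  have h2 : IsLocalMax (fun s : ℝ => concLogLik W Y (lam + s • x)) 0 := by
    have ht : Tendsto (fun s : ℝ => lam + s • x) (𝓝 0) (𝓝 lam) := by
      simpa using hcont.tendsto 0
    have := ht.eventually h1
    simpa [IsLocalMax, IsMaxFilter] using this
  have h3 := h2.hasDerivAt_eq_zero (h.hasDerivAt hl x)
  have := h.mul_pos
  rw [neg_eq_zero] at h3
  exact (mul_eq_zero.1 h3).resolve_left this.ne'

lemma strongMono {δ δ' : Fin d → ℝ} (hδ : l1Norm δ ≤ r / d) (hδ' : l1Norm δ' ≤ r / d) :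
    c / 2 * l2Norm (δ - δ') ^ 2 ≤ concGrad (whiten W lam0) y δ (δ - δ')
      - concGrad (whiten W lam0) y δ' (δ - δ') :=
  h.good.concGrad_strongMono h.dim h.one_le h.bdd h.res h.s_pos h.schur h.r_pos.le h.r_le h.r_lt
    h.r_curv h.κ_le h.κ_curv hδ hδ'

lemma size_le {δ : Fin d → ℝ} (hδ : l1Norm δ ≤ r / d)
    (hcrit : concGrad (whiten W lam0) y δ δ ≤ 0) :
    (d : ℝ) * √d * l2Norm δ ≤ 8 * a / (c * s) * κ := by
  refine h.good.l2Norm_le h.dim h.one_le h.bdd h.s_pos h.κ_le h.c_pos hcrit ?_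
  have h0 : l1Norm (0 : Fin d → ℝ) ≤ r / d := by
    have := h.r_pos
    simp only [l1Norm, Pi.zero_apply, abs_zero, Finset.sum_const_zero]
    positivity
  simpa using h.strongMono hδ h0

lemma continuousOn : ContinuousOn (concLogLik W Y) {lam | l1Norm (lam - lam0) ≤ r / d} := by
  have hdelta : ∀ t, Continuous fun lam : Fin d → ℝ => delta (W t) lam := by
    intro t
    unfold delta influence
    fun_prop
  have hsig : Continuous fun lam => sigmaHat W Y lam := by
    unfold sigmaHat rss
    refine continuous_const.mul (continuous_finsetSum _ fun t _ => ?_)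
    exact continuous_const.dotProduct
      (((hdelta t).matrix_transpose.matrix_mul (hdelta t)).matrix_mulVec continuous_const)
  unfold concLogLik
  refine (continuousOn_const.sub (continuousOn_const.mul (hsig.continuousOn.log ?_))).add
    (continuousOn_finsetSum _ fun t _ => ContinuousOn.log ?_ ?_)
  · intro lam hl
    have := h.sigmaHat_pos hl
    rw [← sigmaHat_whiten h.unit0 h.model] at this
    simpa using this.ne'
  · exact ((hdelta t).matrix_det.abs).continuousOn
  · intro lam hl
    exact abs_ne_zero.2 (h.unit lam (h.lt_of_le hl) t).ne_zero

/-- The maximizer of the concentrated likelihood over the closed ball is an interior point. -/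
lemma exists_nearQMLE : ∃ θ, IsNearQMLE ς r W lam0 Y θ := by
  have hd1 : (1 : ℝ) ≤ d := by exact_mod_cast h.dim
  have hrd : 0 < r / d := div_pos h.r_pos (by linarith)
  obtain ⟨lam, hl, hmax⟩ := (isCompact_l1Ball lam0 (r / d)).exists_isMaxOn
    ⟨lam0, by simpa [l1Norm] using hrd.le⟩ h.continuousOn
  set δ := lam - lam0 with hδ
  have hl' : l1Norm δ ≤ r / d := hl
  -- the criterion does not increase from the maximizer towards the centre of the ball
  have hcrit : concGrad (whiten W lam0) y δ δ ≤ 0 := by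
    have hder := h.hasDerivAt hl (-δ)
    rw [hasDerivAt_iff_tendsto_slope_zero] at hder
    have hneg : concGrad (whiten W lam0) y δ (-δ) = -concGrad (whiten W lam0) y δ δ := by
      have h1 := concGrad_sub_right (whiten W lam0) y δ 0 δ
      have h2 := concGrad_sub_right (whiten W lam0) y δ 0 0
      simp only [sub_self] at h2
      rwa [h2, zero_sub, zero_sub] at h1
    rw [hneg] at hder
    have hder' := hder.mono_left (nhdsWithin_mono (s := Set.Ioi 0) (0 : ℝ)
      (fun u hu => (ne_of_gt hu : u ≠ 0)))
    have hle := le_of_tendsto hder' (b := 0) ?_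
    · have := h.mul_pos
      nlinarith
    · have h01 : ∀ᶠ u : ℝ in 𝓝[>] 0, u ∈ Set.Ioo (0 : ℝ) 1 := Ioo_mem_nhdsGT one_pos
      filter_upwards [h01] with u hu
      have hmem : lam + (0 + u) • (-δ) ∈ {lam | l1Norm (lam - lam0) ≤ r / d} := by
        have e : lam + (0 + u) • (-δ) - lam0 = (1 - u) • δ := by
          rw [hδ]; module
        simp only [Set.mem_ofPred_eq, e, l1Norm_smul]
        rw [abs_of_pos (by linarith [hu.2])]
        nlinarith [l1Norm_nonneg δ, hu.1, hu.2]
      have h1 := hmax hmem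
      have h2 : concLogLik W Y (lam + (0 + u) • (-δ))
          - concLogLik W Y (lam + (0 : ℝ) • (-δ)) ≤ 0 := by
        simp only [zero_smul, add_zero]
        exact sub_nonpos.2 h1
      exact mul_nonpos_of_nonneg_of_nonpos (inv_nonneg.2 hu.1.le) h2
  -- hence it lies in the interior of the ball
  have hsize := h.size_le hl' hcrit
  have hlt : l1Norm δ < r / d := by
    rw [lt_div_iff₀ (by linarith)]
    have h1 := l1Norm_le_sqrt_mul δ
    have h2 := h.κ_lt
    calc l1Norm δ * d ≤ √d * l2Norm δ * d := by gcongr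
      _ = d * √d * l2Norm δ := by ring
      _ < r := by linarith
  have hloc : IsLocalMax (concLogLik W Y) lam := by
    have hopen : IsOpen {x : Fin d → ℝ | l1Norm (x - lam0) < r / d} :=
      isOpen_lt (continuous_l1Norm.comp (continuous_id.sub continuous_const)) continuous_const
    filter_upwards [hopen.mem_nhds hlt] with x hx
    exact hmax (le_of_lt hx : l1Norm (x - lam0) ≤ r / d)
  refine ⟨mkParam lam (sigmaHat W Y lam), ⟨?_, ?_, ?_, ?_⟩, ?_⟩
  · simpa using h.space lam (h.lt_of_le hl)
  · simpa using hloc.on _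
  · simp
  · have := h.sigmaHat_pos hl'
    rw [← sigmaHat_whiten h.unit0 h.model] at this
    simpa [hδ] using this
  · simpa using hl'

lemma existsUnique_nearQMLE : ∃! θ, IsNearQMLE ς r W lam0 Y θ := by
  obtain ⟨θ, hθ⟩ := h.exists_nearQMLE
  refine ⟨θ, hθ, fun θ' hθ' => ?_⟩
  have h1 := h.strongMono hθ'.2 hθ.2
  rw [h.concGrad_eq_zero hθ.2 hθ.1.localMax, h.concGrad_eq_zero hθ'.2 hθ'.1.localMax,
    sub_zero] at h1
  have hc := h.c_pos
  have h2 := l2Norm_eq_zero (x := lamPart θ' - lam0 - (lamPart θ - lam0)) (by nlinarith)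
  have h3 : lamPart θ' = lamPart θ := by
    have : lamPart θ' - lamPart θ = 0 := by rw [← h2]; abel
    exact sub_eq_zero.1 this
  exact param_ext h3 (by rw [hθ'.1.var_eq, hθ.1.var_eq, h3])

/-- The estimation error of an estimate near the true parameter solves the linearized likelihood
equations. -/
lemma abs_infoForm_sub_scoreForm_le {θ : Fin (d + 1) → ℝ} (hθ : IsNearQMLE ς r W lam0 Y θ)
    (x : Fin d → ℝ) (w : ℝ) :
    |infoForm (whiten W lam0) s (lamPart θ - lam0) (varPart θ - s) x w
        - scoreForm (whiten W lam0) y s x w|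
      ≤ linConst a s c * κ * l2Norm (lamPart θ - lam0) * (l2Norm x + |w|) := by
  have hcrit := h.concGrad_eq_zero hθ.2 hθ.1.localMax
  have hvar : varPart θ = sigmaHat (whiten W lam0) y (lamPart θ - lam0) := by
    rw [hθ.1.var_eq, ← sigmaHat_whiten h.unit0 h.model]; simp
  rw [hvar]
  exact h.good.abs_infoForm_sub_scoreForm_le h.dim h.one_le h.bdd h.res h.s_pos h.κ_le h.c_pos
    h.r_pos.le h.r_le h.r_lt hθ.2 hcrit (h.size_le hθ.2 (hcrit _).le) x w

end LocalSetup

end QMLE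

/-! ### Score and information matrix at the true parameter -/

lemma hasDerivAt_trace_inv {n : ℕ} {A : Matrix (Fin n) (Fin n) ℝ} (B C : Matrix (Fin n) (Fin n) ℝ)
    (hA : IsUnit A.det) :
    HasDerivAt (fun s : ℝ => ((A - s • B)⁻¹ * C).trace) (A⁻¹ * B * A⁻¹ * C).trace 0 := by
  have hdet : Continuous fun s : ℝ => (A - s • B).det := by
    refine Continuous.matrix_det ?_
    fun_prop
  have h0 : (A - (0 : ℝ) • B).det ≠ 0 := by simpa using hA.ne_zero
  have hev : ∀ᶠ s : ℝ in 𝓝 0, (A - s • B).det ≠ 0 := hdet.continuousAt.eventually_ne h0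
  have hinv : ContinuousAt (fun s : ℝ => (A - s • B)⁻¹) 0 := by
    simp only [Matrix.inv_def, Ring.inverse_eq_inv']
    refine (hdet.continuousAt.inv₀ h0).smul (Continuous.continuousAt ?_)
    refine Continuous.matrix_adjugate ?_
    fun_prop
  rw [hasDerivAt_iff_tendsto_slope_zero]
  have hlim : Tendsto (fun s : ℝ => ((A - s • B)⁻¹ * (B * A⁻¹ * C)).trace) (𝓝[≠] 0)
      (𝓝 ((A⁻¹ * B * A⁻¹ * C).trace)) := by
    have h1 : ContinuousAt (fun s : ℝ => ((A - s • B)⁻¹ * (B * A⁻¹ * C)).trace) 0 := by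
      refine ContinuousAt.comp (g := Matrix.trace) (Continuous.continuousAt ?_) ?_
      · exact continuous_id.matrix_trace
      · exact ContinuousAt.mul hinv continuousAt_const
    have h2 := h1.tendsto.mono_left (nhdsWithin_le_nhds (s := {0}ᶜ))
    simpa [mul_assoc] using h2
  refine hlim.congr' ?_
  filter_upwards [hev.filter_mono nhdsWithin_le_nhds, self_mem_nhdsWithin] with s hs hs0
  have hs0' : s ≠ 0 := hs0
  have e : (A - s • B)⁻¹ - A⁻¹ = s • ((A - s • B)⁻¹ * (B * A⁻¹)) := by
    have e1 : (A - s • B)⁻¹ * (A - (A - s • B)) * A⁻¹ = (A - s • B)⁻¹ - A⁻¹ := by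
      rw [mul_sub, sub_mul, Matrix.nonsing_inv_mul _ hs.isUnit, one_mul, mul_assoc,
        Matrix.mul_nonsing_inv _ hA, mul_one]
    rw [← e1, sub_sub_cancel, Matrix.mul_smul, Matrix.smul_mul, mul_assoc]
  rw [zero_add, zero_smul, sub_zero, ← Matrix.trace_sub, ← sub_mul, e, Matrix.smul_mul,
    Matrix.trace_smul, smul_smul, inv_mul_cancel₀ hs0', one_smul]
  simp only [mul_assoc]

section Linear

variable {n T d : ℕ}

lemma lamPart_add_smul (θ v : Fin (d + 1) → ℝ) (s : ℝ) :
    lamPart (θ + s • v) = lamPart θ + s • lamPart v := rfl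

lemma varPart_add_smul (θ v : Fin (d + 1) → ℝ) (s : ℝ) :
    varPart (θ + s • v) = varPart θ + s * varPart v := rfl

lemma lamPart_add (v v' : Fin (d + 1) → ℝ) : lamPart (v + v') = lamPart v + lamPart v' := rfl

lemma varPart_add (v v' : Fin (d + 1) → ℝ) : varPart (v + v') = varPart v + varPart v' := rfl

lemma lamPart_smul (c : ℝ) (v : Fin (d + 1) → ℝ) : lamPart (c • v) = c • lamPart v := rfl

lemma varPart_smul (c : ℝ) (v : Fin (d + 1) → ℝ) : varPart (c • v) = c * varPart v := rfl

lemma formSum_add (s : ℝ) (A B : Fin T → Matrix (Fin n) (Fin n) ℝ) (x : Fin T → Fin n → ℝ) :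
    formSum s (fun t => A t + B t) x = formSum s A x + formSum s B x := by
  simp only [formSum, centredForm, Matrix.add_mulVec, dotProduct_add, Matrix.trace_add,
    ← Finset.sum_add_distrib]
  exact Finset.sum_congr rfl fun t _ => by ring

lemma formSum_smul (s c : ℝ) (A : Fin T → Matrix (Fin n) (Fin n) ℝ) (x : Fin T → Fin n → ℝ) :
    formSum s (fun t => c • A t) x = c * formSum s A x := by
  simp only [formSum, centredForm, Matrix.smul_mulVec, dotProduct_smul, Matrix.trace_smul,
    smul_eq_mul, Finset.mul_sum]
  exact Finset.sum_congr rfl fun t _ => by ring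

/-- A bilinear form is determined by its values at the unit vectors. -/
lemma dotProduct_of_mulVec {p : ℕ} (f : (Fin p → ℝ) → (Fin p → ℝ) → ℝ)
    (hal : ∀ u u' v, f (u + u') v = f u v + f u' v) (hsl : ∀ (c : ℝ) u v, f (c • u) v = c * f u v)
    (har : ∀ u v v', f u (v + v') = f u v + f u v') (hsr : ∀ (c : ℝ) u v, f u (c • v) = c * f u v)
    (u v : Fin p → ℝ) :
    u ⬝ᵥ (Matrix.of (fun k l => f (Pi.single k 1) (Pi.single l 1)) *ᵥ v) = f u v := by
  have e : Matrix.of (fun k l => f (Pi.single k 1) (Pi.single l 1))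
      = LinearMap.toMatrix₂' ℝ (LinearMap.mk₂ ℝ f hal hsl har hsr) := by
    ext k l
    simp [LinearMap.toMatrix₂'_apply]
  rw [e, ← Matrix.toLinearMap₂'_apply', Matrix.toLinearMap₂'_toMatrix', LinearMap.mk₂_apply]

end Linear

section Derivatives

variable {n T d : ℕ} (W : Fin T → Fin d → Matrix (Fin n) (Fin n) ℝ) (Y : Fin T → Fin n → ℝ)

/-- The derivative of the quasi-loglikelihood at `θ` in the direction `v`. -/
noncomputable def scoreAt (θ v : Fin (d + 1) → ℝ) : ℝ :=
  -∑ t, ((delta (W t) (lamPart θ))⁻¹ * influence (W t) (lamPart v)).trace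
    + (∑ t, (delta (W t) (lamPart θ) *ᵥ Y t) ⬝ᵥ (influence (W t) (lamPart v) *ᵥ Y t)) / varPart θ
    + varPart v * (rss W Y (lamPart θ) / (2 * varPart θ ^ 2) - n * T / (2 * varPart θ))

variable {W}

lemma hasDerivAt_quasiLogLik {θ : Fin (d + 1) → ℝ}
    (hdet : ∀ t, IsUnit (delta (W t) (lamPart θ)).det) (hvar : 0 < varPart θ)
    (v : Fin (d + 1) → ℝ) :
    HasDerivAt (fun s : ℝ => quasiLogLik W Y (θ + s • v)) (scoreAt W Y θ v) 0 := by
  simp only [quasiLogLik, lamPart_add_smul, varPart_add_smul]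
  have hσ : HasDerivAt (fun s : ℝ => varPart θ + s * varPart v) (varPart v) 0 := by
    simpa using ((hasDerivAt_id (0 : ℝ)).mul_const (varPart v)).const_add (varPart θ)
  have hne : varPart θ + 0 * varPart v ≠ 0 := by simpa using hvar.ne'
  have h1 := (hσ.log hne).const_mul ((n : ℝ) * T / 2)
  have h2 := ((hσ.const_mul 2).fun_inv (by simpa using hvar.ne')).fun_mul
    (hasDerivAt_rss W Y (lamPart θ) (lamPart v))
  have h3 := ((h1.const_sub (-((n : ℝ) * T / 2) * Real.log (2 * Real.pi))).fun_add
    (hasDerivAt_sum_log_abs_det W hdet (lamPart v))).fun_sub h2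
  simp only [one_div]
  refine h3.congr_deriv ?_
  simp only [zero_mul, add_zero, zero_smul, scoreAt]
  field_simp
  ring

lemma hasDerivAt_scoreAt {θ : Fin (d + 1) → ℝ}
    (hdet : ∀ t, IsUnit (delta (W t) (lamPart θ)).det) (hvar : 0 < varPart θ)
    (u v : Fin (d + 1) → ℝ) :
    HasDerivAt (fun s : ℝ => scoreAt W Y (θ + s • u) v)
      (-∑ t, ((delta (W t) (lamPart θ))⁻¹ * influence (W t) (lamPart u)
          * (delta (W t) (lamPart θ))⁻¹ * influence (W t) (lamPart v)).trace
        - (∑ t, (influence (W t) (lamPart u) *ᵥ Y t) ⬝ᵥ (influence (W t) (lamPart v) *ᵥ Y t))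
          / varPart θ
        - varPart u * (∑ t, (delta (W t) (lamPart θ) *ᵥ Y t) ⬝ᵥ
          (influence (W t) (lamPart v) *ᵥ Y t)) / varPart θ ^ 2
        - varPart v * (∑ t, (delta (W t) (lamPart θ) *ᵥ Y t) ⬝ᵥ
          (influence (W t) (lamPart u) *ᵥ Y t)) / varPart θ ^ 2
        - varPart u * varPart v * (rss W Y (lamPart θ) / varPart θ ^ 3
          - n * T / (2 * varPart θ ^ 2))) 0 := by
  simp only [scoreAt, lamPart_add_smul, varPart_add_smul]
  have hσ : HasDerivAt (fun s : ℝ => varPart θ + s * varPart u) (varPart u) 0 := by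
    simpa using ((hasDerivAt_id (0 : ℝ)).mul_const (varPart u)).const_add (varPart θ)
  have hne : varPart θ + 0 * varPart u ≠ 0 := by simpa using hvar.ne'
  have h1 : HasDerivAt (fun s : ℝ => ∑ t, ((delta (W t) (lamPart θ + s • lamPart u))⁻¹
      * influence (W t) (lamPart v)).trace)
      (∑ t, ((delta (W t) (lamPart θ))⁻¹ * influence (W t) (lamPart u)
          * (delta (W t) (lamPart θ))⁻¹ * influence (W t) (lamPart v)).trace) 0 := by
    refine HasDerivAt.fun_sum fun t _ => ?_
    refine (hasDerivAt_trace_inv (influence (W t) (lamPart u)) (influence (W t) (lamPart v))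
      (hdet t)).congr_of_eventuallyEq ?_
    refine Eventually.of_forall fun s => ?_
    have e := delta_add_smul (W t) (lamPart θ) (lamPart u) s
    simp only [e]
  have h2 : HasDerivAt (fun s : ℝ => ∑ t, (delta (W t) (lamPart θ + s • lamPart u) *ᵥ Y t) ⬝ᵥ
      (influence (W t) (lamPart v) *ᵥ Y t))
      (-∑ t, (influence (W t) (lamPart u) *ᵥ Y t) ⬝ᵥ (influence (W t) (lamPart v) *ᵥ Y t)) 0 := by
    rw [← Finset.sum_neg_distrib]
    refine HasDerivAt.fun_sum fun t _ => ?_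
    have e : (fun s : ℝ => (delta (W t) (lamPart θ + s • lamPart u) *ᵥ Y t) ⬝ᵥ
        (influence (W t) (lamPart v) *ᵥ Y t)) = fun s : ℝ =>
        (delta (W t) (lamPart θ) *ᵥ Y t) ⬝ᵥ (influence (W t) (lamPart v) *ᵥ Y t)
          - s * ((influence (W t) (lamPart u) *ᵥ Y t) ⬝ᵥ (influence (W t) (lamPart v) *ᵥ Y t)) := by
      funext s
      rw [delta_add_smul, Matrix.sub_mulVec, Matrix.smul_mulVec, sub_dotProduct, smul_dotProduct,
        smul_eq_mul]
    rw [e]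
    simpa using ((hasDerivAt_id (0 : ℝ)).mul_const ((influence (W t) (lamPart u) *ᵥ Y t) ⬝ᵥ
      (influence (W t) (lamPart v) *ᵥ Y t))).const_sub
      ((delta (W t) (lamPart θ) *ᵥ Y t) ⬝ᵥ (influence (W t) (lamPart v) *ᵥ Y t))
  have h3 := h2.fun_div hσ hne
  have h4 := (hasDerivAt_rss W Y (lamPart θ) (lamPart u)).fun_div ((hσ.fun_pow 2).const_mul 2)
    (by simpa using hvar.ne')
  have h5 := (hasDerivAt_const (0 : ℝ) ((n : ℝ) * T)).fun_div (hσ.const_mul 2)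
    (by simpa using hvar.ne')
  have h6 := (h1.fun_neg.fun_add h3).fun_add ((h4.fun_sub h5).const_mul (varPart v))
  refine h6.congr_deriv ?_
  simp only [zero_mul, add_zero, zero_smul]
  field_simp
  ring

end Derivatives

section Linear

variable {n T d : ℕ} (U : Fin T → Fin d → Matrix (Fin n) (Fin n) ℝ) (s : ℝ)

/-- The matrices of the quadratic forms in the errors that make up the score in the
direction `v`. -/
noncomputable def scoreMat (v : Fin (d + 1) → ℝ) (t : Fin T) : Matrix (Fin n) (Fin n) ℝ :=
  s⁻¹ • influence (U t) (lamPart v) + (varPart v / (2 * s ^ 2)) • 1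

/-- The matrices of the quadratic forms in the errors that make up the second derivative of the
quasi-loglikelihood in the directions `u` and `v`. -/
noncomputable def hessMat (u v : Fin (d + 1) → ℝ) (t : Fin T) : Matrix (Fin n) (Fin n) ℝ :=
  (-s⁻¹) • ((influence (U t) (lamPart u))ᵀ * influence (U t) (lamPart v))
    + (-(varPart u / s ^ 2)) • influence (U t) (lamPart v)
    + (-(varPart v / s ^ 2)) • influence (U t) (lamPart u)
    + (-(varPart u * varPart v / s ^ 3)) • 1

lemma scoreMat_add (v v' : Fin (d + 1) → ℝ) (t : Fin T) :
    scoreMat U s (v + v') t = scoreMat U s v t + scoreMat U s v' t := by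
  simp only [scoreMat, lamPart_add, varPart_add, influence_add, add_div, add_smul, smul_add]
  abel

lemma scoreMat_smul (c : ℝ) (v : Fin (d + 1) → ℝ) (t : Fin T) :
    scoreMat U s (c • v) t = c • scoreMat U s v t := by
  simp only [scoreMat, lamPart_smul, varPart_smul, influence_smul, smul_add, smul_smul]
  congr 2 <;> ring

variable {U} in
lemma SumBdd.scoreMat {a : ℝ} (hU : ∀ t k, SumBdd (U t k) a) (hs : 0 < s) (v : Fin (d + 1) → ℝ)
    (t : Fin T) :
    SumBdd (scoreMat U s v t) (s⁻¹ * (a * l1Norm (lamPart v)) + |varPart v| / (2 * s ^ 2)) := by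
  have h1 := ((SumBdd.influence (hU t) (lamPart v)).smul s⁻¹).add
    ((SumBdd.one (p := n)).smul (varPart v / (2 * s ^ 2)))
  refine h1.mono (le_of_eq ?_)
  rw [abs_of_pos (inv_pos.2 hs), abs_div, abs_of_pos (by positivity : 0 < 2 * s ^ 2), mul_one]

lemma formSum_scoreMat_add (v v' : Fin (d + 1) → ℝ) (x : Fin T → Fin n → ℝ) :
    formSum s (scoreMat U s (v + v')) x
      = formSum s (scoreMat U s v) x + formSum s (scoreMat U s v') x := by
  rw [← formSum_add]
  congr 1
  funext t
  rw [scoreMat_add]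

lemma formSum_scoreMat_smul (c : ℝ) (v : Fin (d + 1) → ℝ) (x : Fin T → Fin n → ℝ) :
    formSum s (scoreMat U s (c • v)) x = c * formSum s (scoreMat U s v) x := by
  rw [← formSum_smul]
  congr 1
  funext t
  rw [scoreMat_smul]

lemma centredForm_scoreMat (hs : s ≠ 0) (v : Fin (d + 1) → ℝ) (t : Fin T) (x : Fin n → ℝ) :
    centredForm s (scoreMat U s v t) x = s⁻¹ * (x ⬝ᵥ (influence (U t) (lamPart v) *ᵥ x))
      - (influence (U t) (lamPart v)).trace + varPart v / (2 * s ^ 2) * (x ⬝ᵥ x)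
      - varPart v / (2 * s) * n := by
  simp only [centredForm, scoreMat, Matrix.add_mulVec, Matrix.smul_mulVec, Matrix.one_mulVec,
    dotProduct_add, dotProduct_smul, Matrix.trace_add, Matrix.trace_smul, smul_eq_mul,
    Matrix.trace_one, Fintype.card_fin]
  field_simp
  ring

lemma mul_scoreForm (hN : ((n : ℝ) * T) ≠ 0) (hs : s ≠ 0) (v : Fin (d + 1) → ℝ)
    (y : Fin T → Fin n → ℝ) :
    (n : ℝ) * T * scoreForm U y s (lamPart v) (varPart v) = formSum s (scoreMat U s v) y := by
  simp only [formSum, centredForm_scoreMat U s hs, Finset.sum_add_distrib, Finset.sum_sub_distrib,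
    ← Finset.mul_sum, Finset.sum_const, Finset.card_univ, Fintype.card_fin, nsmul_eq_mul]
  simp only [scoreForm, linForm, traceForm, meanSq, avg]
  generalize (∑ t, y t ⬝ᵥ (influence (U t) (lamPart v) *ᵥ y t)) = p
  generalize (∑ t, (influence (U t) (lamPart v)).trace) = q
  generalize (∑ t, y t ⬝ᵥ y t) = m
  rw [mul_comm (T : ℝ) n]
  generalize (n : ℝ) * T = N at hN ⊢
  field_simp
  ring

lemma traceForm_add (x z : Fin d → ℝ) : traceForm U (x + z) = traceForm U x + traceForm U z := by
  simp only [traceForm, influence_add, Matrix.trace_add, avg_add]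

lemma traceForm_smul (c : ℝ) (x : Fin d → ℝ) : traceForm U (c • x) = c * traceForm U x := by
  simp only [traceForm, influence_smul, Matrix.trace_smul, smul_eq_mul, avg_const_mul]

/-- The information matrix as a bilinear form on parameter vectors. -/
lemma dotProduct_infoForm_mulVec (u v : Fin (d + 1) → ℝ) :
    u ⬝ᵥ (Matrix.of (fun k l => infoForm U s (lamPart (Pi.single k 1)) (varPart (Pi.single k 1))
      (lamPart (Pi.single l 1)) (varPart (Pi.single l 1))) *ᵥ v)
      = infoForm U s (lamPart u) (varPart u) (lamPart v) (varPart v) := by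
  refine dotProduct_of_mulVec (fun u v => infoForm U s (lamPart u) (varPart u) (lamPart v)
    (varPart v)) ?_ ?_ ?_ ?_ u v
  · intro u u' v
    simp only [infoForm, lamPart_add, varPart_add, traceForm_add, traceGram, traceProd,
      influence_add, Matrix.transpose_add, add_mul, Matrix.trace_add, avg_add]
    ring
  · intro c u v
    simp only [infoForm, lamPart_smul, varPart_smul, traceForm_smul, traceGram, traceProd,
      influence_smul, Matrix.transpose_smul, Matrix.smul_mul, Matrix.trace_smul, smul_eq_mul,
      avg_const_mul]
    ring
  · intro u v v'
    simp only [infoForm, lamPart_add, varPart_add, traceForm_add, traceGram, traceProd,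
      influence_add, mul_add, Matrix.trace_add, avg_add]
    ring
  · intro c u v
    simp only [infoForm, lamPart_smul, varPart_smul, traceForm_smul, traceGram, traceProd,
      influence_smul, Matrix.mul_smul, Matrix.trace_smul, smul_eq_mul, avg_const_mul]
    ring

end Linear

section Model

variable {n T d : ℕ} {W : Fin T → Fin d → Matrix (Fin n) (Fin n) ℝ} {Y y : Fin T → Fin n → ℝ}
  {lam0 : Fin d → ℝ} {s r₀ : ℝ}

/-- The score at the true parameter is a sum of centred quadratic forms in the errors. -/
lemma scoreAt_true (h0 : ∀ t, IsUnit (delta (W t) lam0).det)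
    (hy : ∀ t, delta (W t) lam0 *ᵥ Y t = y t) (hs : s ≠ 0) (v : Fin (d + 1) → ℝ) :
    scoreAt W Y (mkParam lam0 s) v = formSum s (scoreMat (whiten W lam0) s v) y := by
  simp only [scoreAt, lamPart_mkParam, varPart_mkParam, rss_eq, hy, influence_mulVec h0 hy]
  have e1 : ∀ t, ((delta (W t) lam0)⁻¹ * influence (W t) (lamPart v)).trace
      = (influence (whiten W lam0 t) (lamPart v)).trace := by
    intro t
    rw [influence_whiten, Matrix.trace_mul_comm]
  simp only [formSum, centredForm_scoreMat _ s hs, e1, Finset.sum_add_distrib,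
    Finset.sum_sub_distrib, ← Finset.mul_sum,
    Finset.sum_const, Finset.card_univ, Fintype.card_fin, nsmul_eq_mul]
  field_simp
  ring

lemma partialD_quasiLogLik {θ : Fin (d + 1) → ℝ}
    (hdet : ∀ t, IsUnit (delta (W t) (lamPart θ)).det) (hvar : 0 < varPart θ) (k : Fin (d + 1)) :
    partialD (quasiLogLik W Y) k θ = scoreAt W Y θ (Pi.single k 1) :=
  (hasDerivAt_quasiLogLik Y hdet hvar _).deriv

/-- The second derivatives at the true parameter are a sum of centred quadratic forms in the errors
plus their expectation, the negative information. -/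
lemma partialD_partialD_quasiLogLik (hr : 0 < r₀)
    (hunit : ∀ lam, l1Norm (lam - lam0) < r₀ → ∀ t, IsUnit (delta (W t) lam).det)
    (hy : ∀ t, delta (W t) lam0 *ᵥ Y t = y t) (hs : 0 < s) (k l : Fin (d + 1)) :
    partialD (partialD (quasiLogLik W Y) l) k (mkParam lam0 s)
      = formSum s (hessMat (whiten W lam0) s (Pi.single k 1) (Pi.single l 1)) y
        - (n : ℝ) * T * infoForm (whiten W lam0) s (lamPart (Pi.single k 1))
          (varPart (Pi.single k 1)) (lamPart (Pi.single l 1)) (varPart (Pi.single l 1)) := by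
  have hdet0 : ∀ t, IsUnit (delta (W t) lam0).det := by
    refine hunit lam0 ?_
    have : l1Norm (lam0 - lam0) = 0 := by simp [l1Norm]
    rwa [this]
  set u : Fin (d + 1) → ℝ := Pi.single k 1 with hu
  set v : Fin (d + 1) → ℝ := Pi.single l 1 with hv
  have hd := hasDerivAt_scoreAt Y (θ := mkParam lam0 s) (by simpa using hdet0)
    (by simpa using hs) u v
  have hev : (fun h : ℝ => partialD (quasiLogLik W Y) l (mkParam lam0 s + h • u)) =ᶠ[𝓝 0]
      fun h => scoreAt W Y (mkParam lam0 s + h • u) v := by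
    have h1 : ∀ᶠ h : ℝ in 𝓝 0, l1Norm (h • lamPart u) < r₀ := by
      have hc : Continuous fun h : ℝ => l1Norm (h • lamPart u) :=
        continuous_l1Norm.comp (by fun_prop)
      exact hc.continuousAt.eventually_lt continuousAt_const (by simpa [l1Norm] using hr)
    have h2 : ∀ᶠ h : ℝ in 𝓝 0, 0 < s + h * varPart u := by
      have hc : Continuous fun h : ℝ => s + h * varPart u := by fun_prop
      exact continuousAt_const.eventually_lt hc.continuousAt (by simpa using hs)
    filter_upwards [h1, h2] with h hh1 hh2
    refine partialD_quasiLogLik ?_ ?_ l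
    · rw [lamPart_add_smul, lamPart_mkParam]
      exact hunit _ (by simpa using hh1)
    · rw [varPart_add_smul, varPart_mkParam]; exact hh2
  rw [partialD, lineDeriv, hev.deriv_eq, hd.deriv]
  simp only [lamPart_mkParam, varPart_mkParam, rss_eq, hy, influence_mulVec hdet0 hy]
  have e1 : ∀ t, ((delta (W t) lam0)⁻¹ * influence (W t) (lamPart u) * (delta (W t) lam0)⁻¹
      * influence (W t) (lamPart v)).trace
      = (influence (whiten W lam0 t) (lamPart u)
        * influence (whiten W lam0 t) (lamPart v)).trace := by
    intro t
    rw [influence_whiten, influence_whiten, mul_assoc, mul_assoc, Matrix.trace_mul_comm]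
    simp only [mul_assoc]
  have e : ∀ t, centredForm s (hessMat (whiten W lam0) s u v t) (y t)
      = (-s⁻¹) * ((influence (whiten W lam0 t) (lamPart u) *ᵥ y t) ⬝ᵥ
          (influence (whiten W lam0 t) (lamPart v) *ᵥ y t))
        - varPart u / s ^ 2 * (y t ⬝ᵥ (influence (whiten W lam0 t) (lamPart v) *ᵥ y t))
        - varPart v / s ^ 2 * (y t ⬝ᵥ (influence (whiten W lam0 t) (lamPart u) *ᵥ y t))
        - varPart u * varPart v / s ^ 3 * (y t ⬝ᵥ y t)
        + ((influence (whiten W lam0 t) (lamPart u))ᵀ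
          * influence (whiten W lam0 t) (lamPart v)).trace
        + varPart u / s * (influence (whiten W lam0 t) (lamPart v)).trace
        + varPart v / s * (influence (whiten W lam0 t) (lamPart u)).trace
        + varPart u * varPart v / s ^ 2 * n := by
    intro t
    have eg : y t ⬝ᵥ (((influence (whiten W lam0 t) (lamPart u))ᵀ
        * influence (whiten W lam0 t) (lamPart v)) *ᵥ y t)
        = (influence (whiten W lam0 t) (lamPart u) *ᵥ y t) ⬝ᵥ
          (influence (whiten W lam0 t) (lamPart v) *ᵥ y t) := by
      rw [← Matrix.mulVec_mulVec, Matrix.dotProduct_mulVec, Matrix.vecMul_transpose]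
    simp only [centredForm, hessMat, Matrix.add_mulVec, Matrix.smul_mulVec, Matrix.one_mulVec,
      dotProduct_add, dotProduct_smul, Matrix.trace_add, Matrix.trace_smul, smul_eq_mul,
      Matrix.trace_one, Fintype.card_fin, eg]
    field_simp
    ring
  simp only [formSum, e, e1, Finset.sum_add_distrib, Finset.sum_sub_distrib, ← Finset.mul_sum,
    Finset.sum_const, Finset.card_univ, Fintype.card_fin, nsmul_eq_mul]
  rcases eq_or_ne ((n : ℝ) * T) 0 with hN | hN
  · rcases mul_eq_zero.1 hN with h | h
    · obtain rfl : n = 0 := by exact_mod_cast h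
      simp [Matrix.trace, dotProduct]
    · obtain rfl : T = 0 := by exact_mod_cast h
      simp
  · simp only [infoForm, traceGram, traceProd, traceForm, avg]
    generalize (∑ t, y t ⬝ᵥ (influence (whiten W lam0 t) (lamPart v) *ᵥ y t)) = p1
    generalize (∑ t, y t ⬝ᵥ (influence (whiten W lam0 t) (lamPart u) *ᵥ y t)) = p2
    generalize (∑ t, (influence (whiten W lam0 t) (lamPart u) *ᵥ y t) ⬝ᵥ
          (influence (whiten W lam0 t) (lamPart v) *ᵥ y t)) = p3
    generalize (∑ t, (influence (whiten W lam0 t) (lamPart v)).trace) = q1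
    generalize (∑ t, (influence (whiten W lam0 t) (lamPart u)).trace) = q2
    generalize (∑ t, ((influence (whiten W lam0 t) (lamPart u))ᵀ
      * influence (whiten W lam0 t) (lamPart v)).trace) = q3
    generalize (∑ t, (influence (whiten W lam0 t) (lamPart u)
      * influence (whiten W lam0 t) (lamPart v)).trace) = q4
    generalize (∑ t, y t ⬝ᵥ y t) = m
    rw [mul_comm (T : ℝ) n]
    generalize (n : ℝ) * T = N at hN ⊢
    field_simp
    ring

variable {Ω : Type*} [mΩ : MeasurableSpace Ω] {μ : Measure Ω} [IsProbabilityMeasure μ]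
  {ε Z : Ω → Fin T → Fin n → ℝ} {K : ℝ}

/-- The information matrix of the model. -/
lemma dotProduct_infoMat_mulVec (herr : ErrorCond μ ε s K) (hr : 0 < r₀)
    (hunit : ∀ lam, l1Norm (lam - lam0) < r₀ → ∀ t, IsUnit (delta (W t) lam).det)
    (hy : ∀ ω t, delta (W t) lam0 *ᵥ Z ω t = ε ω t) (hs : 0 < s) (hN : ((n : ℝ) * T) ≠ 0)
    (u v : Fin (d + 1) → ℝ) :
    u ⬝ᵥ (infoMat μ W Z (mkParam lam0 s) *ᵥ v)
      = infoForm (whiten W lam0) s (lamPart u) (varPart u) (lamPart v) (varPart v) := by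
  rw [← dotProduct_infoForm_mulVec]
  congr 2
  ext k l
  simp only [infoMat, Matrix.of_apply]
  simp only [fun ω => partialD_partialD_quasiLogLik hr hunit (hy ω) hs k l]
  rw [integral_sub (herr.hasMoments_formSum _).integrable (integrable_const _),
    herr.integral_formSum, integral_const]
  simp only [probReal_univ, one_smul, zero_sub]
  generalize (n : ℝ) * T = N at hN ⊢
  field_simp

/-- The covariance matrix of the score. -/
lemma dotProduct_scoreVar_mulVec (herr : ErrorCond μ ε s K)
    (h0 : ∀ t, IsUnit (delta (W t) lam0).det)
    (hy : ∀ ω t, delta (W t) lam0 *ᵥ Z ω t = ε ω t) (hs : 0 < s) (v : Fin (d + 1) → ℝ) :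
    v ⬝ᵥ (scoreVar μ W Z (mkParam lam0 s) *ᵥ v)
      = ((n : ℝ) * T)⁻¹ * ∫ ω, formSum s (scoreMat (whiten W lam0) s v) (ε ω) ^ 2 ∂μ := by
  have hmem : ∀ v, MemLp (fun ω => formSum s (scoreMat (whiten W lam0) s v) (ε ω)) 2 μ :=
    fun v => herr.hasMoments_formSum _ 2 (by norm_num)
  have e : scoreVar μ W Z (mkParam lam0 s) = Matrix.of fun k l => ((n : ℝ) * T)⁻¹ *
      cov[fun ω => formSum s (scoreMat (whiten W lam0) s (Pi.single k 1)) (ε ω),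
        fun ω => formSum s (scoreMat (whiten W lam0) s (Pi.single l 1)) (ε ω); μ] := by
    ext k l
    simp only [scoreVar, Matrix.of_apply]
    have : ∀ ω k, partialD (quasiLogLik W (Z ω)) k (mkParam lam0 s)
        = formSum s (scoreMat (whiten W lam0) s (Pi.single k 1)) (ε ω) := by
      intro ω k
      rw [partialD_quasiLogLik (by simpa using h0) (by simpa using hs),
        scoreAt_true h0 (hy ω) hs.ne']
    simp only [this]
  rw [e, dotProduct_of_mulVec (fun u v => ((n : ℝ) * T)⁻¹ *
      cov[fun ω => formSum s (scoreMat (whiten W lam0) s u) (ε ω),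
        fun ω => formSum s (scoreMat (whiten W lam0) s v) (ε ω); μ])]
  · rw [covariance_self (hmem v).aemeasurable, variance_of_integral_eq_zero (hmem v).aemeasurable
      (herr.integral_formSum _)]
  · intro u u' v
    simp only [formSum_scoreMat_add]
    rw [← mul_add]
    congr 1
    exact covariance_add_left (hmem u) (hmem u') (hmem v)
  · intro c u v
    simp only [formSum_scoreMat_smul]
    have := covariance_const_mul_left (μ := μ)
      (X := fun ω => formSum s (scoreMat (whiten W lam0) s u) (ε ω))
      (Y := fun ω => formSum s (scoreMat (whiten W lam0) s v) (ε ω)) c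
    rw [this]; ring
  · intro u v v'
    simp only [formSum_scoreMat_add]
    rw [← mul_add]
    congr 1
    exact covariance_add_right (hmem u) (hmem v) (hmem v')
  · intro c u v
    simp only [formSum_scoreMat_smul]
    have := covariance_const_mul_right (μ := μ)
      (X := fun ω => formSum s (scoreMat (whiten W lam0) s u) (ε ω))
      (Y := fun ω => formSum s (scoreMat (whiten W lam0) s v) (ε ω)) c
    rw [this]; ring

end Model

/-! ### Matrix norms -/

lemma specNorm_nonneg {p q : ℕ} (A : Matrix (Fin p) (Fin q) ℝ) : 0 ≤ specNorm A := norm_nonneg _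

lemma frobNorm_nonneg {p q : ℕ} (A : Matrix (Fin p) (Fin q) ℝ) : 0 ≤ frobNorm A :=
  Real.sqrt_nonneg _

lemma l2Norm_eq_norm {p : ℕ} (x : Fin p → ℝ) : l2Norm x = ‖WithLp.toLp 2 x‖ := by
  rw [l2Norm, EuclideanSpace.norm_eq]
  simp

lemma dotProduct_self_eq {p : ℕ} (x : Fin p → ℝ) : x ⬝ᵥ x = l2Norm x ^ 2 := by
  rw [l2Norm_sq, dotProduct]
  exact Finset.sum_congr rfl fun k _ => by ring

lemma abs_dotProduct_le {p : ℕ} (x z : Fin p → ℝ) : |x ⬝ᵥ z| ≤ l2Norm x * l2Norm z :=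
  sum_mul_le_l2Norm x z

lemma l2Norm_mulVec_le {p q : ℕ} (A : Matrix (Fin p) (Fin q) ℝ) (x : Fin q → ℝ) :
    l2Norm (A *ᵥ x) ≤ specNorm A * l2Norm x := by
  have h := (LinearMap.toContinuousLinearMap (Matrix.toEuclideanLin A)).le_opNorm (WithLp.toLp 2 x)
  rw [l2Norm_eq_norm, l2Norm_eq_norm]
  simpa [specNorm, Matrix.toLpLin_toLp] using h

lemma l2Norm_transpose_mulVec_le {p q : ℕ} (A : Matrix (Fin p) (Fin q) ℝ) (x : Fin p → ℝ) :
    l2Norm (Aᵀ *ᵥ x) ≤ specNorm A * l2Norm x := by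
  have h1 : l2Norm (Aᵀ *ᵥ x) ^ 2 ≤ (specNorm A * l2Norm x) * l2Norm (Aᵀ *ᵥ x) := by
    have e : l2Norm (Aᵀ *ᵥ x) ^ 2 = x ⬝ᵥ (A *ᵥ (Aᵀ *ᵥ x)) := by
      rw [← dotProduct_self_eq, Matrix.dotProduct_mulVec x A, Matrix.mulVec_transpose]
    rw [e]
    calc _ ≤ l2Norm x * l2Norm (A *ᵥ (Aᵀ *ᵥ x)) := (le_abs_self _).trans (abs_dotProduct_le _ _)
      _ ≤ l2Norm x * (specNorm A * l2Norm (Aᵀ *ᵥ x)) := by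
        have := l2Norm_mulVec_le A (Aᵀ *ᵥ x)
        have := l2Norm_nonneg x
        gcongr
      _ = _ := by ring
  rcases (l2Norm_nonneg (Aᵀ *ᵥ x)).eq_or_lt with h0 | h0
  · rw [← h0]; exact mul_nonneg (specNorm_nonneg A) (l2Norm_nonneg x)
  · rw [sq] at h1; exact le_of_mul_le_mul_right h1 h0

lemma frobNorm_sq {p q : ℕ} (A : Matrix (Fin p) (Fin q) ℝ) :
    frobNorm A ^ 2 = ∑ i, ∑ j, A i j ^ 2 := by
  have e : (Aᵀ * A).trace = ∑ i, ∑ j, A i j ^ 2 := by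
    rw [Finset.sum_comm]
    simp only [Matrix.trace, Matrix.diag_apply, Matrix.mul_apply, Matrix.transpose_apply, sq]
  rw [frobNorm, Real.sq_sqrt, e]
  rw [e]
  positivity

/-- A bilinear form is bounded by the Euclidean norm of its coefficients. -/
lemma abs_sum_sum_mul_le {p q : ℕ} {F : Fin p → Fin q → ℝ} {b : ℝ} (hb : 0 ≤ b)
    (h : ∑ i, ∑ j, F i j ^ 2 ≤ b ^ 2) (x : Fin p → ℝ) (z : Fin q → ℝ) :
    |∑ i, ∑ j, x i * z j * F i j| ≤ b * l2Norm x * l2Norm z := by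
  have h1 : (∑ k : Fin p × Fin q, (x k.1 * z k.2) * F k.1 k.2) ^ 2
      ≤ (∑ k : Fin p × Fin q, (x k.1 * z k.2) ^ 2) * ∑ k : Fin p × Fin q, F k.1 k.2 ^ 2 :=
    Finset.sum_mul_sq_le_sq_mul_sq _ _ _
  have e1 : ∑ k : Fin p × Fin q, (x k.1 * z k.2) ^ 2 = (l2Norm x * l2Norm z) ^ 2 := by
    rw [mul_pow, l2Norm_sq, l2Norm_sq, Finset.sum_mul_sum, Fintype.sum_prod_type]
    simp only [mul_pow]
  rw [e1, Fintype.sum_prod_type, Fintype.sum_prod_type] at h1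
  have h2 := h1.trans (mul_le_mul_of_nonneg_left h (sq_nonneg _))
  rw [← mul_pow] at h2
  have h3 := abs_le_of_sq_le_sq h2
    (mul_nonneg (mul_nonneg (l2Norm_nonneg x) (l2Norm_nonneg z)) hb)
  have h4 : l2Norm x * l2Norm z * b = b * l2Norm x * l2Norm z := by ring
  rw [← h4]
  exact h3

lemma abs_dotProduct_mulVec_le_frobNorm {p : ℕ} (A : Matrix (Fin p) (Fin p) ℝ)
    (x z : Fin p → ℝ) : |x ⬝ᵥ (A *ᵥ z)| ≤ frobNorm A * l2Norm x * l2Norm z := by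
  have e : x ⬝ᵥ (A *ᵥ z) = ∑ i, ∑ j, x i * z j * A i j := by
    simp only [dotProduct, Matrix.mulVec, Finset.mul_sum]
    exact Finset.sum_congr rfl fun i _ => Finset.sum_congr rfl fun j _ => by ring
  rw [e]
  exact abs_sum_sum_mul_le (frobNorm_nonneg A) (frobNorm_sq A).ge x z

lemma abs_dotProduct_mulVec_le_specNorm {p : ℕ} (A : Matrix (Fin p) (Fin p) ℝ) (x : Fin p → ℝ) :
    |x ⬝ᵥ (A *ᵥ x)| ≤ specNorm A * l2Norm x ^ 2 := by
  refine (abs_dotProduct_le _ _).trans ?_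
  have := mul_le_mul_of_nonneg_left (l2Norm_mulVec_le A x) (l2Norm_nonneg x)
  linarith

/-! ### Consequences of the conditions on the weights -/

lemma rowSumNorm_nonneg {p q : ℕ} (A : Matrix (Fin p) (Fin q) ℝ) : 0 ≤ rowSumNorm A :=
  Real.iSup_nonneg fun _ => Finset.sum_nonneg fun _ _ => abs_nonneg _

lemma sum_abs_le_rowSumNorm {p q : ℕ} (A : Matrix (Fin p) (Fin q) ℝ) (i : Fin p) :
    ∑ j, |A i j| ≤ rowSumNorm A :=
  le_ciSup (f := fun i => ∑ j, |A i j|) (Set.finite_range _).bddAbove i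

lemma SumBdd.of_rowSumNorm_le {p : ℕ} {A : Matrix (Fin p) (Fin p) ℝ} {c : ℝ}
    (h : rowSumNorm A ≤ c) (h' : rowSumNorm Aᵀ ≤ c) : SumBdd A c :=
  ⟨fun i => (sum_abs_le_rowSumNorm A i).trans h, fun j => (sum_abs_le_rowSumNorm Aᵀ j).trans h'⟩

/-- A bound for the row and column sums of the whitened weight matrices and of the inverses of
their influence matrices. -/
noncomputable def weightBound (r₀ Cw : ℝ) : ℝ := 1 + Cw ^ 2 + r₀ * Cw ^ 2

lemma one_le_weightBound {r₀ Cw : ℝ} (hr : 0 < r₀) : 1 ≤ weightBound r₀ Cw := by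
  have : 0 ≤ r₀ * Cw ^ 2 := by positivity
  unfold weightBound
  nlinarith [sq_nonneg Cw]

namespace WeightCond

variable {n T d : ℕ} {W : Fin T → Fin d → Matrix (Fin n) (Fin n) ℝ} {lam0 : Fin d → ℝ}
  {ς r₀ Cw : ℝ}

lemma bounds (h : WeightCond W lam0 ς r₀ Cw) (hd : 1 ≤ d) {lam : Fin d → ℝ}
    (hl : l1Norm (lam - lam0) < r₀) (t : Fin T) :
    0 ≤ Cw ∧ (∀ k, SumBdd (W t k) Cw) ∧ SumBdd (delta (W t) lam)⁻¹ Cw := by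
  have key := ((h lam hl).2 t).2
  have nn : ∀ k, 0 ≤ rowSumNorm (W t k) ∧ 0 ≤ rowSumNorm (W t k)ᵀ
      ∧ 0 ≤ rowSumNorm (delta (W t) lam)⁻¹ ∧ 0 ≤ rowSumNorm ((delta (W t) lam)ᵀ)⁻¹ := fun k =>
    ⟨rowSumNorm_nonneg _, rowSumNorm_nonneg _, rowSumNorm_nonneg _, rowSumNorm_nonneg _⟩
  have k0 : Fin d := ⟨0, hd⟩
  have h0 := key k0
  obtain ⟨n1, n2, n3, n4⟩ := nn k0
  refine ⟨by linarith, fun k => ?_, ?_⟩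
  · have hk := key k
    obtain ⟨m1, m2, m3, m4⟩ := nn k
    exact SumBdd.of_rowSumNorm_le (by linarith) (by linarith)
  · refine SumBdd.of_rowSumNorm_le (by linarith) ?_
    rw [Matrix.transpose_nonsing_inv]
    linarith

lemma l1Norm_self (lam0 : Fin d → ℝ) : l1Norm (lam0 - lam0) = 0 := by simp [l1Norm]

lemma isUnit (h : WeightCond W lam0 ς r₀ Cw) {lam : Fin d → ℝ} (hl : l1Norm (lam - lam0) < r₀)
    (t : Fin T) : IsUnit (delta (W t) lam).det := ((h lam hl).2 t).1

lemma isUnit_self (h : WeightCond W lam0 ς r₀ Cw) (hr : 0 < r₀) (t : Fin T) :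
    IsUnit (delta (W t) lam0).det := h.isUnit (by rwa [l1Norm_self]) t

lemma sumBdd_whiten (h : WeightCond W lam0 ς r₀ Cw) (hd : 1 ≤ d) (hr : 0 < r₀) (t : Fin T)
    (k : Fin d) : SumBdd (whiten W lam0 t k) (weightBound r₀ Cw) := by
  obtain ⟨h0, h1, h2⟩ := h.bounds hd (lam := lam0) (by rwa [l1Norm_self]) t
  refine ((h1 k).mul h2).mono ?_
  have : 0 ≤ r₀ * Cw ^ 2 := by positivity
  unfold weightBound
  nlinarith

/-- The inverse is bounded since `(I - V(δ))⁻¹ = Δ(λ₀) Δ(λ₀ + δ)⁻¹ = I + B(δ) Δ(λ₀ + δ)⁻¹`. -/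
lemma resolventBdd_whiten (h : WeightCond W lam0 ς r₀ Cw) (hd : 1 ≤ d) (hr : 0 < r₀) :
    ResolventBdd (whiten W lam0) r₀ (weightBound r₀ Cw) := by
  intro δ hδ t
  have hu0 := h.isUnit_self hr
  have hl : l1Norm (lam0 + δ - lam0) < r₀ := by simpa using hδ
  have hu := h.isUnit hl t
  refine ⟨isUnit_det_whiten hu0 hu, ?_⟩
  obtain ⟨hc, h1, h2⟩ := h.bounds hd hl t
  have e : (delta (whiten W lam0 t) δ)⁻¹ = 1 + influence (W t) δ * (delta (W t) (lam0 + δ))⁻¹ := by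
    have e1 : (delta (whiten W lam0 t) δ)⁻¹ = delta (W t) lam0 * (delta (W t) (lam0 + δ))⁻¹ := by
      rw [← delta_whiten_mul hu0, Matrix.mul_inv_rev,
        Matrix.mul_nonsing_inv_cancel_left _ _ (hu0 t)]
    have e2 : delta (W t) lam0 = delta (W t) (lam0 + δ) + influence (W t) δ := by
      rw [delta_add]; abel
    rw [e1, e2, add_mul, Matrix.mul_nonsing_inv _ hu]
  rw [e]
  refine (SumBdd.one.add ((SumBdd.influence h1 δ).mul h2)).mono ?_
  have h3 : Cw * l1Norm δ * Cw ≤ r₀ * Cw ^ 2 := by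
    have : Cw * l1Norm δ * Cw = l1Norm δ * Cw ^ 2 := by ring
    rw [this]
    exact mul_le_mul_of_nonneg_right hδ.le (sq_nonneg _)
  unfold weightBound
  nlinarith [sq_nonneg Cw]

end WeightCond

section Curvature

variable {n T d : ℕ} {U : Fin T → Fin d → Matrix (Fin n) (Fin n) ℝ} {s c : ℝ}

lemma l2Norm_sq_param (θ : Fin (d + 1) → ℝ) :
    l2Norm θ ^ 2 = l2Norm (lamPart θ) ^ 2 + varPart θ ^ 2 := by
  rw [l2Norm_sq, l2Norm_sq, Fin.sum_univ_castSucc]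
  rfl

lemma l2Norm_lamPart_le (θ : Fin (d + 1) → ℝ) : l2Norm (lamPart θ) ≤ l2Norm θ := by
  refine le_of_sq_le_sq ?_ (l2Norm_nonneg θ)
  rw [l2Norm_sq_param]
  nlinarith [sq_nonneg (varPart θ)]

lemma abs_varPart_le (θ : Fin (d + 1) → ℝ) : |varPart θ| ≤ l2Norm θ := by
  refine abs_le_of_sq_le_sq' ?_ (l2Norm_nonneg θ) |> abs_le.2
  rw [l2Norm_sq_param]
  nlinarith [sq_nonneg (l2Norm (lamPart θ))]

/-- Minimizing the information over the last entry of the direction gives its Schur complement. -/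
lemma schurBound_of_infoForm (hs : 0 < s) (hc : 0 ≤ c)
    (h : ∀ v : Fin (d + 1) → ℝ,
      c * l2Norm v ^ 2 ≤ infoForm U s (lamPart v) (varPart v) (lamPart v) (varPart v)) :
    SchurBound U c := by
  intro x
  have h1 := h (mkParam x (-(2 * s * traceForm U x)))
  rw [l2Norm_sq_param, lamPart_mkParam, varPart_mkParam, infoForm] at h1
  have e : -(2 * s * traceForm U x) * traceForm U x / s
      + -(2 * s * traceForm U x) * traceForm U x / s
      + -(2 * s * traceForm U x) * -(2 * s * traceForm U x) / (2 * s ^ 2)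
      = -2 * traceForm U x ^ 2 := by
    field_simp
    ring
  have h2 : 0 ≤ c * (-(2 * s * traceForm U x)) ^ 2 := by positivity
  linarith

lemma infoForm_comm (δ : Fin d → ℝ) (η : ℝ) (x : Fin d → ℝ) (w : ℝ) :
    infoForm U s δ η x w = infoForm U s x w δ η := by
  have e1 : traceGram U δ x = traceGram U x δ := by
    simp only [traceGram]
    congr 1
    funext t
    rw [← Matrix.trace_transpose, Matrix.transpose_mul, Matrix.transpose_transpose]
  have e2 : traceProd U δ x = traceProd U x δ := by
    simp only [traceProd]
    congr 1
    funext t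
    rw [Matrix.trace_mul_comm]
  rw [infoForm, infoForm, e1, e2]
  ring

end Curvature

/-! ### The deviation of the sample moments -/

section Deviation

variable {n T d : ℕ} {U : Fin T → Fin d → Matrix (Fin n) (Fin n) ℝ} {y : Fin T → Fin n → ℝ}
  {s κ L : ℝ}

/-- The normalized sum of squares of the deviations of the sample moments in `GoodSample` from their
expectations. Its expectation is bounded. -/
noncomputable def sampleDev (U : Fin T → Fin d → Matrix (Fin n) (Fin n) ℝ) (s : ℝ)
    (y : Fin T → Fin n → ℝ) : ℝ :=
  ((n : ℝ) * T)⁻¹ * (formSum s (fun _ => 1) y ^ 2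
    + (d : ℝ)⁻¹ * ∑ k, formSum s (fun t => U t k) y ^ 2
    + ((d : ℝ) ^ 2)⁻¹ * ∑ k, ∑ l, formSum s (fun t => (U t k)ᵀ * U t l) y ^ 2)

lemma avg_quadForm_sub (s : ℝ) (A : Fin T → Matrix (Fin n) (Fin n) ℝ) (y : Fin T → Fin n → ℝ) :
    (avg n fun t => y t ⬝ᵥ (A t *ᵥ y t)) - s * (avg n fun t => (A t).trace)
      = ((n : ℝ) * T)⁻¹ * formSum s A y := by
  simp only [avg, formSum, centredForm, Finset.sum_sub_distrib, ← Finset.mul_sum]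
  ring

lemma meanSq_sub (hN : ((n : ℝ) * T) ≠ 0) :
    meanSq y - s = ((n : ℝ) * T)⁻¹ * formSum s (fun _ => 1) y := by
  rw [← avg_quadForm_sub]
  simp only [meanSq, Matrix.one_mulVec, Matrix.trace_one, Fintype.card_fin]
  have : avg n (fun _ : Fin T => (n : ℝ)) = 1 := by
    simp only [avg, Finset.sum_const, Finset.card_univ, Fintype.card_fin, nsmul_eq_mul]
    rw [mul_comm (T : ℝ), inv_mul_cancel₀ hN]
  rw [this, mul_one]

lemma formSum_sum {ι : Type*} (s : ℝ) (S : Finset ι) (A : Fin T → ι → Matrix (Fin n) (Fin n) ℝ)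
    (x : Fin T → Fin n → ℝ) :
    formSum s (fun t => ∑ i ∈ S, A t i) x = ∑ i ∈ S, formSum s (fun t => A t i) x := by
  simp only [formSum]
  rw [Finset.sum_comm]
  refine Finset.sum_congr rfl fun t _ => ?_
  simp only [centredForm, Matrix.sum_mulVec, dotProduct_sum, Matrix.trace_sum, Finset.mul_sum,
    ← Finset.sum_sub_distrib]

lemma linForm_sub_traceForm (x : Fin d → ℝ) :
    linForm U y x - s * traceForm U x
      = ∑ k, x k * (((n : ℝ) * T)⁻¹ * formSum s (fun t => U t k) y) := by
  rw [linForm, traceForm, avg_quadForm_sub]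
  have e : formSum s (fun t => influence (U t) x) y = ∑ k, x k * formSum s (fun t => U t k) y := by
    simp only [influence, formSum_sum, formSum_smul]
  rw [e, Finset.mul_sum]
  exact Finset.sum_congr rfl fun k _ => by ring

lemma gramForm_sub_traceGram (x z : Fin d → ℝ) :
    gramForm U y x z - s * traceGram U x z
      = ∑ k, ∑ l, x k * z l * (((n : ℝ) * T)⁻¹ * formSum s (fun t => (U t k)ᵀ * U t l) y) := by
  have e0 : gramForm U y x z
      = avg n fun t => y t ⬝ᵥ (((influence (U t) x)ᵀ * influence (U t) z) *ᵥ y t) := by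
    simp only [gramForm]
    congr 1
    funext t
    rw [← Matrix.mulVec_mulVec, Matrix.dotProduct_mulVec (y t), Matrix.vecMul_transpose]
  rw [e0, traceGram, avg_quadForm_sub]
  have e : formSum s (fun t => (influence (U t) x)ᵀ * influence (U t) z) y
      = ∑ k, ∑ l, x k * z l * formSum s (fun t => (U t k)ᵀ * U t l) y := by
    have e1 : ∀ t, (influence (U t) x)ᵀ * influence (U t) z
        = ∑ k, ∑ l, (x k * z l) • ((U t k)ᵀ * U t l) := by
      intro t
      simp only [influence, Matrix.transpose_sum, Matrix.transpose_smul, Finset.sum_mul_sum,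
        Matrix.smul_mul, Matrix.mul_smul, smul_smul, mul_comm]
    simp only [e1, formSum_sum, formSum_smul]
  rw [e, Finset.mul_sum]
  refine Finset.sum_congr rfl fun k _ => ?_
  rw [Finset.mul_sum]
  exact Finset.sum_congr rfl fun k _ => by ring

/-- The sample is good when the deviation is bounded. -/
lemma goodSample_of_sampleDev_le (hd : 1 ≤ d) (hN : 0 < (n : ℝ) * T) (hL : 0 ≤ L)
    (h : sampleDev U s y ≤ L) : GoodSample U y s ((d : ℝ) ^ 2 * √(L / ((n : ℝ) * T))) := by
  set N := (n : ℝ) * T with hNdef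
  set ρ := √(L / N) with hρ
  have hρ0 : 0 ≤ ρ := Real.sqrt_nonneg _
  have hρsq : ρ ^ 2 = L / N := Real.sq_sqrt (by positivity)
  have hd0 : (0 : ℝ) < d := by exact_mod_cast hd
  set P := formSum s (fun _ => (1 : Matrix (Fin n) (Fin n) ℝ)) y with hP
  set Q := ∑ k, formSum s (fun t => U t k) y ^ 2 with hQ
  set R := ∑ k, ∑ l, formSum s (fun t => (U t k)ᵀ * U t l) y ^ 2 with hR
  have h' : N⁻¹ * (P ^ 2 + (d : ℝ)⁻¹ * Q + ((d : ℝ) ^ 2)⁻¹ * R) ≤ L := h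
  have hQ0 : 0 ≤ Q := Finset.sum_nonneg fun _ _ => sq_nonneg _
  have hR0 : 0 ≤ R := Finset.sum_nonneg fun _ _ => Finset.sum_nonneg fun _ _ => sq_nonneg _
  clear_value P Q R ρ
  have hX : P ^ 2 + (d : ℝ)⁻¹ * Q + ((d : ℝ) ^ 2)⁻¹ * R ≤ N * L := by
    rwa [inv_mul_le_iff₀ hN] at h'
  have q1 : 0 ≤ (d : ℝ)⁻¹ * Q := by positivity
  have q2 : 0 ≤ ((d : ℝ) ^ 2)⁻¹ * R := by positivity
  have hNL : N * L = (N * ρ) ^ 2 := by rw [mul_pow, hρsq]; field_simp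
  have hPle : P ^ 2 ≤ (N * ρ) ^ 2 := by nlinarith
  have hQle : Q ≤ d * (N * ρ) ^ 2 := by
    rw [← inv_mul_le_iff₀ hd0]; nlinarith [sq_nonneg P]
  have hRle : R ≤ (d : ℝ) ^ 2 * (N * ρ) ^ 2 := by
    rw [← inv_mul_le_iff₀ (by positivity)]; nlinarith [sq_nonneg P]
  refine ⟨?_, fun x => ?_, fun x z => ?_⟩
  · rw [meanSq_sub hN.ne', abs_mul, abs_of_pos (inv_pos.2 hN)]
    refine mul_le_mul_of_nonneg_left ?_ (sq_nonneg _)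
    rw [inv_mul_le_iff₀ hN, ← hP]
    exact abs_le.2 (abs_le_of_sq_le_sq' hPle (by positivity))
  · rw [linForm_sub_traceForm]
    have h1 := sum_mul_le_l2Norm x fun k => N⁻¹ * formSum s (fun t => U t k) y
    have h2 : l2Norm (fun k => N⁻¹ * formSum s (fun t => U t k) y) ≤ √d * ρ := by
      refine le_of_sq_le_sq ?_ (by positivity)
      rw [l2Norm_sq, mul_pow, Real.sq_sqrt hd0.le]
      simp only [mul_pow, ← Finset.mul_sum]
      rw [← hQ, inv_pow, inv_mul_le_iff₀ (by positivity)]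
      linarith [hQle, mul_pow N ρ 2, (by ring : (d : ℝ) * (N * ρ) ^ 2 = N ^ 2 * (d * ρ ^ 2))]
    calc _ ≤ (d : ℝ) * √d * (l2Norm x * (√d * ρ)) :=
          mul_le_mul_of_nonneg_left
            (h1.trans (mul_le_mul_of_nonneg_left h2 (l2Norm_nonneg x))) (by positivity)
      _ = d * (√d * √d) * ρ * l2Norm x := by ring
      _ = _ := by rw [Real.mul_self_sqrt hd0.le]; ring
  · rw [gramForm_sub_traceGram]
    have h1 := abs_sum_sum_mul_le (F := fun k l => N⁻¹ * formSum s (fun t => (U t k)ᵀ * U t l) y)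
      (b := d * ρ) (by positivity) ?_ x z
    · calc _ ≤ (d : ℝ) * (d * ρ * l2Norm x * l2Norm z) := mul_le_mul_of_nonneg_left h1 hd0.le
        _ = _ := by ring
    · simp only [mul_pow, ← Finset.mul_sum]
      rw [← hR, inv_pow, inv_mul_le_iff₀ (by positivity)]
      linarith [hRle, (by ring : (d : ℝ) ^ 2 * (N * ρ) ^ 2 = N ^ 2 * (d ^ 2 * ρ ^ 2))]

variable {Ω : Type*} [mΩ : MeasurableSpace Ω] {μ : Measure Ω} [IsProbabilityMeasure μ]
  {ε : Ω → Fin T → Fin n → ℝ} {K a : ℝ}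

lemma sampleDev_nonneg : 0 ≤ sampleDev U s y := by
  unfold sampleDev
  positivity

lemma integrable_sampleDev (herr : ErrorCond μ ε s K) :
    Integrable (fun ω => sampleDev U s (ε ω)) μ := by
  unfold sampleDev
  exact HasMoments.integrable (((((herr.hasMoments_formSum _).pow 2).add
    ((HasMoments.sum _ fun k _ => (herr.hasMoments_formSum _).pow 2).const_mul _)).add
    ((HasMoments.sum _ fun k _ => HasMoments.sum _ fun l _ =>
      (herr.hasMoments_formSum _).pow 2).const_mul _)).const_mul _)

lemma integral_sampleDev_le (herr : ErrorCond μ ε s K) (hd : 1 ≤ d) (hN : 0 < (n : ℝ) * T)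
    (ha : 1 ≤ a) (hU : ∀ t k, SumBdd (U t k) a) :
    ∫ ω, sampleDev U s (ε ω) ∂μ ≤ 3 * ErrorCond.formBound (a ^ 2) s K := by
  set N := (n : ℝ) * T with hNdef
  set F := ErrorCond.formBound (a ^ 2) s K with hF
  have hd0 : (0 : ℝ) < d := by exact_mod_cast hd
  have ha2 : a ≤ a ^ 2 := by nlinarith
  have m0 := (herr.hasMoments_formSum (fun _ => 1)).pow 2
  have m1 := fun k => (herr.hasMoments_formSum (fun t => U t k)).pow 2
  have m2 := fun k l => (herr.hasMoments_formSum (fun t => (U t k)ᵀ * U t l)).pow 2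
  have b0 : ∫ ω, formSum s (fun _ => 1) (ε ω) ^ 2 ∂μ ≤ F * N :=
    herr.integral_formSum_sq_le fun _ => SumBdd.one.mono (ha.trans ha2)
  have b1 : ∀ k, ∫ ω, formSum s (fun t => U t k) (ε ω) ^ 2 ∂μ ≤ F * N :=
    fun k => herr.integral_formSum_sq_le fun t => (hU t k).mono ha2
  have b2 : ∀ k l, ∫ ω, formSum s (fun t => (U t k)ᵀ * U t l) (ε ω) ^ 2 ∂μ ≤ F * N :=
    fun k l => herr.integral_formSum_sq_le fun t =>
      ((hU t k).transpose.mul (hU t l)).mono (le_of_eq (by ring))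
  have s1 : ∑ k, ∫ ω, formSum s (fun t => U t k) (ε ω) ^ 2 ∂μ ≤ d * (F * N) := by
    refine (Finset.sum_le_sum fun k _ => b1 k).trans (le_of_eq ?_)
    simp
  have s2 : ∑ k, ∑ l, ∫ ω, formSum s (fun t => (U t k)ᵀ * U t l) (ε ω) ^ 2 ∂μ
      ≤ (d : ℝ) ^ 2 * (F * N) := by
    refine (Finset.sum_le_sum fun k _ => Finset.sum_le_sum fun l _ => b2 k l).trans (le_of_eq ?_)
    simp only [Finset.sum_const, Finset.card_univ, Fintype.card_fin, nsmul_eq_mul]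
    ring
  have i1 := HasMoments.sum Finset.univ fun k _ => m1 k
  have i2 := HasMoments.sum Finset.univ fun k _ => HasMoments.sum Finset.univ fun l _ => m2 k l
  simp only [sampleDev]
  rw [integral_const_mul, integral_add (m0.add (i1.const_mul _)).integrable
    (i2.const_mul _).integrable, integral_add m0.integrable (i1.const_mul _).integrable,
    integral_const_mul, integral_const_mul, integral_finsetSum _ fun k _ => (m1 k).integrable,
    integral_finsetSum _ fun k _ =>
      (HasMoments.sum Finset.univ fun l _ => m2 k l).integrable]
  simp only [fun k => integral_finsetSum Finset.univ fun l (_ : l ∈ Finset.univ) =>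
    (m2 k l).integrable]
  rw [inv_mul_le_iff₀ hN]
  have t1 := mul_le_mul_of_nonneg_left s1 (inv_nonneg.2 hd0.le)
  have t2 := mul_le_mul_of_nonneg_left s2 (inv_nonneg.2 (sq_nonneg (d : ℝ)))
  rw [inv_mul_cancel_left₀ hd0.ne'] at t1
  rw [inv_mul_cancel_left₀ (by positivity)] at t2
  linarith

/-- Markov's inequality for the deviation of the sample moments. -/
lemma measure_sampleDev_gt_le (herr : ErrorCond μ ε s K) (hd : 1 ≤ d) (hN : 0 < (n : ℝ) * T)
    (ha : 1 ≤ a) (hU : ∀ t k, SumBdd (U t k) a) (hL : 0 < L) :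
    μ {ω | L < sampleDev U s (ε ω)} ≤ ENNReal.ofReal (3 * ErrorCond.formBound (a ^ 2) s K / L) := by
  have h1 := mul_meas_ge_le_integral_of_nonneg (μ := μ)
    (Eventually.of_forall fun ω => sampleDev_nonneg (U := U) (s := s) (y := ε ω))
    (integrable_sampleDev herr) L
  have h2 := h1.trans (integral_sampleDev_le herr hd hN ha hU)
  rw [← le_div_iff₀' hL] at h2
  refine (measure_mono fun ω (hω : L < _) => ?_).trans
    ((ENNReal.le_ofReal_iff_toReal_le (measure_ne_top _ _) ?_).2 h2)
  · exact hω.le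
  · exact measureReal_nonneg.trans h2

end Deviation

/-! ### The estimation error at a fixed sample size -/

/-- The model at one index of the asymptotic sequence. -/
structure ModelAt {Ω : Type*} [MeasurableSpace Ω] {n T d : ℕ} (μ : Measure Ω)
    (ε Y : Ω → Fin T → Fin n → ℝ) (W : Fin T → Fin d → Matrix (Fin n) (Fin n) ℝ)
    (lam0 : Fin d → ℝ) (s K ς r₀ Cw : ℝ) : Prop where
  dim : 1 ≤ d
  s_pos : 0 < s
  r_pos : 0 < r₀
  model : ∀ ω t, Y ω t = influence (W t) lam0 *ᵥ Y ω t + ε ω t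
  err : ErrorCond μ ε s K
  weight : WeightCond W lam0 ς r₀ Cw

/-- A radius on which the concentrated likelihood is strictly concave. -/
noncomputable def radius (r₀ a c : ℝ) : ℝ :=
  min (1 / (6 * a ^ 2)) (min (r₀ / 2) (c / (272 * a ^ 5)))

lemma radius_pos {r₀ a c : ℝ} (hr : 0 < r₀) (ha : 1 ≤ a) (hc : 0 < c) : 0 < radius r₀ a c := by
  have : 0 < a := by linarith
  unfold radius
  positivity

/-- The constant of the stochastic bound of the score. -/
noncomputable def scoreConst (s : ℝ) : ℝ := s⁻¹ + (2 * s ^ 2)⁻¹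

lemma linConst_nonneg {a s c : ℝ} (ha : 0 < a) (hs : 0 < s) (hc : 0 < c) : 0 ≤ linConst a s c := by
  unfold linConst
  positivity

lemma GoodSample.abs_scoreForm_le {n T d : ℕ} {U : Fin T → Fin d → Matrix (Fin n) (Fin n) ℝ}
    {y : Fin T → Fin n → ℝ} {s ρ : ℝ} (h : GoodSample U y s ((d : ℝ) ^ 2 * ρ)) (hd : 1 ≤ d)
    (hs : 0 < s) (v : Fin (d + 1) → ℝ) :
    |scoreForm U y s (lamPart v) (varPart v)| ≤ √d * ρ * scoreConst s * l2Norm v := by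
  have hd1 : (1 : ℝ) ≤ d := by exact_mod_cast hd
  have hd0 : (0 : ℝ) < d := by linarith
  have hsd : 1 ≤ √(d : ℝ) := Real.one_le_sqrt.2 hd1
  have h1 : |linForm U y (lamPart v) - s * traceForm U (lamPart v)|
      ≤ √d * ρ * l2Norm (lamPart v) := by
    have h2 := h.lin (lamPart v)
    have e : (d : ℝ) ^ 2 * ρ * l2Norm (lamPart v)
        = (d * √d) * (√d * ρ * l2Norm (lamPart v)) := by
      have := Real.mul_self_sqrt hd0.le
      linear_combination (-(d : ℝ) * ρ * l2Norm (lamPart v)) * this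
    rw [e] at h2
    exact le_of_mul_le_mul_left h2 (by positivity)
  have h2 : |MIR.meanSq y - s| ≤ ρ := le_of_mul_le_mul_left h.meanSq (by positivity)
  have hρ : 0 ≤ ρ := (abs_nonneg _).trans h2
  have h3 : |MIR.meanSq y - s| ≤ √d * ρ := h2.trans (le_mul_of_one_le_left hρ hsd)
  unfold scoreForm scoreConst
  refine (abs_add_le _ _).trans ?_
  rw [abs_div, abs_div, abs_mul, abs_of_pos hs, abs_of_pos (by positivity : 0 < 2 * s ^ 2)]
  have h4 : |linForm U y (lamPart v) - s * traceForm U (lamPart v)| ≤ √d * ρ * l2Norm v :=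
    h1.trans (mul_le_mul_of_nonneg_left (l2Norm_lamPart_le v) (by positivity))
  have h5 : |varPart v| * |MIR.meanSq y - s| ≤ √d * ρ * l2Norm v := by
    rw [mul_comm]
    exact mul_le_mul h3 (abs_varPart_le v) (abs_nonneg _) (by positivity)
  calc _ ≤ √d * ρ * l2Norm v / s + √d * ρ * l2Norm v / (2 * s ^ 2) := by gcongr
    _ = _ := by ring

namespace ModelAt

variable {Ω : Type*} [MeasurableSpace Ω] {n T d : ℕ} {μ : Measure Ω}
  {ε Y : Ω → Fin T → Fin n → ℝ} {W : Fin T → Fin d → Matrix (Fin n) (Fin n) ℝ}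
  {lam0 : Fin d → ℝ} {s K ς r₀ Cw : ℝ}

lemma delta_mulVec (h : ModelAt μ ε Y W lam0 s K ς r₀ Cw) (ω : Ω) (t : Fin T) :
    delta (W t) lam0 *ᵥ Y ω t = ε ω t := by
  rw [delta, Matrix.sub_mulVec, Matrix.one_mulVec, sub_eq_iff_eq_add']
  exact h.model ω t

lemma sumBdd (h : ModelAt μ ε Y W lam0 s K ς r₀ Cw) (t : Fin T) (k : Fin d) :
    SumBdd (whiten W lam0 t k) (weightBound r₀ Cw) := h.weight.sumBdd_whiten h.dim h.r_pos t k

lemma dotProduct_infoMat_mulVec [IsProbabilityMeasure μ] (h : ModelAt μ ε Y W lam0 s K ς r₀ Cw)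
    (hN : 0 < (n : ℝ) * T) (u v : Fin (d + 1) → ℝ) :
    u ⬝ᵥ (infoMat μ W Y (mkParam lam0 s) *ᵥ v)
      = infoForm (whiten W lam0) s (lamPart u) (varPart u) (lamPart v) (varPart v) :=
  MIR.dotProduct_infoMat_mulVec h.err h.r_pos (fun _ hl => h.weight.isUnit hl) h.delta_mulVec
    h.s_pos hN.ne' u v

/-- The information of the sample inherits half of the lower bound of its limit. -/
lemma infoForm_ge [IsProbabilityMeasure μ] (h : ModelAt μ ε Y W lam0 s K ς r₀ Cw)
    (hN : 0 < (n : ℝ) * T) {I0 : Matrix (Fin (d + 1)) (Fin (d + 1)) ℝ} {c C : ℝ}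
    (hI0 : EigenBounds I0 c C)
    (hfrob : frobNorm (infoMat μ W Y (mkParam lam0 s) - I0) ≤ c / 2) (v : Fin (d + 1) → ℝ) :
    c / 2 * l2Norm v ^ 2
      ≤ infoForm (whiten W lam0) s (lamPart v) (varPart v) (lamPart v) (varPart v) := by
  rw [← h.dotProduct_infoMat_mulVec hN]
  have h1 := (hI0.2 v).1
  rw [dotProduct_self_eq] at h1
  have h2 := abs_dotProduct_mulVec_le_frobNorm (infoMat μ W Y (mkParam lam0 s) - I0) v v
  rw [Matrix.sub_mulVec, dotProduct_sub] at h2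
  have h3 := (abs_le.1 h2).1
  have h4 := mul_le_mul_of_nonneg_right hfrob (sq_nonneg (l2Norm v))
  rw [mul_assoc, ← sq] at h3
  linarith

lemma localSetup (h : ModelAt μ ε Y W lam0 s K ς r₀ Cw) {c κ : ℝ} (hc : 0 < c)
    (hinfo : ∀ v : Fin (d + 1) → ℝ, c * l2Norm v ^ 2
      ≤ infoForm (whiten W lam0) s (lamPart v) (varPart v) (lamPart v) (varPart v)) {ω : Ω}
    (hgood : GoodSample (whiten W lam0) (ε ω) s κ) (hκ1 : κ ≤ s / 2)
    (hκ2 : 20 * weightBound r₀ Cw ^ 2 * κ / s ≤ c / 4)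
    (hκ3 : 8 * weightBound r₀ Cw / (c * s) * κ < radius r₀ (weightBound r₀ Cw) c) :
    LocalSetup W (Y ω) lam0 (ε ω) ς r₀ (weightBound r₀ Cw) s c
      (radius r₀ (weightBound r₀ Cw) c) κ := by
  have ha := one_le_weightBound (Cw := Cw) h.r_pos
  set a := weightBound r₀ Cw with ha_def
  have ha0 : 0 < a := by linarith
  have hr0 := h.r_pos
  refine ⟨h.dim, fun lam hl => (h.weight lam hl).1, fun lam hl => h.weight.isUnit hl,
    h.delta_mulVec ω, ha, h.sumBdd, h.weight.resolventBdd_whiten h.dim h.r_pos, h.s_pos, hc,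
    schurBound_of_infoForm h.s_pos hc.le hinfo, hgood, radius_pos h.r_pos ha hc, ?_, ?_, ?_,
    hκ1, hκ2, hκ3⟩
  · calc a ^ 2 * radius r₀ a c ≤ a ^ 2 * (1 / (6 * a ^ 2)) := by
          unfold radius
          gcongr
          exact min_le_left _ _
      _ = 1 / 6 := by field_simp
  · exact ((min_le_right _ _).trans (min_le_left _ _)).trans_lt (by linarith)
  · calc 68 * a ^ 5 * radius r₀ a c ≤ 68 * a ^ 5 * (c / (272 * a ^ 5)) := by
          unfold radius
          gcongr
          exact (min_le_right _ _).trans (min_le_right _ _)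
      _ = c / 4 := by field_simp; norm_num

end ModelAt

section Error

variable {n T d : ℕ} {W : Fin T → Fin d → Matrix (Fin n) (Fin n) ℝ} {Y y : Fin T → Fin n → ℝ}
  {lam0 : Fin d → ℝ} {s ς r₀ a c r ρ : ℝ} {θ : Fin (d + 1) → ℝ}

lemma lamPart_sub_mkParam (θ : Fin (d + 1) → ℝ) (lam0 : Fin d → ℝ) (s : ℝ) :
    lamPart (θ - mkParam lam0 s) = lamPart θ - lam0 := by
  have : lamPart (θ - mkParam lam0 s) = lamPart θ - lamPart (mkParam lam0 s) := rfl
  rw [this, lamPart_mkParam]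

lemma varPart_sub_mkParam (θ : Fin (d + 1) → ℝ) (lam0 : Fin d → ℝ) (s : ℝ) :
    varPart (θ - mkParam lam0 s) = varPart θ - s := by
  have : varPart (θ - mkParam lam0 s) = varPart θ - varPart (mkParam lam0 s) := rfl
  rw [this, varPart_mkParam]

lemma LocalSetup.abs_infoForm_sub_le {κ : ℝ} (h : LocalSetup W Y lam0 y ς r₀ a s c r κ)
    (hκ : 0 ≤ κ) (hθ : IsNearQMLE ς r W lam0 Y θ) (v : Fin (d + 1) → ℝ) :
    |infoForm (whiten W lam0) s (lamPart (θ - mkParam lam0 s)) (varPart (θ - mkParam lam0 s))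
        (lamPart v) (varPart v) - scoreForm (whiten W lam0) y s (lamPart v) (varPart v)|
      ≤ 2 * linConst a s c * κ * l2Norm (θ - mkParam lam0 s) * l2Norm v := by
  have h1 := h.abs_infoForm_sub_scoreForm_le hθ (lamPart v) (varPart v)
  rw [← lamPart_sub_mkParam θ lam0 s, ← varPart_sub_mkParam θ lam0 s] at h1
  refine h1.trans ?_
  have hl : 0 ≤ linConst a s c := linConst_nonneg (by linarith [h.one_le]) h.s_pos h.c_pos
  have h2 := l2Norm_lamPart_le v
  have h3 := abs_varPart_le v
  have h4 := l2Norm_lamPart_le (θ - mkParam lam0 s)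
  calc _ ≤ linConst a s c * κ * l2Norm (θ - mkParam lam0 s) * (l2Norm v + l2Norm v) := by
        have := l2Norm_nonneg (lamPart v)
        have := l2Norm_nonneg (θ - mkParam lam0 s)
        gcongr
    _ = _ := by ring

/-- The rate of convergence of the estimate. -/
lemma LocalSetup.l2Norm_sub_le (h : LocalSetup W Y lam0 y ς r₀ a s c r ((d : ℝ) ^ 2 * ρ))
    (hρ : 0 ≤ ρ) (hlin : 4 * linConst a s c * ((d : ℝ) ^ 2 * ρ) ≤ c)
    (hinfo : ∀ v : Fin (d + 1) → ℝ, c * l2Norm v ^ 2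
      ≤ infoForm (whiten W lam0) s (lamPart v) (varPart v) (lamPart v) (varPart v))
    (hθ : IsNearQMLE ς r W lam0 Y θ) :
    l2Norm (θ - mkParam lam0 s) ≤ 2 * scoreConst s / c * (√d * ρ) := by
  have h1 := h.abs_infoForm_sub_le (by positivity) hθ (θ - mkParam lam0 s)
  have h2 := h.good.abs_scoreForm_le h.dim h.s_pos (θ - mkParam lam0 s)
  have h3 := hinfo (θ - mkParam lam0 s)
  have hc := h.c_pos
  set x := l2Norm (θ - mkParam lam0 s) with hx
  have hx0 : 0 ≤ x := l2Norm_nonneg _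
  have h4 := (abs_le.1 h1).2
  have h5 := (abs_le.1 h2).2
  have h6 := mul_le_mul_of_nonneg_right hlin (sq_nonneg x)
  have h7 : c / 2 * x * x ≤ √d * ρ * scoreConst s * x := by nlinarith
  have h8 : c / 2 * x ≤ √d * ρ * scoreConst s := by
    rcases hx0.eq_or_lt with h0 | h0
    · rw [← h0, mul_zero]
      have := h.s_pos
      unfold scoreConst
      positivity
    · exact le_of_mul_le_mul_right h7 h0
  have e : 2 * scoreConst s / c * (√d * ρ) = (√d * ρ * scoreConst s) / (c / 2) := by
    field_simp
  rw [e, le_div_iff₀' (by positivity)]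
  exact h8

/-- Linear functionals of the estimation error agree, up to a negligible error, with a sum of
quadratic forms in the errors. -/
lemma LocalSetup.abs_dotProduct_mulVec_sub_formSum_le {κ δ B : ℝ}
    (h : LocalSetup W Y lam0 y ς r₀ a s c r κ) (hκ : 0 ≤ κ)
    {I0 IN : Matrix (Fin (d + 1)) (Fin (d + 1)) ℝ} (hδ : frobNorm (IN - I0) ≤ δ)
    (hIN : ∀ u v, u ⬝ᵥ (IN *ᵥ v)
      = infoForm (whiten W lam0) s (lamPart u) (varPart u) (lamPart v) (varPart v))
    (hθ : IsNearQMLE ς r W lam0 Y θ)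
    (hB : √((n : ℝ) * T / d) * l2Norm (θ - mkParam lam0 s) ≤ B) (v : Fin (d + 1) → ℝ) :
    |√((n : ℝ) * T / d) * (v ⬝ᵥ (I0 *ᵥ (θ - mkParam lam0 s)))
        - (√((n : ℝ) * T))⁻¹ * formSum s (scoreMat (whiten W lam0) s ((√(d : ℝ))⁻¹ • v)) y|
      ≤ (δ + 2 * linConst a s c * κ) * l2Norm v * B := by
  have hN := h.mul_pos
  have hd0 : (0 : ℝ) < d := by exact_mod_cast h.dim
  set Θ := θ - mkParam lam0 s with hΘ
  have h1 := h.abs_infoForm_sub_le hκ hθ v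
  rw [← hΘ, infoForm_comm, ← hIN] at h1
  have h2 := abs_dotProduct_mulVec_le_frobNorm (IN - I0) v Θ
  rw [Matrix.sub_mulVec, dotProduct_sub] at h2
  have e : (√((n : ℝ) * T))⁻¹ * formSum s (scoreMat (whiten W lam0) s ((√(d : ℝ))⁻¹ • v)) y
      = √((n : ℝ) * T / d) * scoreForm (whiten W lam0) y s (lamPart v) (varPart v) := by
    rw [formSum_scoreMat_smul, ← mul_scoreForm _ _ hN.ne' h.s_pos.ne', Real.sqrt_div' _ hd0.le]
    have h3 := Real.mul_self_sqrt hN.le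
    have h4 : 0 < √((n : ℝ) * T) := Real.sqrt_pos.2 hN
    have h5 : (√((n : ℝ) * T))⁻¹ * ((n : ℝ) * T) = √((n : ℝ) * T) := by
      rw [inv_mul_eq_iff_eq_mul₀ h4.ne', h3]
    linear_combination (√(d : ℝ))⁻¹ * scoreForm (whiten W lam0) y s (lamPart v) (varPart v) * h5
  rw [e, ← mul_sub, abs_mul, abs_of_nonneg (Real.sqrt_nonneg _)]
  have h6 : |v ⬝ᵥ (I0 *ᵥ Θ) - scoreForm (whiten W lam0) y s (lamPart v) (varPart v)|
      ≤ (δ + 2 * linConst a s c * κ) * l2Norm v * l2Norm Θ := by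
    have h7 : |v ⬝ᵥ (I0 *ᵥ Θ) - scoreForm (whiten W lam0) y s (lamPart v) (varPart v)|
        ≤ |v ⬝ᵥ (IN *ᵥ Θ) - v ⬝ᵥ (I0 *ᵥ Θ)|
          + |v ⬝ᵥ (IN *ᵥ Θ) - scoreForm (whiten W lam0) y s (lamPart v) (varPart v)| := by
      rw [abs_sub_comm (v ⬝ᵥ (IN *ᵥ Θ)) (v ⬝ᵥ (I0 *ᵥ Θ))]
      exact abs_sub_le _ _ _
    have h8 : frobNorm (IN - I0) * l2Norm v * l2Norm Θ ≤ δ * l2Norm v * l2Norm Θ := by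
      have := l2Norm_nonneg v
      have := l2Norm_nonneg Θ
      gcongr
    linarith
  have hl : 0 ≤ linConst a s c := linConst_nonneg (by linarith [h.one_le]) h.s_pos h.c_pos
  have hδ0 : 0 ≤ δ := (frobNorm_nonneg _).trans hδ
  have hv := l2Norm_nonneg v
  calc _ ≤ √((n : ℝ) * T / d) * ((δ + 2 * linConst a s c * κ) * l2Norm v * l2Norm Θ) :=
        mul_le_mul_of_nonneg_left h6 (Real.sqrt_nonneg _)
    _ = (δ + 2 * linConst a s c * κ) * l2Norm v * (√((n : ℝ) * T / d) * l2Norm Θ) := by ring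
    _ ≤ _ := by gcongr

end Error

/-! ### Convergence of characteristic functions -/

lemma norm_cexp_sub_cexp_le (x z : ℝ) :
    ‖Complex.exp ((x : ℝ) * Complex.I) - Complex.exp ((z : ℝ) * Complex.I)‖ ≤ |x - z| := by
  have e : Complex.exp ((x : ℝ) * Complex.I) - Complex.exp ((z : ℝ) * Complex.I)
      = Complex.exp ((z : ℝ) * Complex.I) * (Complex.exp (Complex.I * ((x - z : ℝ) : ℂ)) - 1) := by
    rw [mul_sub, ← Complex.exp_add, mul_one]
    congr 2
    push_cast
    ring
  rw [e, norm_mul, Complex.norm_exp_ofReal_mul_I, one_mul]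
  exact Real.norm_exp_I_mul_ofReal_sub_one_le

lemma integrable_cexp {Ω : Type*} [MeasurableSpace Ω] {μ : Measure Ω} [IsProbabilityMeasure μ]
    {f : Ω → ℝ} (hf : AEMeasurable f μ) :
    Integrable (fun ω => Complex.exp ((f ω : ℝ) * Complex.I)) μ := by
  refine Integrable.of_bound (C := 1) ?_ (Eventually.of_forall fun ω => ?_)
  · exact (Complex.measurable_exp.comp_aemeasurable
      ((Complex.measurable_ofReal.comp_aemeasurable hf).mul_const _)).aestronglyMeasurable
  · rw [Complex.norm_exp_ofReal_mul_I]

lemma norm_integral_cexp_sub_le {Ω : Type*} [MeasurableSpace Ω] {μ : Measure Ω}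
    [IsProbabilityMeasure μ] {f g : Ω → ℝ} (hf : AEMeasurable f μ) (hg : AEMeasurable g μ)
    {η : ℝ} (hη : 0 ≤ η) :
    ‖(∫ ω, Complex.exp ((f ω : ℝ) * Complex.I) ∂μ) - ∫ ω, Complex.exp ((g ω : ℝ) * Complex.I) ∂μ‖
      ≤ η + 2 * μ.real {ω | η < |f ω - g ω|} := by
  set S := toMeasurable μ {ω | η < |f ω - g ω|} with hS
  have hSm : MeasurableSet S := measurableSet_toMeasurable _ _
  have hSμ : μ.real S = μ.real {ω | η < |f ω - g ω|} := by
    rw [measureReal_def, measureReal_def, measure_toMeasurable]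
  have hi : Integrable (fun ω => η + S.indicator (fun _ => (2 : ℝ)) ω) μ :=
    (integrable_const η).add ((integrable_const (2 : ℝ)).indicator hSm)
  rw [← integral_sub (integrable_cexp hf) (integrable_cexp hg)]
  refine (norm_integral_le_of_norm_le hi (Eventually.of_forall fun ω => ?_)).trans (le_of_eq ?_)
  · by_cases hω : ω ∈ S
    · rw [Set.indicator_of_mem hω]
      refine (norm_sub_le _ _).trans ?_
      rw [Complex.norm_exp_ofReal_mul_I, Complex.norm_exp_ofReal_mul_I]
      linarith
    · rw [Set.indicator_of_notMem hω, add_zero]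
      refine (norm_cexp_sub_cexp_le _ _).trans (not_lt.1 fun h => hω ?_)
      exact subset_toMeasurable μ _ h
  · rw [integral_add (integrable_const η) ((integrable_const (2 : ℝ)).indicator hSm),
      integral_indicator hSm, setIntegral_const, integral_const, hSμ]
    simp only [probReal_univ, smul_eq_mul, one_mul]
    ring

/-- Variables whose difference tends to zero in probability have the same limit of characteristic
functions. -/
lemma tendsto_integral_cexp_of_close {Ω : ℕ → Type*} [∀ m, MeasurableSpace (Ω m)]
    {μ : ∀ m, Measure (Ω m)} [∀ m, IsProbabilityMeasure (μ m)] {f g : ∀ m, Ω m → ℝ}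
    (hf : ∀ m, AEMeasurable (f m) (μ m)) (hg : ∀ m, AEMeasurable (g m) (μ m))
    (hfg : ∀ η : ℝ, 0 < η → Tendsto (fun m => μ m {ω | η < |f m ω - g m ω|}) atTop (𝓝 0)) {z : ℂ}
    (hz : Tendsto (fun m => ∫ ω, Complex.exp ((g m ω : ℝ) * Complex.I) ∂(μ m)) atTop (𝓝 z)) :
    Tendsto (fun m => ∫ ω, Complex.exp ((f m ω : ℝ) * Complex.I) ∂(μ m)) atTop (𝓝 z) := by
  refine tendsto_of_tendsto_of_dist hz ?_
  rw [Metric.tendsto_atTop]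
  intro δ hδ
  have h1 := hfg (δ / 2) (by positivity)
  have h2 : Tendsto (fun m => (μ m).real {ω | δ / 2 < |f m ω - g m ω|}) atTop (𝓝 0) := by
    have := (ENNReal.tendsto_toReal ENNReal.zero_ne_top).comp h1
    rwa [ENNReal.toReal_zero] at this
  obtain ⟨N, hN⟩ := eventually_atTop.1 (h2.eventually_lt_const (by positivity : 0 < δ / 4))
  refine ⟨N, fun m hm => ?_⟩
  rw [Real.dist_eq, sub_zero, abs_of_nonneg dist_nonneg, dist_comm, dist_eq_norm]
  have h3 := norm_integral_cexp_sub_le (hf m) (hg m) (by positivity : 0 ≤ δ / 2)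
  have h4 := hN m hm
  linarith

section Sequence

variable {n T d : ℕ → ℕ} {Ω : ℕ → Type*} [∀ m, MeasurableSpace (Ω m)] {μ : ∀ m, Measure (Ω m)}
  [∀ m, IsProbabilityMeasure (μ m)] {ε Y : ∀ m, Ω m → Fin (T m) → Fin (n m) → ℝ}
  {W : ∀ m, Fin (T m) → Fin (d m) → Matrix (Fin (n m)) (Fin (n m)) ℝ}
  {lam0 : ∀ m, Fin (d m) → ℝ} {s K ς r₀ Cw c C L : ℝ}
  {I0 : ∀ m, Matrix (Fin (d m + 1)) (Fin (d m + 1)) ℝ}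

/-! ### The asymptotic sequence -/

lemma tendsto_natCast_mul (hnT : Tendsto (fun m => n m * T m) atTop atTop) :
    Tendsto (fun m => (n m : ℝ) * T m) atTop atTop := by
  have := tendsto_natCast_atTop_atTop (R := ℝ).comp hnT
  refine this.congr fun m => ?_
  simp

lemma eventually_mul_pos (hnT : Tendsto (fun m => n m * T m) atTop atTop) :
    ∀ᶠ m in atTop, 0 < (n m : ℝ) * T m :=
  (tendsto_natCast_mul hnT).eventually_gt_atTop 0

/-- The growth condition makes the deviations negligible. -/
lemma tendsto_sq_mul_sqrt
    (hgrowth : Tendsto (fun m => (d m : ℝ) / ((n m : ℝ) * T m) ^ (1 / 4 : ℝ)) atTop (𝓝 0))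
    (L : ℝ) : Tendsto (fun m => (d m : ℝ) ^ 2 * √(L / ((n m : ℝ) * T m))) atTop (𝓝 0) := by
  have h1 := (hgrowth.pow 2).const_mul (√L)
  rw [zero_pow two_ne_zero, mul_zero] at h1
  refine h1.congr fun m => ?_
  have hN : 0 ≤ (n m : ℝ) * T m := by positivity
  have e : (((n m : ℝ) * T m) ^ (1 / 4 : ℝ)) ^ 2 = √((n m : ℝ) * T m) := by
    rw [← Real.rpow_natCast, ← Real.rpow_mul hN, Real.sqrt_eq_rpow]
    norm_num
  rw [div_pow, e, Real.sqrt_div' _ hN]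
  ring

/-- With probability close to one the deviation of the sample moments is bounded. -/
lemma exists_measure_sampleDev_le (hM : ∀ m, ModelAt (μ m) (ε m) (Y m) (W m) (lam0 m) s K ς r₀ Cw)
    (hnT : Tendsto (fun m => n m * T m) atTop atTop) {ξ : ℝ≥0∞} (hξ : 0 < ξ) :
    ∃ L : ℝ, 0 < L ∧ ∀ᶠ m in atTop,
      μ m {ω | L < sampleDev (whiten (W m) (lam0 m)) s (ε m ω)} ≤ ξ := by
  set F := 3 * ErrorCond.formBound (weightBound r₀ Cw ^ 2) s K with hF
  have h1 : Tendsto (fun L : ℝ => ENNReal.ofReal (F / L)) atTop (𝓝 0) := by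
    have := (ENNReal.continuous_ofReal.tendsto 0).comp
      (tendsto_const_nhds.div_atTop tendsto_id : Tendsto (fun L : ℝ => F / L) atTop (𝓝 0))
    rwa [ENNReal.ofReal_zero] at this
  obtain ⟨L, hL, hL0⟩ := ((h1.eventually_le_const hξ).and (eventually_gt_atTop 0)).exists
  refine ⟨L, hL0, ?_⟩
  filter_upwards [eventually_mul_pos hnT] with m hN
  exact (measure_sampleDev_gt_le (hM m).err (hM m).dim hN (one_le_weightBound (hM m).r_pos)
    (hM m).sumBdd hL0).trans hL

/-- For large sample sizes a bounded deviation of the sample moments puts the likelihood into the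
scope of the deterministic analysis. -/
lemma eventually_localSetup
    (hM : ∀ m, ModelAt (μ m) (ε m) (Y m) (W m) (lam0 m) s K ς r₀ Cw)
    (hnT : Tendsto (fun m => n m * T m) atTop atTop)
    (hgrowth : Tendsto (fun m => (d m : ℝ) / ((n m : ℝ) * T m) ^ (1 / 4 : ℝ)) atTop (𝓝 0))
    (hI : Tendsto (fun m => frobNorm (infoMat (μ m) (W m) (Y m) (mkParam (lam0 m) s) - I0 m))
      atTop (𝓝 0)) (hc : 0 < c) (hI0 : ∀ m, EigenBounds (I0 m) c (C * d m)) (hL : 0 ≤ L) :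
    ∀ᶠ m in atTop, 0 < (n m : ℝ) * T m ∧
      4 * linConst (weightBound r₀ Cw) s (c / 2) * ((d m : ℝ) ^ 2 * √(L / ((n m : ℝ) * T m)))
        ≤ c / 2 ∧
      (∀ v : Fin (d m + 1) → ℝ, c / 2 * l2Norm v ^ 2 ≤ infoForm (whiten (W m) (lam0 m)) s
        (lamPart v) (varPart v) (lamPart v) (varPart v)) ∧
      ∀ ω, sampleDev (whiten (W m) (lam0 m)) s (ε m ω) ≤ L →
        LocalSetup (W m) (Y m ω) (lam0 m) (ε m ω) ς r₀ (weightBound r₀ Cw) s (c / 2)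
          (radius r₀ (weightBound r₀ Cw) (c / 2))
          ((d m : ℝ) ^ 2 * √(L / ((n m : ℝ) * T m))) := by
  have hs := (hM 0).s_pos
  have hr := (hM 0).r_pos
  have hκ := tendsto_sq_mul_sqrt hgrowth L
  have k : ∀ x b : ℝ, 0 < b →
      ∀ᶠ m in atTop, x * ((d m : ℝ) ^ 2 * √(L / ((n m : ℝ) * T m))) < b := by
    intro x b hb
    have := hκ.const_mul x
    rw [mul_zero] at this
    exact this.eventually_lt_const hb
  filter_upwards [eventually_mul_pos hnT, hI.eventually_le_const (half_pos hc),
    k (4 * linConst (weightBound r₀ Cw) s (c / 2)) _ (half_pos hc), k 1 (s / 2) (by positivity),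
    k (20 * weightBound r₀ Cw ^ 2 / s) (c / 2 / 4) (by positivity),
    k (8 * weightBound r₀ Cw / (c / 2 * s)) _
      (radius_pos hr (one_le_weightBound hr) (half_pos hc))] with m hN hfrob k1 k2 k3 k4
  have hinfo := fun v => (hM m).infoForm_ge hN (hI0 m) hfrob v
  refine ⟨hN, k1.le, hinfo, fun ω hω => ?_⟩
  refine (hM m).localSetup (half_pos hc) hinfo
    (goodSample_of_sampleDev_le (hM m).dim hN hL hω) (by linarith) ?_ k4
  rw [mul_div_right_comm]
  exact k3.le

/-- Existence and uniqueness of the estimate. -/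
lemma tendsto_measure_not_existsUnique
    (hM : ∀ m, ModelAt (μ m) (ε m) (Y m) (W m) (lam0 m) s K ς r₀ Cw)
    (hnT : Tendsto (fun m => n m * T m) atTop atTop)
    (hgrowth : Tendsto (fun m => (d m : ℝ) / ((n m : ℝ) * T m) ^ (1 / 4 : ℝ)) atTop (𝓝 0))
    (hI : Tendsto (fun m => frobNorm (infoMat (μ m) (W m) (Y m) (mkParam (lam0 m) s) - I0 m))
      atTop (𝓝 0)) (hc : 0 < c) (hI0 : ∀ m, EigenBounds (I0 m) c (C * d m)) :
    Tendsto (fun m => μ m {ω | ¬ ∃! θ, IsNearQMLE ς (radius r₀ (weightBound r₀ Cw) (c / 2)) (W m)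
      (lam0 m) (Y m ω) θ}) atTop (𝓝 0) := by
  rw [ENNReal.tendsto_nhds_zero]
  intro ξ hξ
  obtain ⟨L, hL, hLm⟩ := exists_measure_sampleDev_le hM hnT hξ
  filter_upwards [hLm, eventually_localSetup hM hnT hgrowth hI hc hI0 hL.le] with m h1 h2
  refine (measure_mono fun ω hω => ?_).trans h1
  by_contra hcon
  exact hω (h2.2.2.2 ω (not_lt.1 hcon)).existsUnique_nearQMLE

/-- The constant of the rate of convergence. -/
noncomputable def rateConst (s c L : ℝ) : ℝ := 2 * scoreConst s / (c / 2) * √L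

lemma eventually_l2Norm_sub_le
    (hM : ∀ m, ModelAt (μ m) (ε m) (Y m) (W m) (lam0 m) s K ς r₀ Cw)
    (hnT : Tendsto (fun m => n m * T m) atTop atTop)
    (hgrowth : Tendsto (fun m => (d m : ℝ) / ((n m : ℝ) * T m) ^ (1 / 4 : ℝ)) atTop (𝓝 0))
    (hI : Tendsto (fun m => frobNorm (infoMat (μ m) (W m) (Y m) (mkParam (lam0 m) s) - I0 m))
      atTop (𝓝 0)) (hc : 0 < c) (hI0 : ∀ m, EigenBounds (I0 m) c (C * d m)) (hL : 0 ≤ L) :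
    ∀ᶠ m in atTop, ∀ ω θ, sampleDev (whiten (W m) (lam0 m)) s (ε m ω) ≤ L →
      IsNearQMLE ς (radius r₀ (weightBound r₀ Cw) (c / 2)) (W m) (lam0 m) (Y m ω) θ →
      l2Norm (θ - mkParam (lam0 m) s) ≤ rateConst s c L * √((d m : ℝ) / ((n m : ℝ) * T m)) := by
  filter_upwards [eventually_localSetup hM hnT hgrowth hI hc hI0 hL] with m h ω θ hω hθ
  obtain ⟨hN, hlin, hinfo, hset⟩ := h
  refine ((hset ω hω).l2Norm_sub_le (Real.sqrt_nonneg _) hlin hinfo hθ).trans (le_of_eq ?_)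
  rw [rateConst, Real.sqrt_div' _ hN.le, Real.sqrt_div' _ hN.le]
  ring

/-- The estimate converges at the rate `(d / nT) ^ (1 / 2)`. -/
lemma exists_eventually_measure_l2Norm_sub_le
    (hM : ∀ m, ModelAt (μ m) (ε m) (Y m) (W m) (lam0 m) s K ς r₀ Cw)
    (hnT : Tendsto (fun m => n m * T m) atTop atTop)
    (hgrowth : Tendsto (fun m => (d m : ℝ) / ((n m : ℝ) * T m) ^ (1 / 4 : ℝ)) atTop (𝓝 0))
    (hI : Tendsto (fun m => frobNorm (infoMat (μ m) (W m) (Y m) (mkParam (lam0 m) s) - I0 m))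
      atTop (𝓝 0)) (hc : 0 < c) (hI0 : ∀ m, EigenBounds (I0 m) c (C * d m))
    {θhat : ∀ m, Ω m → Fin (d m + 1) → ℝ}
    (hθ : Tendsto (fun m => μ m {ω | ¬ IsNearQMLE ς (radius r₀ (weightBound r₀ Cw) (c / 2)) (W m)
      (lam0 m) (Y m ω) (θhat m ω)}) atTop (𝓝 0)) {ξ : ℝ≥0∞} (hξ : 0 < ξ) :
    ∃ R : ℝ, ∀ᶠ m in atTop, μ m {ω | R * √((d m : ℝ) / ((n m : ℝ) * T m)) <
      l2Norm (θhat m ω - mkParam (lam0 m) s)} ≤ ξ := by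
  have hξ2 : 0 < ξ / 2 := ENNReal.half_pos hξ.ne'
  obtain ⟨L, hL, hLm⟩ := exists_measure_sampleDev_le hM hnT hξ2
  refine ⟨rateConst s c L, ?_⟩
  filter_upwards [hLm, hθ.eventually_le_const hξ2,
    eventually_l2Norm_sub_le hM hnT hgrowth hI hc hI0 hL.le] with m h1 h2 h3
  refine (measure_mono (t := {ω | L < sampleDev (whiten (W m) (lam0 m)) s (ε m ω)} ∪
    {ω | ¬ IsNearQMLE ς (radius r₀ (weightBound r₀ Cw) (c / 2)) (W m)
      (lam0 m) (Y m ω) (θhat m ω)}) fun ω hω => ?_).trans ((measure_union_le _ _).trans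
      ((add_le_add h1 h2).trans (ENNReal.add_halves ξ).le))
  by_contra hcon
  rw [Set.mem_union, not_or] at hcon
  exact absurd (h3 ω _ (not_lt.1 hcon.1) (not_not.1 hcon.2)) (not_le.2 hω)

/-! ### Asymptotic normality -/

variable {M : ℕ} {D : ∀ m, Matrix (Fin M) (Fin (d m + 1)) ℝ} {CD : ℝ}
  {J0 : ∀ m, Matrix (Fin (d m + 1)) (Fin (d m + 1)) ℝ} {G : Matrix (Fin M) (Fin M) ℝ}

/-- The leading term of the estimation error in the direction `u`. -/
noncomputable def leadTerm (W : ∀ m, Fin (T m) → Fin (d m) → Matrix (Fin (n m)) (Fin (n m)) ℝ)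
    (lam0 : ∀ m, Fin (d m) → ℝ) (s : ℝ) (D : ∀ m, Matrix (Fin M) (Fin (d m + 1)) ℝ)
    (u : Fin M → ℝ) (m : ℕ) (t : Fin (T m)) : Matrix (Fin (n m)) (Fin (n m)) ℝ :=
  scoreMat (whiten (W m) (lam0 m)) s ((√(d m : ℝ))⁻¹ • ((D m)ᵀ *ᵥ u)) t

omit [∀ m, IsProbabilityMeasure (μ m)] in
lemma sumBdd_leadTerm (hM : ∀ m, ModelAt (μ m) (ε m) (Y m) (W m) (lam0 m) s K ς r₀ Cw)
    (hD : ∀ m, specNorm (D m) ≤ CD) (u : Fin M → ℝ) (m : ℕ) (t : Fin (T m)) :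
    SumBdd (leadTerm W lam0 s D u m t)
      ((s⁻¹ * weightBound r₀ Cw + (2 * s ^ 2)⁻¹) * (CD * l2Norm u)) := by
  have hs := (hM m).s_pos
  have hd1 : (1 : ℝ) ≤ d m := by exact_mod_cast (hM m).dim
  have hsd : 1 ≤ √(d m : ℝ) := Real.one_le_sqrt.2 hd1
  have hsd0 : 0 < √(d m : ℝ) := by linarith
  have ha : 0 ≤ weightBound r₀ Cw := zero_le_one.trans (one_le_weightBound (hM m).r_pos)
  refine (SumBdd.scoreMat s (hM m).sumBdd hs _ t).mono ?_
  set v := (D m)ᵀ *ᵥ u with hv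
  have hvle : l2Norm v ≤ CD * l2Norm u :=
    (l2Norm_transpose_mulVec_le (D m) u).trans
      (mul_le_mul_of_nonneg_right (hD m) (l2Norm_nonneg u))
  rw [lamPart_smul, varPart_smul, l1Norm_smul, abs_mul, abs_of_pos (inv_pos.2 hsd0)]
  have h1 : (√(d m : ℝ))⁻¹ * l1Norm (lamPart v) ≤ CD * l2Norm u := by
    rw [inv_mul_le_iff₀ hsd0]
    exact (l1Norm_le_sqrt_mul _).trans
      (mul_le_mul_of_nonneg_left ((l2Norm_lamPart_le v).trans hvle) hsd0.le)
  have h2 : (√(d m : ℝ))⁻¹ * |varPart v| ≤ CD * l2Norm u :=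
    (mul_le_of_le_one_left (abs_nonneg _) (inv_le_one_of_one_le₀ hsd)).trans
      ((abs_varPart_le v).trans hvle)
  calc _ ≤ s⁻¹ * (weightBound r₀ Cw * (CD * l2Norm u)) + CD * l2Norm u / (2 * s ^ 2) := by gcongr
    _ = _ := by ring

/-- The variance of the leading term converges. -/
lemma tendsto_integral_leadTerm_sq
    (hM : ∀ m, ModelAt (μ m) (ε m) (Y m) (W m) (lam0 m) s K ς r₀ Cw)
    (hJ : Tendsto (fun m => specNorm (scoreVar (μ m) (W m) (Y m) (mkParam (lam0 m) s) - J0 m))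
      atTop (𝓝 0)) (hD : ∀ m, specNorm (D m) ≤ CD)
    (hG : Tendsto (fun m => (d m : ℝ)⁻¹ • (D m * J0 m * (D m)ᵀ)) atTop (𝓝 G)) (u : Fin M → ℝ) :
    Tendsto (fun m => ∫ ω, ((√((n m : ℝ) * T m))⁻¹
      * formSum s (leadTerm W lam0 s D u m) (ε m ω)) ^ 2 ∂(μ m)) atTop (𝓝 (u ⬝ᵥ (G *ᵥ u))) := by
  have hlim : Tendsto (fun m => (d m : ℝ)⁻¹ *
      (((D m)ᵀ *ᵥ u) ⬝ᵥ (J0 m *ᵥ ((D m)ᵀ *ᵥ u)))) atTop (𝓝 (u ⬝ᵥ (G *ᵥ u))) := by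
    have hc : Continuous fun A : Matrix (Fin M) (Fin M) ℝ => u ⬝ᵥ (A *ᵥ u) :=
      continuous_const.dotProduct (continuous_id.matrix_mulVec continuous_const)
    refine ((hc.tendsto G).comp hG).congr fun m => ?_
    simp only [Function.comp_apply, Matrix.smul_mulVec, dotProduct_smul, smul_eq_mul]
    rw [← Matrix.mulVec_mulVec, ← Matrix.mulVec_mulVec, Matrix.dotProduct_mulVec u (D m),
      Matrix.mulVec_transpose]
  have e : ∀ m, ∫ ω, ((√((n m : ℝ) * T m))⁻¹ * formSum s (leadTerm W lam0 s D u m) (ε m ω)) ^ 2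
      ∂(μ m) = (d m : ℝ)⁻¹ * (((D m)ᵀ *ᵥ u) ⬝ᵥ
        (scoreVar (μ m) (W m) (Y m) (mkParam (lam0 m) s) *ᵥ ((D m)ᵀ *ᵥ u))) := by
    intro m
    rw [dotProduct_scoreVar_mulVec (hM m).err ((hM m).weight.isUnit_self (hM m).r_pos)
      (hM m).delta_mulVec (hM m).s_pos]
    have e1 : ∀ ω, ((√((n m : ℝ) * T m))⁻¹ * formSum s (leadTerm W lam0 s D u m) (ε m ω)) ^ 2
        = ((d m : ℝ)⁻¹ * ((n m : ℝ) * T m)⁻¹) *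
          formSum s (scoreMat (whiten (W m) (lam0 m)) s ((D m)ᵀ *ᵥ u)) (ε m ω) ^ 2 := by
      intro ω
      have : leadTerm W lam0 s D u m
        = scoreMat (whiten (W m) (lam0 m)) s ((√(d m : ℝ))⁻¹ • ((D m)ᵀ *ᵥ u)) := rfl
      rw [this, formSum_scoreMat_smul, mul_pow, mul_pow, inv_pow, inv_pow,
        Real.sq_sqrt (by positivity), Real.sq_sqrt (by positivity)]
      ring
    simp only [e1]
    rw [integral_const_mul, mul_assoc]
  simp only [e]
  have hdiff : Tendsto (fun m => (d m : ℝ)⁻¹ * (((D m)ᵀ *ᵥ u) ⬝ᵥ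
      ((scoreVar (μ m) (W m) (Y m) (mkParam (lam0 m) s) - J0 m) *ᵥ ((D m)ᵀ *ᵥ u))))
      atTop (𝓝 0) := by
    have h0 := hJ.mul_const ((CD * l2Norm u) ^ 2)
    rw [zero_mul] at h0
    refine squeeze_zero_norm (fun m => ?_) h0
    have hd1 : (1 : ℝ) ≤ d m := by exact_mod_cast (hM m).dim
    have hvle : l2Norm ((D m)ᵀ *ᵥ u) ≤ CD * l2Norm u :=
      (l2Norm_transpose_mulVec_le (D m) u).trans
        (mul_le_mul_of_nonneg_right (hD m) (l2Norm_nonneg u))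
    rw [Real.norm_eq_abs, abs_mul, abs_of_nonneg (by positivity : (0 : ℝ) ≤ (d m : ℝ)⁻¹)]
    refine (mul_le_of_le_one_left (abs_nonneg _) (inv_le_one_of_one_le₀ hd1)).trans ?_
    refine (abs_dotProduct_mulVec_le_specNorm _ _).trans ?_
    exact mul_le_mul_of_nonneg_left (pow_le_pow_left₀ (l2Norm_nonneg _) hvle 2)
      (specNorm_nonneg _)
  have h := hdiff.add hlim
  rw [zero_add] at h
  refine h.congr fun m => ?_
  rw [Matrix.sub_mulVec, dotProduct_sub]
  ring

/-- Every linear functional of the normalized estimation error is asymptotically normal. -/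
lemma tendsto_integral_cexp_estimate
    (hM : ∀ m, ModelAt (μ m) (ε m) (Y m) (W m) (lam0 m) s K ς r₀ Cw)
    (hnT : Tendsto (fun m => n m * T m) atTop atTop)
    (hregime : (∀ m t, iIndepFun (fun i ω => ε m ω t i) (μ m)) ∨ Tendsto T atTop atTop)
    (hgrowth : Tendsto (fun m => (d m : ℝ) / ((n m : ℝ) * T m) ^ (1 / 4 : ℝ)) atTop (𝓝 0))
    (hI : Tendsto (fun m => frobNorm (infoMat (μ m) (W m) (Y m) (mkParam (lam0 m) s) - I0 m))
      atTop (𝓝 0)) (hc : 0 < c) (hI0 : ∀ m, EigenBounds (I0 m) c (C * d m))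
    (hJ : Tendsto (fun m => specNorm (scoreVar (μ m) (W m) (Y m) (mkParam (lam0 m) s) - J0 m))
      atTop (𝓝 0)) (hD : ∀ m, specNorm (D m) ≤ CD)
    (hG : Tendsto (fun m => (d m : ℝ)⁻¹ • (D m * J0 m * (D m)ᵀ)) atTop (𝓝 G))
    {θhat : ∀ m, Ω m → Fin (d m + 1) → ℝ} (hmeas : ∀ m, AEMeasurable (θhat m) (μ m))
    (hθ : Tendsto (fun m => μ m {ω | ¬ IsNearQMLE ς (radius r₀ (weightBound r₀ Cw) (c / 2)) (W m)
      (lam0 m) (Y m ω) (θhat m ω)}) atTop (𝓝 0)) (u : Fin M → ℝ) :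
    Tendsto (fun m => ∫ ω, Complex.exp ((√((n m : ℝ) * T m / d m) *
        (((D m)ᵀ *ᵥ u) ⬝ᵥ (I0 m *ᵥ (θhat m ω - mkParam (lam0 m) s))) : ℝ) * Complex.I) ∂(μ m))
      atTop (𝓝 ((Real.exp (-(u ⬝ᵥ (G *ᵥ u)) / 2) : ℝ) : ℂ)) := by
  have hs := (hM 0).s_pos
  have hvar := tendsto_integral_leadTerm_sq hM hJ hD hG u
  have hlead : Tendsto (fun m => ∫ ω, Complex.exp (((√((n m : ℝ) * T m))⁻¹ *
      formSum s (leadTerm W lam0 s D u m) (ε m ω) : ℝ) * Complex.I) ∂(μ m))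
      atTop (𝓝 ((Real.exp (-(u ⬝ᵥ (G *ᵥ u)) / 2) : ℝ) : ℂ)) := by
    rcases hregime with hind | hT
    · exact tendsto_integral_exp_formSum_of_indep hnT (fun m => (hM m).err) hind hs.le
        (sumBdd_leadTerm hM hD u) hvar
    · exact tendsto_integral_exp_formSum_of_tendsto hnT (fun m => (hM m).err) hT
        (sumBdd_leadTerm hM hD u) hvar
  refine tendsto_integral_cexp_of_close (fun m => ?_) (fun m => ?_) (fun η hη => ?_) hlead
  · refine AEMeasurable.const_mul ?_ _
    have hmc : Measurable fun θ : Fin (d m + 1) → ℝ =>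
        ((D m)ᵀ *ᵥ u) ⬝ᵥ (I0 m *ᵥ (θ - mkParam (lam0 m) s)) :=
      (continuous_const.dotProduct (continuous_const.matrix_mulVec
        (continuous_id.sub continuous_const))).measurable
    exact hmc.comp_aemeasurable (hmeas m)
  · exact (((hM m).err.hasMoments_formSum _).const_mul _).integrable.aemeasurable
  · rw [ENNReal.tendsto_nhds_zero]
    intro ξ hξ
    have hξ2 : 0 < ξ / 2 := ENNReal.half_pos hξ.ne'
    obtain ⟨L, hL, hLm⟩ := exists_measure_sampleDev_le hM hnT hξ2
    have hsmall : Tendsto (fun m => (frobNorm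
        (infoMat (μ m) (W m) (Y m) (mkParam (lam0 m) s) - I0 m)
          + 2 * linConst (weightBound r₀ Cw) s (c / 2)
            * ((d m : ℝ) ^ 2 * √(L / ((n m : ℝ) * T m)))) * (CD * l2Norm u) * rateConst s c L)
        atTop (𝓝 0) := by
      have := ((hI.add ((tendsto_sq_mul_sqrt hgrowth L).const_mul
        (2 * linConst (weightBound r₀ Cw) s (c / 2)))).mul_const (CD * l2Norm u)).mul_const
          (rateConst s c L)
      simpa using this
    filter_upwards [hLm, hθ.eventually_le_const hξ2, hsmall.eventually_le_const hη,
      eventually_l2Norm_sub_le hM hnT hgrowth hI hc hI0 hL.le,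
      eventually_localSetup hM hnT hgrowth hI hc hI0 hL.le] with m h1 h2 h3 h4 h5
    obtain ⟨hN, -, -, hset⟩ := h5
    refine (measure_mono (t := {ω | L < sampleDev (whiten (W m) (lam0 m)) s (ε m ω)} ∪
      {ω | ¬ IsNearQMLE ς (radius r₀ (weightBound r₀ Cw) (c / 2)) (W m)
        (lam0 m) (Y m ω) (θhat m ω)}) fun ω hω => ?_).trans ((measure_union_le _ _).trans
        ((add_le_add h1 h2).trans (ENNReal.add_halves ξ).le))
    by_contra hcon
    rw [Set.mem_union, not_or] at hcon
    have hX : sampleDev (whiten (W m) (lam0 m)) s (ε m ω) ≤ L := not_lt.1 hcon.1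
    have hnear := not_not.1 hcon.2
    have hd0 : (0 : ℝ) < d m := by exact_mod_cast (hM m).dim
    have hrate : √((n m : ℝ) * T m / d m) * l2Norm (θhat m ω - mkParam (lam0 m) s)
        ≤ rateConst s c L := by
      have h6 := mul_le_mul_of_nonneg_left (h4 ω _ hX hnear)
        (Real.sqrt_nonneg ((n m : ℝ) * T m / d m))
      have h7 : √((n m : ℝ) * T m / d m) * √((d m : ℝ) / ((n m : ℝ) * T m)) = 1 := by
        rw [← Real.sqrt_mul (by positivity), div_mul_div_cancel₀ hd0.ne', div_self hN.ne',
          Real.sqrt_one]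
      linear_combination h6 + rateConst s c L * h7
    have h8 := (hset ω hX).abs_dotProduct_mulVec_sub_formSum_le (I0 := I0 m) (by positivity) le_rfl
      ((hM m).dotProduct_infoMat_mulVec hN) hnear hrate ((D m)ᵀ *ᵥ u)
    have hlc : 0 ≤ linConst (weightBound r₀ Cw) s (c / 2) :=
      linConst_nonneg (by linarith [one_le_weightBound (Cw := Cw) (hM m).r_pos]) hs (half_pos hc)
    have hrc : 0 ≤ rateConst s c L := by
      unfold rateConst scoreConst
      positivity
    have hvle : l2Norm ((D m)ᵀ *ᵥ u) ≤ CD * l2Norm u :=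
      (l2Norm_transpose_mulVec_le (D m) u).trans
        (mul_le_mul_of_nonneg_right (hD m) (l2Norm_nonneg u))
    have hfr := frobNorm_nonneg (infoMat (μ m) (W m) (Y m) (mkParam (lam0 m) s) - I0 m)
    refine absurd (h8.trans (le_trans ?_ h3)) (not_le.2 hω)
    gcongr

/-- The limit covariance matrix is positive semidefinite. -/
lemma posSemidef_of_tendsto {c' : ℝ} {C' : ℕ → ℝ} (hJ0 : ∀ m, EigenBounds (J0 m) c' (C' m))
    (hG : Tendsto (fun m => (d m : ℝ)⁻¹ • (D m * J0 m * (D m)ᵀ)) atTop (𝓝 G)) : G.PosSemidef := by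
  have hm : ∀ m, ((d m : ℝ)⁻¹ • (D m * J0 m * (D m)ᵀ)).PosSemidef := by
    intro m
    have h1 := (hJ0 m).1.posSemidef.mul_mul_conjTranspose_same (D m)
    rw [Matrix.conjTranspose_eq_transpose_of_trivial] at h1
    exact h1.smul (by positivity)
  refine Matrix.PosSemidef.of_dotProduct_mulVec_nonneg ?_ fun x => ?_
  · have hc : Continuous fun A : Matrix (Fin M) (Fin M) ℝ => Aᴴ :=
      continuous_id.matrix_conjTranspose
    exact tendsto_nhds_unique (((hc.tendsto G).comp hG).congr fun m => (hm m).1) hG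
  · have hc : Continuous fun A : Matrix (Fin M) (Fin M) ℝ => star x ⬝ᵥ (A *ᵥ x) :=
      continuous_const.dotProduct (continuous_id.matrix_mulVec continuous_const)
    exact ge_of_tendsto' ((hc.tendsto G).comp hG) fun m => (hm m).dotProduct_mulVec_nonneg x

end Sequence

end MIR

theorem theorem1
    -- sample sizes and numbers of similarity matrices along the asymptotic sequence
    (n T d : ℕ → ℕ) (hd : ∀ m, 1 ≤ d m)
    (hnT : Tendsto (fun m => n m * T m) atTop atTop)
    -- probability spaces, errors, responses, similarity matrices, true parameters
    {Ω : ℕ → Type*} [∀ m, MeasurableSpace (Ω m)]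
    (μ : ∀ m, Measure (Ω m)) [∀ m, IsProbabilityMeasure (μ m)]
    (ε Y : ∀ m, Ω m → Fin (T m) → Fin (n m) → ℝ)
    (W : ∀ m, Fin (T m) → Fin (d m) → Matrix (Fin (n m)) (Fin (n m)) ℝ)
    (lam0 : ∀ m, Fin (d m) → ℝ) (s0 : ℝ) (hs0 : 0 < s0)
    -- the model
    (hmodel : ∀ m ω t, Y m ω t = MIR.influence (W m t) (lam0 m) *ᵥ Y m ω t + ε m ω t)
    -- errors
    (K : ℝ) (herr : ∀ m, MIR.ErrorCond (μ m) (ε m) s0 K)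
    (hregime : (∀ m t, iIndepFun (fun i ω => ε m ω t i) (μ m)) ∨ Tendsto T atTop atTop)
    -- parameter space and similarity matrices
    (ς : ℝ) (hς : ς ∈ Set.Ioo (0 : ℝ) 1) (r0 Cw : ℝ) (hr0 : 0 < r0)
    (hW : ∀ m, MIR.WeightCond (W m) (lam0 m) ς r0 Cw)
    -- information matrices
    (I0 J0 : ∀ m, Matrix (Fin (d m + 1)) (Fin (d m + 1)) ℝ)
    (hI : Tendsto (fun m => MIR.frobNorm
      (MIR.infoMat (μ m) (W m) (Y m) (MIR.mkParam (lam0 m) s0) - I0 m)) atTop (𝓝 0))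
    (hJ : Tendsto (fun m => MIR.specNorm
      (MIR.scoreVar (μ m) (W m) (Y m) (MIR.mkParam (lam0 m) s0) - J0 m)) atTop (𝓝 0))
    (c₁ c₂ C₁ C₂ : ℝ) (hc₁ : 0 < c₁) (hc₂ : 0 < c₂)
    (hI0 : ∀ m, MIR.EigenBounds (I0 m) c₁ (C₁ * d m))
    (hJ0 : ∀ m, MIR.EigenBounds (J0 m) c₂ (C₂ * d m))
    -- growth of `d` and sparsity of the true coefficients
    (hgrowth : Tendsto (fun m => (d m : ℝ) / ((n m : ℝ) * T m) ^ (1 / 4 : ℝ)) atTop (𝓝 0))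
    (S : ℕ) (hsparse : ∀ m, Set.ncard {k | lam0 m k ≠ 0} ≤ S) :
    ∃ r > 0,
      -- with probability tending to one there is exactly one QMLE near the true parameter
      Tendsto (fun m => μ m {ω | ¬ ∃! θ, MIR.IsNearQMLE ς r (W m) (lam0 m) (Y m ω) θ})
        atTop (𝓝 0) ∧
      ∀ θhat : ∀ m, Ω m → Fin (d m + 1) → ℝ,
        (∀ m, AEMeasurable (θhat m) (μ m)) →
        Tendsto (fun m => μ m {ω | ¬ MIR.IsNearQMLE ς r (W m) (lam0 m) (Y m ω) (θhat m ω)})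
          atTop (𝓝 0) →
        -- consistency at the rate `(nT/d)^{1/2}`
        (∀ ξ : ℝ≥0∞, 0 < ξ → ∃ C : ℝ, ∀ᶠ m in atTop,
          μ m {ω | C * √((d m : ℝ) / ((n m : ℝ) * T m)) <
            MIR.l2Norm (θhat m ω - MIR.mkParam (lam0 m) s0)} ≤ ξ) ∧
        -- asymptotic normality
        ∀ (M : ℕ) (D : ∀ m, Matrix (Fin M) (Fin (d m + 1)) ℝ) (G : Matrix (Fin M) (Fin M) ℝ)
          (CD : ℝ),
          (∀ m, MIR.specNorm (D m) ≤ CD) →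
          Tendsto (fun m => (d m : ℝ)⁻¹ • (D m * J0 m * (D m)ᵀ)) atTop (𝓝 G) →
          TendstoInDistribution
            (fun m ω => WithLp.toLp 2
              (√((n m : ℝ) * T m / d m) •
                ((D m * I0 m) *ᵥ (θhat m ω - MIR.mkParam (lam0 m) s0))))
            atTop (id : EuclideanSpace ℝ (Fin M) → EuclideanSpace ℝ (Fin M)) μ
            (multivariateGaussian 0 G) := by
  have hM : ∀ m, MIR.ModelAt (μ m) (ε m) (Y m) (W m) (lam0 m) s0 K ς r0 Cw := fun m =>
    ⟨hd m, hs0, hr0, hmodel m, herr m, hW m⟩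
  refine ⟨MIR.radius r0 (MIR.weightBound r0 Cw) (c₁ / 2),
    MIR.radius_pos hr0 (MIR.one_le_weightBound hr0) (half_pos hc₁),
    MIR.tendsto_measure_not_existsUnique hM hnT hgrowth hI hc₁ hI0,
    fun θhat hmeas hθ => ⟨fun ξ hξ =>
      MIR.exists_eventually_measure_l2Norm_sub_le hM hnT hgrowth hI hc₁ hI0 hθ hξ,
      fun M D G CD hD hG => ?_⟩⟩
  have hX : ∀ m, AEMeasurable (fun ω => WithLp.toLp 2 (√((n m : ℝ) * T m / d m) •
      ((D m * I0 m) *ᵥ (θhat m ω - MIR.mkParam (lam0 m) s0)))) (μ m) := by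
    intro m
    have h1 : Continuous fun θ : Fin (d m + 1) → ℝ =>
        (D m * I0 m) *ᵥ (θ - MIR.mkParam (lam0 m) s0) :=
      continuous_const.matrix_mulVec (continuous_id.sub continuous_const)
    have hc : Continuous fun θ : Fin (d m + 1) → ℝ => WithLp.toLp 2 (√((n m : ℝ) * T m / d m) •
        ((D m * I0 m) *ᵥ (θ - MIR.mkParam (lam0 m) s0))) :=
      (PiLp.continuous_toLp 2 _).comp
        ((continuous_const_smul (√((n m : ℝ) * T m / d m))).comp h1)
    exact hc.measurable.comp_aemeasurable (hmeas m)
  refine ⟨hX, by fun_prop, ProbabilityMeasure.tendsto_iff_tendsto_charFun.2 fun x => ?_⟩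
  set u : Fin M → ℝ := WithLp.ofLp x with hu
  have hlim := MIR.tendsto_integral_cexp_estimate hM hnT hregime hgrowth hI hc₁ hI0 hJ hD hG hmeas
    hθ u
  have e1 : charFun ((multivariateGaussian 0 G).map
      (id : EuclideanSpace ℝ (Fin M) → EuclideanSpace ℝ (Fin M))) x
      = ((Real.exp (-(u ⬝ᵥ (G *ᵥ u)) / 2) : ℝ) : ℂ) := by
    rw [Measure.map_id, charFun_multivariateGaussian (MIR.posSemidef_of_tendsto hJ0 hG),
      inner_zero_right]
    push_cast
    congr 1
    ring
  have e2 : ∀ m, charFun ((μ m).map (fun ω => WithLp.toLp 2 (√((n m : ℝ) * T m / d m) •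
      ((D m * I0 m) *ᵥ (θhat m ω - MIR.mkParam (lam0 m) s0))))) x
      = ∫ ω, Complex.exp ((√((n m : ℝ) * T m / d m) * (((D m)ᵀ *ᵥ u) ⬝ᵥ
        (I0 m *ᵥ (θhat m ω - MIR.mkParam (lam0 m) s0))) : ℝ) * Complex.I) ∂(μ m) := by
    intro m
    rw [charFun_apply, integral_map (hX m) (by fun_prop)]
    refine integral_congr_ae (Eventually.of_forall fun ω => ?_)
    have e3 : inner ℝ (WithLp.toLp 2 (√((n m : ℝ) * T m / d m) •
        ((D m * I0 m) *ᵥ (θhat m ω - MIR.mkParam (lam0 m) s0)))) x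
        = √((n m : ℝ) * T m / d m) * (((D m)ᵀ *ᵥ u) ⬝ᵥ
          (I0 m *ᵥ (θhat m ω - MIR.mkParam (lam0 m) s0))) := by
      rw [EuclideanSpace.inner_eq_star_dotProduct, star_trivial, dotProduct_smul, smul_eq_mul,
        ← Matrix.mulVec_mulVec, Matrix.dotProduct_mulVec, Matrix.mulVec_transpose]
    simp only [e3]
  simp only [ProbabilityMeasure.coe_mk]
  rw [e1]
  exact hlim.congr fun m => (e2 m).symm
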